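/- Let $(\Omega,\mathcal F,\mathbb P)$ be a probability space and let $X=\{X(s):s\in\mathbb R^2\}$ be a real-valued random field with $C^2$ sample paths. Fix $t>0$ and $T=[-t,t]^2$. Write $X_1,X_2$ for the first order and $X_{11},X_{22}$ for the pure second order partial derivatives of $X$. Assume that for every level $v\in\mathbb R$ the following hold almost surely: (1) $X$ has no critical point $s\in T$ with $X(s)=v$; (2) the restriction of $X$ to each of the four (open) sides of $T$ has no local extremum at the level $v$; (3) for $k\in\{1,2\}$ there is no $s\in T$ with $X(s)-v=X_k(s)=X_{kk}(s)=0$. For $u\in\mathbb R$ put $E_X(u)=\{s\in\mathbb R^2:X(s)\ge u\}$ and $P_X^T(u)=\mathcal H^1\big(T\cap\partial E_X(u)\big)$, where $\mathcal H^1$ is the one-dimensional Hausdorff measure. For $\epsilon>0$ and $i,j\in\mathbb N_0$ let $s_{i,j}=(-t+i\epsilon,-t+j\epsilon)$ and $\zeta_{i,j}=\mathbf 1\{X(s_{i,j})\ge u\}$, let $\mathcal G^{(T,\epsilon)}=\{s_{i,j}:i,j\in\mathbb N_0\}\cap T$ be the grid, let $M$ be its number of rows, and for $m\in\mathbb N^+$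 let $I$ be the set of the multiples of $m$ in $\{0,\dots,M-1\}$. For $a,b\in I$ let $$N_h(a,b)=\sum_{i=a}^{(a+m-1)\wedge(M-1)}\ \sum_{j=b}^{(b+m-1)\wedge(M-2)}|\zeta_{i,j}-\zeta_{i,j+1}|,\qquad N_v(a,b)=\sum_{i=a}^{(a+m-1)\wedge(M-2)}\ \sum_{j=b}^{(b+m-1)\wedge(M-1)}|\zeta_{i,j}-\zeta_{i+1,j}|,$$ and define the 2-norm estimator $$\hat P_X^{(2)}(\epsilon,m;T,u)=\epsilon\sum_{a\in I}\sum_{b\in I}\sqrt{N_h(a,b)^2+N_v(a,b)^2}.$$ Let $(m_n)_{n\ge1}$ be a non-decreasing sequence of positive integers with $m_n\to\infty$, and let $(\epsilon_n)_{n\ge1}$ be a sequence of positive reals such that $m_n\epsilon_n^{2/3}\to C$ for some constant $C>0$ and such that for every $n$ the four vertices of $T$ belong to $\mathcal G^{(T,\epsilon_n)}$. Fix $u\in\mathbb R$. Then $P_X^T(u)<\infty$ almost surely, and for every non-decreasing real sequence $(g_n)_{n\ge1}$ with $g_n=o(m_n)$, $$g_n\,\big|\hat P_X^{(2)}(\epsilon_n,m_n;T,u)-P_X^T(u)\big|\longrightarrow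 0\quad\text{almost surely as } n\to\infty .$$ Moreover the speed of convergence is $O(1/m_n)$: almost surely, $\hat P_X^{(2)}(\epsilon_n,m_n;T,u)-P_X^T(u)=O(1/m_n)$ as $n\to\infty$ (the implied constant may depend on the sample path). -/

import Mathlib

open MeasureTheory Filter Topology Asymptotics
open scoped ENNReal

namespace ExcursionPerimeter

noncomputable section

/-- The Euclidean plane. -/
abbrev Plane : Type := EuclideanSpace ℝ (Fin 2)

/-- The closed square `T = [-t, t]²`. -/
def square (t : ℝ) : Set Plane := {s | ∀ k, s k ∈ Set.Icc (-t) t}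

/-- The vertices of the square `[-t, t]²`. -/
def vertices (t : ℝ) : Set Plane := {s | ∀ k, s k = -t ∨ s k = t}

/-- The side of the square `[-t, t]²` on which the coordinate `k` is constant, equal to `c`
(to be used with `c = -t` and `c = t`), without its two end points. -/
def side (t : ℝ) (k : Fin 2) (c : ℝ) : Set Plane :=
  {s | s k = c ∧ ∀ l, l ≠ k → s l ∈ Set.Ioo (-t) t}

/-- The excursion set of `f` at the level `u`. -/
def excursionSet (f : Plane → ℝ) (u : ℝ) : Set Plane := {s | u ≤ f s}

/-- The part in `[-t, t]²` of the boundary (in the plane) of the excursion set. -/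
def excursionBoundary (f : Plane → ℝ) (t u : ℝ) : Set Plane :=
  square t ∩ frontier (excursionSet f u)

/-- The one-dimensional Hausdorff measure of the boundary of the excursion set in `[-t, t]²`. -/
def perimeter (f : Plane → ℝ) (t u : ℝ) : ℝ≥0∞ := μH[1] (excursionBoundary f t u)

/-- The partial derivative of `f` in the direction of the coordinate `k`. -/
def partialDeriv (k : Fin 2) (f : Plane → ℝ) (s : Plane) : ℝ :=
  fderiv ℝ f s (EuclideanSpace.single k 1)

/-- The regularity conditions on a sample path `f` at the level `u` in `[-t, t]²`. -/
structure RegularAtLevel (f : Plane → ℝ) (t u : ℝ) : Prop where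
  /-- There are no critical points at the level `u`. -/
  no_critical : ∀ s ∈ square t, f s = u → ∃ k, partialDeriv k f s ≠ 0
  /-- The restriction to each side of the square has no local extrema at the level `u`. -/
  no_extremum_side : ∀ (k : Fin 2) (c : ℝ), c = -t ∨ c = t → ∀ s ∈ side t k c,
    f s = u → ¬ IsLocalExtrOn f (side t k c) s
  /-- `f - u`, `f_k` and `f_kk` have no common zero. -/
  no_degenerate : ∀ (k : Fin 2), ∀ s ∈ square t,
    ¬ (f s = u ∧ partialDeriv k f s = 0 ∧ partialDeriv k (partialDeriv k f) s = 0)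

/-- The point `s_{i,j} = (-t + i ε, -t + j ε)`. -/
def gridPoint (t ε : ℝ) (i j : ℕ) : Plane := !₂[-t + i * ε, -t + j * ε]

/-- The grid of the points `s_{i,j}`, `i, j ∈ ℕ`, that lie in `[-t, t]²`. -/
def grid (t ε : ℝ) : Set Plane := {s | ∃ i j : ℕ, s = gridPoint t ε i j} ∩ square t

/-- The number of rows (and of columns) of the grid. -/
def numRows (t ε : ℝ) : ℕ := Set.ncard {j : ℕ | ∃ i : ℕ, gridPoint t ε i j ∈ grid t ε}

/-- The indices in `{0, …, M - 1}` that are divisible by `m`, where `M` is the number of rows. -/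
def blockIndices (t ε : ℝ) (m : ℕ) : Finset ℕ :=
  (Finset.range (numRows t ε)).filter (fun i => i ≡ 0 [MOD m])

/-- The binary observation at the grid point `s_{i,j}`: `1` if `f s_{i,j} ≥ u`, else `0`. -/
def zeta (f : Plane → ℝ) (t ε u : ℝ) (i j : ℕ) : ℝ :=
  (excursionSet f u).indicator (fun _ => 1) (gridPoint t ε i j)

/-- The number of pairs `(i, j)` with `a ≤ i ≤ min (a + m - 1) (M - 1)` and
`b ≤ j ≤ min (b + m - 1) (M - 2)` such that the observations at `s_{i,j}` and `s_{i,j+1}` differ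
(half-open ranges avoid the truncated subtraction `M - 2`). -/
def countH (f : Plane → ℝ) (t ε u : ℝ) (m a b : ℕ) : ℝ :=
  ∑ i ∈ Finset.Ico a (min (a + m) (numRows t ε)),
    ∑ j ∈ Finset.Ico b (min (b + m) (numRows t ε - 1)),
      |zeta f t ε u i j - zeta f t ε u i (j + 1)|

/-- The number of pairs `(i, j)` with `a ≤ i ≤ min (a + m - 1) (M - 2)` and
`b ≤ j ≤ min (b + m - 1) (M - 1)` such that the observations at `s_{i,j}` and `s_{i+1,j}`
differ. -/
def countV (f : Plane → ℝ) (t ε u : ℝ) (m a b : ℕ) : ℝ :=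
  ∑ i ∈ Finset.Ico a (min (a + m) (numRows t ε - 1)),
    ∑ j ∈ Finset.Ico b (min (b + m) (numRows t ε)),
      |zeta f t ε u i j - zeta f t ε u (i + 1) j|

/-- The perimeter estimator associated to the `p`-norm. -/
def estimator (p : ℝ≥0∞) (f : Plane → ℝ) (ε : ℝ) (m : ℕ) (t u : ℝ) : ℝ :=
  ε * ∑ a ∈ blockIndices t ε m, ∑ b ∈ blockIndices t ε m,
    ‖WithLp.toLp p ![countH f t ε u m a b, countV f t ε u m a b]‖

end

end ExcursionPerimeter

/-! Almost every path is regular at the level u, and the rest is deterministic: with δ = mε small,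
`exists_estimator_bound` gives an error O(1/m + δ²). Since mδ² = (mε^(2/3))³ → C³, both terms are
O(1/m), and a factor g = o(m) leaves o(1).

Without critical points the boundary in T is the compact level set {f = u} ∩ T
(`frontier_excursionSet`), on which one of the partial derivatives is at least some c > 0 in
absolute value. Its length is the sum of the lengths in the closed blocks (`perimeter_eq_sum`),
because each grid line meets it in finitely many points. In a block of side at most δ that meets the
level set, say |F₂| ≥ c at a point of it; for small δ, F₂ keeps its sign in the block.
`LevelBounds.block_error` then separates two cases.

If F₁ has no zero in the block, the level set there is a monotone arc. The two counts times ε are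
its two projections up to O(ε) (`abs_crossings_sub_volume_le`), so their 2-norm gives the chord. The
gradient turns by O(δ) only, which makes the relative excess of arc over chord O(δ²). The error is
O(ε + δ³).

If F₁ has a zero in the block, the chords of the level set have slope O(δ). The length is close to
the horizontal projection, the other count is small, and the error is O(ε + δ²).

Only O(1/δ) blocks meet the level set (`LevelBounds.card_blocks_mul_le`), so the first case
contributes O(ε/δ + δ²) = O(1/m + δ²). The second case occurs only within O(δ) of finitely many
points, because the common zeros of f - u and F₁ are nondegenerate (`exists_finset_degenerate`).
This leaves O(1) blocks (`card_near_blocks_le`), where the sign of F₁₁ also makes each row cross the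
level at most twice. -/

namespace ExcursionPerimeter

/-! ### Variation of 0-1 sequences and grid nodes in intervals -/

lemma sum_abs_sub_succ_of_monotoneOn {g : ℕ → ℝ} {b b' : ℕ} (h : b ≤ b')
    (hg : MonotoneOn g (Set.Icc b b')) :
    ∑ j ∈ Finset.Ico b b', |g j - g (j + 1)| = g b' - g b := by
  rw [← Finset.sum_Ico_sub g h]
  refine Finset.sum_congr rfl fun j hj => ?_
  rw [Finset.mem_Ico] at hj
  rw [abs_sub_comm, abs_of_nonneg]
  exact sub_nonneg.2 (hg ⟨hj.1, hj.2.le⟩ ⟨by omega, by omega⟩ (by omega))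

lemma sum_abs_sub_succ_of_antitoneOn {g : ℕ → ℝ} {b b' : ℕ} (h : b ≤ b')
    (hg : AntitoneOn g (Set.Icc b b')) :
    ∑ j ∈ Finset.Ico b b', |g j - g (j + 1)| = g b - g b' := by
  have := sum_abs_sub_succ_of_monotoneOn h (g := fun j => - g j) hg.neg
  rw [show g b - g b' = -g b' - -g b by ring, ← this]
  refine Finset.sum_congr rfl fun j _ => ?_
  rw [← abs_neg]; congr 1; ring

/-- A sequence of zeros and ones that takes the value `1` on an interval changes at most twice. -/
lemma sum_abs_sub_succ_le_two_of_ordConnected {g : ℕ → ℝ} {a a' : ℕ}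
    (h01 : ∀ i, g i = 0 ∨ g i = 1) (hg : ({i ∈ Set.Icc a a' | g i = 1}).OrdConnected) :
    ∑ i ∈ Finset.Ico a a', |g i - g (i + 1)| ≤ 2 := by
  by_cases hne : ∃ i₀ ∈ Set.Icc a a', g i₀ = 1
  · obtain ⟨i₀, hi₀, hg₀⟩ := hne
    have hle : ∀ i, g i ≤ 1 := fun i => by rcases h01 i with h | h <;> norm_num [h]
    have hnn : ∀ i, 0 ≤ g i := fun i => by rcases h01 i with h | h <;> norm_num [h]
    have hone : ∀ i ∈ Set.Icc a a', ∀ j ∈ Set.Icc a a', g i = 1 → g j = 1 →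
        ∀ k ∈ Set.Icc i j, g k = 1 := fun i hi j hj h1 h2 k hk =>
      (hg.out ⟨hi, h1⟩ ⟨hj, h2⟩ hk).2
    rw [← Finset.sum_Ico_consecutive _ hi₀.1 hi₀.2,
      sum_abs_sub_succ_of_monotoneOn hi₀.1, sum_abs_sub_succ_of_antitoneOn hi₀.2]
    · linarith [hle i₀, hnn a, hnn a']
    · intro i hi j hj hij
      rcases h01 j with h | h
      · rw [h]; exact hnn i
      · have : g i = 1 := hone i₀ hi₀ j ⟨hi₀.1.trans hj.1, hj.2⟩ hg₀ h i ⟨hi.1, hij⟩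
        rw [this, h]
    · intro i hi j hj hij
      rcases h01 i with h | h
      · rw [h]; exact hnn j
      · have : g j = 1 := hone i ⟨hi.1, hi.2.trans hi₀.2⟩ i₀ hi₀ h hg₀ j ⟨hij, hj.2⟩
        rw [this, h]
  · push Not at hne
    have h0 : ∀ i ∈ Set.Icc a a', g i = 0 := fun i hi => (h01 i).resolve_right (hne i hi)
    rw [Finset.sum_eq_zero]
    · norm_num
    · intro i hi
      rw [Finset.mem_Ico] at hi
      rw [h0 i ⟨hi.1, hi.2.le⟩, h0 (i + 1) ⟨by omega, by omega⟩]; simp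

lemma card_le_of_forall_sub_le {s : Finset ℕ} {L : ℝ} (hL : 0 ≤ L)
    (h : ∀ i ∈ s, ∀ j ∈ s, (i : ℝ) - j ≤ L) : (s.card : ℝ) ≤ L + 1 := by
  rcases s.eq_empty_or_nonempty with rfl | hne
  · simp; linarith
  · have hsub : s ⊆ Finset.Icc (s.min' hne) (s.max' hne) := fun i hi =>
      Finset.mem_Icc.2 ⟨s.min'_le i hi, s.le_max' i hi⟩
    have h1 := Finset.card_le_card hsub
    rw [Nat.card_Icc] at h1
    have h2 := h _ (s.max'_mem hne) _ (s.min'_mem hne)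
    have h3 : s.min' hne ≤ s.max' hne := s.min'_le _ (s.max'_mem hne)
    have h4 : (s.card : ℝ) + s.min' hne ≤ s.max' hne + 1 := by exact_mod_cast (by omega)
    linarith

/-- The coordinate `-t + i ε`. -/
def node (t ε : ℝ) (i : ℕ) : ℝ := -t + i * ε

lemma node_le_node_iff {t ε : ℝ} (hε : 0 < ε) {i j : ℕ} : node t ε i ≤ node t ε j ↔ i ≤ j := by
  unfold node
  rw [add_le_add_iff_left, mul_le_mul_iff_left₀ hε, Nat.cast_le]

lemma node_mem_Icc {t ε : ℝ} (hε : 0 < ε) {i a b : ℕ} (h : i ∈ Set.Icc a b) :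
    node t ε i ∈ Set.Icc (node t ε a) (node t ε b) :=
  ⟨(node_le_node_iff hε).2 h.1, (node_le_node_iff hε).2 h.2⟩

lemma node_sub_node (t ε : ℝ) (i j : ℕ) : node t ε i - node t ε j = ((i : ℝ) - j) * ε := by
  unfold node; ring

-- An interval of length ℓ contains ℓ/ε nodes up to an error of one. The second ε pays for the end
-- node a', which the range [a, a'') may leave out.
open Classical in
lemma abs_card_sub_volume_le_of_ordConnected {t ε : ℝ} (hε : 0 < ε) {a a' a'' : ℕ}
    (ha'' : a' ≤ a'') (ha₃ : a'' ≤ a' + 1) {E : Set ℝ}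
    (hES : E ⊆ Set.Icc (node t ε a) (node t ε a')) (hE : E.OrdConnected) :
    |ε * ((Finset.Ico a a'').filter (fun i => node t ε i ∈ E)).card - (volume E).toReal|
      ≤ 2 * ε := by
  set s := (Finset.Ico a a'').filter (fun i => node t ε i ∈ E) with hs
  have hbdd : volume E ≠ ⊤ := ne_top_of_le_ne_top (by simp) (measure_mono hES)
  rw [abs_le]
  constructor
  · have hdiam : ∀ x ∈ E, ∀ y ∈ E, x ≤ y → y - x ≤ (s.card + 2) * ε := by
      intro x hx y hy hxy
      set p := ⌈(x + t) / ε⌉₊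
      set q := ⌊(y + t) / ε⌋₊
      have hx0 : 0 ≤ (x + t) / ε := by
        have := (hES hx).1
        unfold node at this
        have : 0 ≤ (a : ℝ) * ε := by positivity
        apply div_nonneg _ hε.le; linarith
      have hy0 : 0 ≤ (y + t) / ε := hx0.trans (by gcongr)
      have hp1 : (x + t) / ε ≤ p := Nat.le_ceil _
      have hp2 : (p : ℝ) < (x + t) / ε + 1 := Nat.ceil_lt_add_one hx0
      have hq1 : (q : ℝ) ≤ (y + t) / ε := Nat.floor_le hy0
      have hq2 : (y + t) / ε < q + 1 := Nat.lt_floor_add_one _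
      rw [div_le_iff₀ hε] at hp1
      rw [le_div_iff₀ hε] at hq1
      have hsub : (Finset.Icc p q).erase a' ⊆ s := by
        intro i hi
        rw [Finset.mem_erase, Finset.mem_Icc] at hi
        have hi1 : (p : ℝ) * ε ≤ i * ε := by gcongr; exact hi.2.1
        have hi2 : (i : ℝ) * ε ≤ q * ε := by gcongr; exact hi.2.2
        have hiE : node t ε i ∈ E :=
          hE.out hx hy ⟨by unfold node; linarith, by unfold node; linarith⟩
        have := hES hiE
        rw [Set.mem_Icc, node_le_node_iff hε, node_le_node_iff hε] at this
        rw [hs, Finset.mem_filter, Finset.mem_Ico]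
        exact ⟨⟨this.1, by omega⟩, hiE⟩
      have hcard := (Finset.pred_card_le_card_erase (s := Finset.Icc p q) (a := a')).trans
        (Finset.card_le_card hsub)
      rw [Nat.card_Icc] at hcard
      have : (q : ℝ) + 1 ≤ s.card + 1 + p := by exact_mod_cast (by omega)
      have h5 : (y + t) / ε - (x + t) / ε < s.card + 2 := by linarith
      rw [← sub_div, div_lt_iff₀ hε] at h5
      linarith
    have hvol : volume E ≤ ENNReal.ofReal ((s.card + 2) * ε) := by
      refine (Real.volume_le_diam E).trans (Metric.ediam_le fun x hx y hy => ?_)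
      rw [edist_dist]
      apply ENNReal.ofReal_le_ofReal
      rw [Real.dist_eq]
      rcases le_total x y with h | h
      · rw [abs_sub_comm, abs_of_nonneg (by linarith)]; exact hdiam x hx y hy h
      · rw [abs_of_nonneg (by linarith)]; exact hdiam y hy x hx h
    have := ENNReal.toReal_le_of_le_ofReal (by positivity) hvol
    linarith
  · rcases s.eq_empty_or_nonempty with h | hne
    · rw [h]
      have : 0 ≤ (volume E).toReal := ENNReal.toReal_nonneg
      simp; linarith
    · have hmin := Finset.mem_filter.1 (s.min'_mem hne)
      have hmax := Finset.mem_filter.1 (s.max'_mem hne)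
      have hsub : s ⊆ Finset.Icc (s.min' hne) (s.max' hne) := fun i hi =>
        Finset.mem_Icc.2 ⟨s.min'_le i hi, s.le_max' i hi⟩
      have h1 := Finset.card_le_card hsub
      rw [Nat.card_Icc] at h1
      have h3 : s.min' hne ≤ s.max' hne := s.min'_le _ (s.max'_mem hne)
      have h4 : (s.card : ℝ) + s.min' hne ≤ s.max' hne + 1 := by exact_mod_cast (by omega)
      have hvol := ENNReal.toReal_mono hbdd (measure_mono (μ := volume) (hE.out hmin.2 hmax.2))
      rw [Real.volume_Icc, node_sub_node] at hvol
      have := (le_max_left _ _).trans (ENNReal.toReal_ofReal' (r := _) ▸ hvol)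
      nlinarith

open Classical in
/-- The number of nodes in a set that is an interval or the complement of an interval. -/
lemma abs_card_sub_volume_le {t ε : ℝ} (hε : 0 < ε) {a a' a'' : ℕ} (haa' : a ≤ a')
    (ha'' : a' ≤ a'') (ha₃ : a'' ≤ a' + 1) {E : Set ℝ}
    (hES : E ⊆ Set.Icc (node t ε a) (node t ε a'))
    (hE : E.OrdConnected ∨ (Set.Icc (node t ε a) (node t ε a') \ E).OrdConnected) :
    |ε * ((Finset.Ico a a'').filter (fun i => node t ε i ∈ E)).card - (volume E).toReal|
      ≤ 3 * ε := by
  rcases hE with hE | hE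
  · exact (abs_card_sub_volume_le_of_ordConnected hε ha'' ha₃ hES hE).trans (by linarith)
  · set S := Set.Icc (node t ε a) (node t ε a')
    have h : |ε * ((Finset.Ico a a'').filter (fun i => node t ε i ∈ S \ E)).card
        - (volume (S \ E)).toReal| ≤ 2 * ε := by
      convert abs_card_sub_volume_le_of_ordConnected hε ha'' ha₃ Set.sdiff_subset hE
    have hbdd : volume S ≠ ⊤ := by simp [S]
    have hvol : (volume (S \ E)).toReal + (volume E).toReal = ((a' : ℝ) - a) * ε := by
      rw [← ENNReal.toReal_add (ne_top_of_le_ne_top hbdd (measure_mono Set.sdiff_subset))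
        (ne_top_of_le_ne_top hbdd (measure_mono hES))]
      have h2 : E = S \ (S \ E) := (Set.sdiff_sdiff_cancel_left hES).symm
      have hm : MeasurableSet E := h2 ▸ measurableSet_Icc.diff hE.measurableSet
      have := measure_inter_add_sdiff (μ := volume) S hm
      rw [Set.inter_eq_self_of_subset_right hES, add_comm] at this
      rw [this, Real.volume_Icc, node_sub_node, ENNReal.toReal_ofReal]
      have : (a : ℝ) ≤ a' := by exact_mod_cast haa'
      nlinarith
    have hcard : (((Finset.Ico a a'').filter (fun i => node t ε i ∈ S \ E)).card : ℝ) +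
        ((Finset.Ico a a'').filter (fun i => node t ε i ∈ E)).card = ((a'' : ℝ) - a) := by
      have := Finset.card_filter_add_card_filter_not (s := Finset.Ico a a'') (fun i => node t ε i ∈ E)
      rw [Nat.card_Ico] at this
      have h3 : (Finset.Ico a a'').filter (fun i => node t ε i ∈ S \ E) =
          (Finset.Ico a a'').filter (fun i => ¬ node t ε i ∈ E) := by
        refine Finset.filter_congr fun i hi => ?_
        rw [Finset.mem_Ico] at hi
        have : node t ε i ∈ S := node_mem_Icc hε ⟨hi.1, by omega⟩
        simp [this]
      rw [h3, eq_sub_iff_add_eq]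
      exact_mod_cast (by omega)
    -- Passing to complements compares a'' - a nodes with the length (a' - a)ε, which adds at most
    -- one ε to the 2ε of the interval case.
    have h1 : (a' : ℝ) ≤ a'' := by exact_mod_cast ha''
    have h2 : (a'' : ℝ) ≤ a' + 1 := by exact_mod_cast ha₃
    have h3 := congrArg (ε * ·) hcard
    simp only [mul_add] at h3
    have h4 : ε * a' ≤ ε * a'' := by gcongr
    have h5 : ε * a'' ≤ ε * (a' + 1) := by gcongr
    rw [abs_le] at h ⊢
    constructor <;> linarith

/-- The number of nodes in a set of small diameter. -/
lemma card_nodes_le {t ε d : ℝ} (hε : 0 < ε) (hd : 0 ≤ d) {s : Finset ℕ}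
    (h : ∀ i ∈ s, ∀ j ∈ s, node t ε i - node t ε j ≤ d) : ε * s.card ≤ d + ε := by
  have := card_le_of_forall_sub_le (s := s) (L := d / ε) (by positivity) fun i hi j hj => by
    rw [le_div_iff₀ hε, ← node_sub_node t]; exact h i hi j hj
  calc ε * s.card ≤ ε * (d / ε + 1) := by gcongr
    _ = d + ε := by field_simp

/-! ### Length of a planar set and of its projection to a line -/

lemma dist_sq_eq (s s' : Plane) : dist s s' ^ 2 = (s 0 - s' 0) ^ 2 + (s 1 - s' 1) ^ 2 := by
  rw [EuclideanSpace.dist_eq, Real.sq_sqrt (by positivity), Fin.sum_univ_two, Real.dist_eq,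
    Real.dist_eq, sq_abs, sq_abs]

/-- A planar set all of whose chords are almost parallel to the unit vector `w` has almost the
same length as its projection to the line spanned by `w`. -/
lemma hausdorffMeasure_bounds_of_projection {Γ : Set Plane} {w₀ w₁ η : ℝ}
    (hw : w₀ ^ 2 + w₁ ^ 2 = 1) (hη0 : 0 ≤ η) (hη : η ≤ 1 / 2)
    (h : ∀ s ∈ Γ, ∀ s' ∈ Γ,
      ((s 0 - s' 0) * w₁ - (s 1 - s' 1) * w₀) ^ 2 ≤ η * dist s s' ^ 2) :
    volume ((fun s : Plane => w₀ * s 0 + w₁ * s 1) '' Γ) ≤ μH[1] Γ ∧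
      μH[1] Γ ≤ ENNReal.ofReal (1 + 2 * η) *
        volume ((fun s : Plane => w₀ * s 0 + w₁ * s 1) '' Γ) := by
  set π : Plane → ℝ := fun s => w₀ * s 0 + w₁ * s 1
  -- Pythagoras for a chord, split into its components along w and across w.
  have key : ∀ s s' : Plane, (dist (π s) (π s')) ^ 2 +
      ((s 0 - s' 0) * w₁ - (s 1 - s' 1) * w₀) ^ 2 = dist s s' ^ 2 := fun s s' => by
    rw [dist_sq_eq, Real.dist_eq, sq_abs]
    linear_combination ((s 0 - s' 0) ^ 2 + (s 1 - s' 1) ^ 2) * hw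
  have hπ : LipschitzOnWith 1 π Γ := by
    refine LipschitzOnWith.of_dist_le_mul fun s _ s' _ => ?_
    have := key s s'
    simp only [NNReal.coe_one, one_mul]
    exact abs_le_of_sq_le_sq' (by nlinarith [sq_nonneg ((s 0 - s' 0) * w₁ - (s 1 - s' 1) * w₀)])
      dist_nonneg |>.2
  have hle : ∀ s ∈ Γ, ∀ s' ∈ Γ, dist s s' ≤ (1 + 2 * η) * dist (π s) (π s') := by
    intro s hs s' hs'
    have h1 := key s s'
    have h2 := h s hs s' hs'
    refine (abs_le_of_sq_le_sq' ?_ (by positivity)).2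
    have h3 : (1 - η) * dist s s' ^ 2 ≤ dist (π s) (π s') ^ 2 := by linarith
    -- The exact Lipschitz constant of the inverse would be (1 - η)^(-1/2); for 0 ≤ η ≤ 1/2 it is at
    -- most 1 + 2η.
    have h4 : 1 ≤ (1 + 2 * η) ^ 2 * (1 - η) := by nlinarith [mul_nonneg hη0 hη0]
    calc dist s s' ^ 2 ≤ ((1 + 2 * η) ^ 2 * (1 - η)) * dist s s' ^ 2 :=
          le_mul_of_one_le_left (by positivity) h4
      _ = (1 + 2 * η) ^ 2 * ((1 - η) * dist s s' ^ 2) := by ring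
      _ ≤ (1 + 2 * η) ^ 2 * dist (π s) (π s') ^ 2 := by gcongr
      _ = _ := by ring
  have hinj : Set.InjOn π Γ := fun s hs s' hs' hss => by
    have := hle s hs s' hs'
    rw [hss, dist_self, mul_zero] at this
    exact dist_le_zero.1 this
  constructor
  · have := hπ.hausdorffMeasure_image_le (d := 1) zero_le_one
    simpa [hausdorffMeasure_real] using this
  · have hg : LipschitzOnWith (Real.toNNReal (1 + 2 * η)) (Function.invFunOn π Γ) (π '' Γ) := by
      refine LipschitzOnWith.of_dist_le_mul ?_
      rintro _ ⟨s, hs, rfl⟩ _ ⟨s', hs', rfl⟩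
      rw [hinj.leftInvOn_invFunOn hs, hinj.leftInvOn_invFunOn hs', Real.coe_toNNReal _ (by positivity)]
      exact hle s hs s' hs'
    have := hg.hausdorffMeasure_image_le (d := 1) zero_le_one
    rw [hinj.invFunOn_image subset_rfl] at this
    simpa [hausdorffMeasure_real, ENNReal.ofReal] using this

/-! ### Crossing counts and projected length -/

/-- The indicator of the half line `[u, ∞)`. -/
noncomputable def threshold (u v : ℝ) : ℝ := if u ≤ v then 1 else 0

lemma threshold_mono (u : ℝ) : Monotone (threshold u) := by
  intro v v' h
  unfold threshold
  split_ifs with h1 h2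
  · exact le_rfl
  · exact absurd (h1.trans h) h2
  · exact zero_le_one
  · exact le_rfl

lemma threshold_eq (u v : ℝ) : threshold u v = 0 ∨ threshold u v = 1 := by
  unfold threshold; split_ifs <;> simp

/-- The number of threshold crossings along the edges in the direction of the second
coordinate. -/
noncomputable def crossings (F : ℝ → ℝ → ℝ) (t ε u : ℝ) (a a' b b' : ℕ) : ℝ :=
  ∑ i ∈ Finset.Ico a a', ∑ j ∈ Finset.Ico b b',
    |threshold u (F (node t ε i) (node t ε j)) - threshold u (F (node t ε i) (node t ε (j + 1)))|

lemma crossings_nonneg (F : ℝ → ℝ → ℝ) (t ε u : ℝ) (a a' b b' : ℕ) :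
    0 ≤ crossings F t ε u a a' b b' :=
  Finset.sum_nonneg fun _ _ => Finset.sum_nonneg fun _ _ => abs_nonneg _

/-- Meant for D the projection of the level set, E₀ and E₁ the superlevel sets on two opposite edges
of the rectangle, and N the zeros of F - u on one edge. -/
lemma volume_toReal_eq_sub {D E₀ E₁ S N : Set ℝ} (hS : volume S ≠ ⊤) (h₀ : E₀ ⊆ E₁) (h₁ : E₁ ⊆ S)
    (hm : MeasurableSet E₀) (hD₁ : E₁ \ E₀ ⊆ D) (hD₂ : D ⊆ (E₁ \ E₀) ∪ N) (hN : volume N = 0) :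
    (volume D).toReal = (volume E₁).toReal - (volume E₀).toReal := by
  have hD : volume D = volume (E₁ \ E₀) := by
    refine le_antisymm ((measure_mono hD₂).trans ((measure_union_le _ _).trans ?_))
      (measure_mono hD₁)
    rw [hN, add_zero]
  have hE₁ := ne_top_of_le_ne_top hS (measure_mono h₁)
  have := measure_inter_add_sdiff (μ := volume) E₁ hm
  rw [Set.inter_eq_self_of_subset_right h₀] at this
  rw [hD, ← this, ENNReal.toReal_add (ne_top_of_le_ne_top hE₁ (measure_mono h₀))
    (ne_top_of_le_ne_top hE₁ (measure_mono Set.sdiff_subset))]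
  ring

/-- The set of the `x` in `[x₀, x₁]` for which `F x y ≥ u`. -/
def superlevel (F : ℝ → ℝ → ℝ) (u x₀ x₁ y : ℝ) : Set ℝ := {x ∈ Set.Icc x₀ x₁ | u ≤ F x y}

/-- The superlevel set in `[x₀, x₁]` or its complement is an interval. -/
def IsIntervalLike (F : ℝ → ℝ → ℝ) (u x₀ x₁ y : ℝ) : Prop :=
  (superlevel F u x₀ x₁ y).OrdConnected ∨ (Set.Icc x₀ x₁ \ superlevel F u x₀ x₁ y).OrdConnected

/-- The projection to the first coordinate of the level set in a rectangle. -/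
def levelProj (F : ℝ → ℝ → ℝ) (u x₀ x₁ y₀ y₁ : ℝ) : Set ℝ :=
  {x ∈ Set.Icc x₀ x₁ | ∃ y ∈ Set.Icc y₀ y₁, F x y = u}

lemma superlevel_subset (F : ℝ → ℝ → ℝ) (u x₀ x₁ y : ℝ) :
    superlevel F u x₀ x₁ y ⊆ Set.Icc x₀ x₁ := fun _ hx => hx.1

lemma IsIntervalLike.measurableSet {F : ℝ → ℝ → ℝ} {u x₀ x₁ y : ℝ}
    (h : IsIntervalLike F u x₀ x₁ y) : MeasurableSet (superlevel F u x₀ x₁ y) := by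
  rcases h with h | h
  · exact h.measurableSet
  · have h2 := Set.sdiff_sdiff_cancel_left (superlevel_subset F u x₀ x₁ y)
    exact h2 ▸ measurableSet_Icc.diff h.measurableSet

open Classical in
lemma abs_sum_threshold_sub_volume_le {F : ℝ → ℝ → ℝ} {t ε u : ℝ} (hε : 0 < ε) {a a' a'' : ℕ}
    (haa' : a ≤ a') (ha'' : a' ≤ a'') (ha₃ : a'' ≤ a' + 1) {y : ℝ}
    (hQ : IsIntervalLike F u (node t ε a) (node t ε a') y) :
    |ε * ∑ i ∈ Finset.Ico a a'', threshold u (F (node t ε i) y) -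
      (volume (superlevel F u (node t ε a) (node t ε a') y)).toReal| ≤ 3 * ε := by
  have h := abs_card_sub_volume_le hε haa' ha'' ha₃ (superlevel_subset F u _ _ y) hQ
  rw [Finset.card_filter, Nat.cast_sum] at h
  convert h using 5 with i hi
  rw [Finset.mem_Ico] at hi
  have : node t ε i ∈ Set.Icc (node t ε a) (node t ε a') := node_mem_Icc hε ⟨hi.1, by omega⟩
  have h2 : node t ε i ∈ superlevel F u (node t ε a) (node t ε a') y ↔ u ≤ F (node t ε i) y :=
    ⟨fun h => h.2, fun h => ⟨this, h⟩⟩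
  simp [threshold, h2]

/-- Along each line of constant x the function is monotone, so the crossings telescope to the
difference of the thresholds at the two ends. Summing over x counts the nodes in the superlevel sets
of the two opposite edges, each count being within 3ε of a length. The difference of these lengths
is that of the projection, by the intermediate value theorem. Here a' is the last node of the block,
while the counted lines are those in [a, a''): a'' = a' for a block followed by another one, and a''
= a' + 1 for a last block, which keeps its far edge. -/
lemma abs_crossings_sub_volume_le {F : ℝ → ℝ → ℝ} {t ε u : ℝ} (hε : 0 < ε) {a a' a'' b b' : ℕ}
    (haa' : a ≤ a') (ha'' : a' ≤ a'') (ha₃ : a'' ≤ a' + 1) (hbb' : b ≤ b')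
    (hc : ∀ x, Continuous (F x))
    (hmono : (∀ x ∈ Set.Icc (node t ε a) (node t ε a'),
        StrictMonoOn (F x) (Set.Icc (node t ε b) (node t ε b'))) ∨
      ∀ x ∈ Set.Icc (node t ε a) (node t ε a'),
        StrictAntiOn (F x) (Set.Icc (node t ε b) (node t ε b')))
    (hQ : ∀ y ∈ Set.Icc (node t ε b) (node t ε b'),
      IsIntervalLike F u (node t ε a) (node t ε a') y)
    (hnull : ∀ y ∈ Set.Icc (node t ε b) (node t ε b'),
      volume {x ∈ Set.Icc (node t ε a) (node t ε a') | F x y = u} = 0) :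
    |ε * crossings F t ε u a a'' b b' - (volume (levelProj F u (node t ε a) (node t ε a')
      (node t ε b) (node t ε b'))).toReal| ≤ 6 * ε := by
  have hnode : ∀ i ∈ Finset.Ico a a'', node t ε i ∈ Set.Icc (node t ε a) (node t ε a') :=
    fun i hi => by
      rw [Finset.mem_Ico] at hi; exact node_mem_Icc hε ⟨hi.1, by omega⟩
  have hy : node t ε b ≤ node t ε b' := (node_le_node_iff hε).2 hbb'
  have hy₀ : node t ε b ∈ Set.Icc (node t ε b) (node t ε b') := ⟨le_rfl, hy⟩
  have hy₁ : node t ε b' ∈ Set.Icc (node t ε b) (node t ε b') := ⟨hy, le_rfl⟩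
  have c0 := abs_le.1 (abs_sum_threshold_sub_volume_le hε haa' ha'' ha₃ (hQ _ hy₀))
  have c1 := abs_le.1 (abs_sum_threshold_sub_volume_le hε haa' ha'' ha₃ (hQ _ hy₁))
  have m0 := (hQ _ hy₀).measurableSet
  have m1 := (hQ _ hy₁).measurableSet
  have n0 := hnull _ hy₀
  have n1 := hnull _ hy₁
  rcases hmono with hm | hm
  · have hcr : crossings F t ε u a a'' b b' =
        ∑ i ∈ Finset.Ico a a'', threshold u (F (node t ε i) (node t ε b')) -
          ∑ i ∈ Finset.Ico a a'', threshold u (F (node t ε i) (node t ε b)) := by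
      rw [← Finset.sum_sub_distrib]
      refine Finset.sum_congr rfl fun i hi => sum_abs_sub_succ_of_monotoneOn
        (g := fun j => threshold u (F (node t ε i) (node t ε j))) hbb' fun j hj k hk hjk => ?_
      exact threshold_mono u ((hm _ (hnode i hi)).monotoneOn (node_mem_Icc hε hj)
        (node_mem_Icc hε hk) ((node_le_node_iff hε).2 hjk))
    have hvol := volume_toReal_eq_sub (S := Set.Icc (node t ε a) (node t ε a'))
      (D := levelProj F u (node t ε a) (node t ε a') (node t ε b) (node t ε b'))
      (E₀ := superlevel F u (node t ε a) (node t ε a') (node t ε b)) (E₁ := superlevel F u (node t ε a) (node t ε a') (node t ε b')) (by simp)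
      (fun x hx => ⟨hx.1, hx.2.trans ((hm x hx.1).monotoneOn hy₀ hy₁ hy)⟩) (superlevel_subset F u _ _ _)
      m0
      (fun x ⟨hx, hx'⟩ => ⟨hx.1, by
        have : F x (node t ε b) < u := by by_contra! h; exact hx' ⟨hx.1, h⟩
        exact intermediate_value_Icc hy (hc x).continuousOn ⟨this.le, hx.2⟩⟩)
      (fun x ⟨hx, y, hyy, hxy⟩ => by
        rcases eq_or_lt_of_le ((hm x hx).monotoneOn hy₀ hyy hyy.1) with h | h
        · right; exact (⟨hx, h.trans hxy⟩ : x ∈ {x ∈ Set.Icc (node t ε a) (node t ε a') | F x (node t ε b) = u})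
        · left
          exact ⟨⟨hx, hxy.ge.trans ((hm x hx).monotoneOn hyy hy₁ hyy.2)⟩,
            fun h' => absurd h'.2 (by linarith)⟩)
      n0
    rw [hcr, hvol, abs_le]
    constructor <;> linarith
  · have hcr : crossings F t ε u a a'' b b' =
        ∑ i ∈ Finset.Ico a a'', threshold u (F (node t ε i) (node t ε b)) -
          ∑ i ∈ Finset.Ico a a'', threshold u (F (node t ε i) (node t ε b')) := by
      rw [← Finset.sum_sub_distrib]
      refine Finset.sum_congr rfl fun i hi => sum_abs_sub_succ_of_antitoneOn
        (g := fun j => threshold u (F (node t ε i) (node t ε j))) hbb' fun j hj k hk hjk => ?_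
      exact threshold_mono u ((hm _ (hnode i hi)).antitoneOn (node_mem_Icc hε hj)
        (node_mem_Icc hε hk) ((node_le_node_iff hε).2 hjk))
    have hvol := volume_toReal_eq_sub (S := Set.Icc (node t ε a) (node t ε a'))
      (D := levelProj F u (node t ε a) (node t ε a') (node t ε b) (node t ε b'))
      (E₀ := superlevel F u (node t ε a) (node t ε a') (node t ε b')) (E₁ := superlevel F u (node t ε a) (node t ε a') (node t ε b)) (by simp)
      (fun x hx => ⟨hx.1, hx.2.trans ((hm x hx.1).antitoneOn hy₀ hy₁ hy)⟩) (superlevel_subset F u _ _ _)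
      m1
      (fun x ⟨hx, hx'⟩ => ⟨hx.1, by
        have : F x (node t ε b') < u := by by_contra! h; exact hx' ⟨hx.1, h⟩
        exact intermediate_value_Icc' hy (hc x).continuousOn ⟨this.le, hx.2⟩⟩)
      (fun x ⟨hx, y, hyy, hxy⟩ => by
        rcases eq_or_lt_of_le ((hm x hx).antitoneOn hyy hy₁ hyy.2) with h | h
        · right; exact (⟨hx, h.trans hxy⟩ : x ∈ {x ∈ Set.Icc (node t ε a) (node t ε a') | F x (node t ε b') = u})
        · left
          exact ⟨⟨hx, hxy.ge.trans ((hm x hx).antitoneOn hy₀ hyy hyy.1)⟩,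
            fun h' => absurd h'.2 (by linarith)⟩)
      n1
    rw [hcr, hvol, abs_le]
    constructor <;> linarith

/-! ### Functions of two real variables and their level sets in a rectangle -/

/-- `F₁` and `F₂` are the partial derivatives of the function `F` of two real variables, and
they are continuous and satisfy Rolle's theorem on segments. -/
structure HasPartials (F F₁ F₂ : ℝ → ℝ → ℝ) : Prop where
  cont : Continuous fun p : ℝ × ℝ => F p.1 p.2
  cont₁ : Continuous fun p : ℝ × ℝ => F₁ p.1 p.2
  cont₂ : Continuous fun p : ℝ × ℝ => F₂ p.1 p.2
  deriv₁ : ∀ x y, HasDerivAt (fun x => F x y) (F₁ x y) x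
  deriv₂ : ∀ x y, HasDerivAt (fun y => F x y) (F₂ x y) y
  rolle : ∀ {x₀ x₁ y₀ y₁ x x' y y' : ℝ}, x ∈ Set.Icc x₀ x₁ → x' ∈ Set.Icc x₀ x₁ →
    y ∈ Set.Icc y₀ y₁ → y' ∈ Set.Icc y₀ y₁ → F x y = F x' y' →
    ∃ ξ ∈ Set.Icc x₀ x₁, ∃ υ ∈ Set.Icc y₀ y₁, F₁ ξ υ * (x' - x) + F₂ ξ υ * (y' - y) = 0

namespace HasPartials

variable {F F₁ F₂ : ℝ → ℝ → ℝ}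

/-- Exchanging the coordinates lets each estimate be proved in one direction only. -/
lemma symm (h : HasPartials F F₁ F₂) : HasPartials (flip F) (flip F₂) (flip F₁) where
  cont := h.cont.comp continuous_swap
  cont₁ := h.cont₂.comp continuous_swap
  cont₂ := h.cont₁.comp continuous_swap
  deriv₁ x y := h.deriv₂ y x
  deriv₂ x y := h.deriv₁ y x
  rolle hx hx' hy hy' hF := by
    obtain ⟨ξ, hξ, υ, hυ, h0⟩ := h.rolle hy hy' hx hx' hF
    exact ⟨υ, hυ, ξ, hξ, by rw [add_comm]; exact h0⟩

lemma cont_right (h : HasPartials F F₁ F₂) (x : ℝ) : Continuous (F x) :=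
  h.cont.comp (continuous_const.prodMk continuous_id)

lemma strictMonoOn_right (h : HasPartials F F₁ F₂) {x y₀ y₁ : ℝ}
    (hpos : ∀ y ∈ Set.Icc y₀ y₁, 0 < F₂ x y) : StrictMonoOn (F x) (Set.Icc y₀ y₁) := by
  refine strictMonoOn_of_deriv_pos (convex_Icc _ _) (h.cont_right x).continuousOn fun y hy => ?_
  rw [(h.deriv₂ x y).deriv]
  exact hpos y (interior_subset hy)

lemma strictAntiOn_right (h : HasPartials F F₁ F₂) {x y₀ y₁ : ℝ}
    (hneg : ∀ y ∈ Set.Icc y₀ y₁, F₂ x y < 0) : StrictAntiOn (F x) (Set.Icc y₀ y₁) := by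
  refine strictAntiOn_of_deriv_neg (convex_Icc _ _) (h.cont_right x).continuousOn fun y hy => ?_
  rw [(h.deriv₂ x y).deriv]
  exact hneg y (interior_subset hy)

lemma strictMonoOn_left (h : HasPartials F F₁ F₂) {y x₀ x₁ : ℝ}
    (hpos : ∀ x ∈ Set.Icc x₀ x₁, 0 < F₁ x y) : StrictMonoOn (fun x => F x y) (Set.Icc x₀ x₁) :=
  h.symm.strictMonoOn_right hpos

lemma strictAntiOn_left (h : HasPartials F F₁ F₂) {y x₀ x₁ : ℝ}
    (hneg : ∀ x ∈ Set.Icc x₀ x₁, F₁ x y < 0) : StrictAntiOn (fun x => F x y) (Set.Icc x₀ x₁) :=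
  h.symm.strictAntiOn_right hneg

/-- A continuous nonvanishing function on a rectangle has constant sign. -/
lemma _root_.ExcursionPerimeter.pos_or_neg_of_ne_zero {G : ℝ → ℝ → ℝ}
    (hG : Continuous fun p : ℝ × ℝ => G p.1 p.2) {x₀ x₁ y₀ y₁ : ℝ}
    (hne : ∀ x ∈ Set.Icc x₀ x₁, ∀ y ∈ Set.Icc y₀ y₁, G x y ≠ 0) :
    (∀ x ∈ Set.Icc x₀ x₁, ∀ y ∈ Set.Icc y₀ y₁, 0 < G x y) ∨
      (∀ x ∈ Set.Icc x₀ x₁, ∀ y ∈ Set.Icc y₀ y₁, G x y < 0) := by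
  by_contra! hcon
  obtain ⟨⟨x, hx, y, hy, h1⟩, x', hx', y', hy', h2⟩ := hcon
  have hpre : IsPreconnected (Set.Icc x₀ x₁ ×ˢ Set.Icc y₀ y₁) :=
    isPreconnected_Icc.prod isPreconnected_Icc
  obtain ⟨p, hp, hp0⟩ := hpre.intermediate_value (a := (x, y)) (b := (x', y')) ⟨hx, hy⟩ ⟨hx', hy'⟩
    hG.continuousOn ⟨h1, h2⟩
  exact hne p.1 hp.1 p.2 hp.2 hp0

end HasPartials

/-- The level set in a rectangle. -/
def levelSet (F : ℝ → ℝ → ℝ) (u x₀ x₁ y₀ y₁ : ℝ) : Set Plane :=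
  {s | s 0 ∈ Set.Icc x₀ x₁ ∧ s 1 ∈ Set.Icc y₀ y₁ ∧ F (s 0) (s 1) = u}

/-- The form with coefficients 1 and 0 matches `hausdorffMeasure_bounds_of_projection` for w = (1,
0). -/
lemma levelProj_eq_image (F : ℝ → ℝ → ℝ) (u x₀ x₁ y₀ y₁ : ℝ) :
    levelProj F u x₀ x₁ y₀ y₁ = (fun s : Plane => 1 * s 0 + 0 * s 1) '' levelSet F u x₀ x₁ y₀ y₁ := by
  ext x
  constructor
  · rintro ⟨hx, y, hy, h⟩
    exact ⟨!₂[x, y], ⟨by simpa using hx, by simpa using hy, by simpa using h⟩, by simp⟩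
  · rintro ⟨s, ⟨h1, h2, h3⟩, rfl⟩
    simp only [one_mul, zero_mul, add_zero]
    exact ⟨h1, s 1, h2, h3⟩

lemma hausdorffMeasure_levelSet_flip (F : ℝ → ℝ → ℝ) (u x₀ x₁ y₀ y₁ : ℝ) :
    μH[1] (levelSet (flip F) u y₀ y₁ x₀ x₁) = μH[1] (levelSet F u x₀ x₁ y₀ y₁) := by
  let e : Plane ≃ₗᵢ[ℝ] Plane := LinearIsometryEquiv.piLpCongrLeft 2 ℝ ℝ (Equiv.swap (0 : Fin 2) 1)
  have he0 : ∀ s, e s 0 = s 1 := fun s => by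
    simp [e, LinearIsometryEquiv.piLpCongrLeft_apply, Equiv.piCongrLeft'_apply]
  have he1 : ∀ s, e s 1 = s 0 := fun s => by
    simp [e, LinearIsometryEquiv.piLpCongrLeft_apply, Equiv.piCongrLeft'_apply]
  have : levelSet (flip F) u y₀ y₁ x₀ x₁ = e.symm ⁻¹' (levelSet F u x₀ x₁ y₀ y₁) := by
    ext s
    obtain ⟨s, rfl⟩ := e.surjective s
    simp only [levelSet, Set.mem_preimage, Set.mem_ofPred_eq, e.symm_apply_apply, he0, he1, flip]
    tauto
  rw [this]
  exact e.symm.toIsometryEquiv.hausdorffMeasure_preimage 1 _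

/-- Two points of a level set in a rectangle on which `|F₂| ≥ c` and `|F₁| ≤ K`. -/
lemma HasPartials.abs_sub_le {F F₁ F₂ : ℝ → ℝ → ℝ} (h : HasPartials F F₁ F₂)
    {x₀ x₁ y₀ y₁ c K : ℝ}
    (hc : ∀ x ∈ Set.Icc x₀ x₁, ∀ y ∈ Set.Icc y₀ y₁, c ≤ |F₂ x y|)
    (hK : ∀ x ∈ Set.Icc x₀ x₁, ∀ y ∈ Set.Icc y₀ y₁, |F₁ x y| ≤ K)
    {x x' y y' : ℝ} (hx : x ∈ Set.Icc x₀ x₁) (hx' : x' ∈ Set.Icc x₀ x₁)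
    (hy : y ∈ Set.Icc y₀ y₁) (hy' : y' ∈ Set.Icc y₀ y₁) (hF : F x y = F x' y') :
    c * |y' - y| ≤ K * |x' - x| := by
  obtain ⟨ξ, hξ, υ, hυ, h0⟩ := h.rolle hx hx' hy hy' hF
  calc c * |y' - y| ≤ |F₂ ξ υ| * |y' - y| := by gcongr; exact hc ξ hξ υ hυ
    _ = |F₁ ξ υ| * |x' - x| := by
      rw [← abs_mul, ← abs_mul, ← abs_neg]; congr 1; linarith
    _ ≤ K * |x' - x| := by gcongr; exact hK ξ hξ υ hυ

/-- Almost horizontal level sets. -/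
lemma hausdorffMeasure_levelSet_of_flat {F : ℝ → ℝ → ℝ}
    {u x₀ x₁ y₀ y₁ θ : ℝ} (hθ' : θ ^ 2 ≤ 1 / 2)
    (hle : ∀ s ∈ levelSet F u x₀ x₁ y₀ y₁, ∀ s' ∈ levelSet F u x₀ x₁ y₀ y₁,
      |s 1 - s' 1| ≤ θ * |s 0 - s' 0|) :
    volume (levelProj F u x₀ x₁ y₀ y₁) ≤ μH[1] (levelSet F u x₀ x₁ y₀ y₁) ∧
    μH[1] (levelSet F u x₀ x₁ y₀ y₁) ≤
      ENNReal.ofReal (1 + 2 * θ ^ 2) * volume (levelProj F u x₀ x₁ y₀ y₁) := by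
  rw [levelProj_eq_image]
  -- With w = (1, 0) the component across w is the vertical one, so slope at most θ means η = θ².
  refine hausdorffMeasure_bounds_of_projection (by norm_num) (by positivity) hθ' ?_
  intro s hs s' hs'
  rw [dist_sq_eq]
  have h1 := hle s hs s' hs'
  have h2 : |s 1 - s' 1| ^ 2 ≤ (θ * |s 0 - s' 0|) ^ 2 := by gcongr
  rw [mul_pow, sq_abs, sq_abs] at h2
  nlinarith [mul_nonneg (sq_nonneg θ) (sq_nonneg (s 1 - s' 1))]

/-- Between two points of the level set, `F₁` having constant sign, and the two points being
in monotone position, all first coordinates occur. -/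
lemma HasPartials.exists_mem_uIcc {F F₁ F₂ : ℝ → ℝ → ℝ} (h : HasPartials F F₁ F₂)
    {u x₀ x₁ y₀ y₁ : ℝ}
    (hs₁ : (∀ x ∈ Set.Icc x₀ x₁, ∀ y ∈ Set.Icc y₀ y₁, 0 < F₁ x y) ∨
      (∀ x ∈ Set.Icc x₀ x₁, ∀ y ∈ Set.Icc y₀ y₁, F₁ x y < 0))
    {p₀ p₁ q₀ q₁ : ℝ} (hp₀ : p₀ ∈ Set.Icc x₀ x₁) (hp₁ : p₁ ∈ Set.Icc y₀ y₁)
    (hq₀ : q₀ ∈ Set.Icc x₀ x₁) (hq₁ : q₁ ∈ Set.Icc y₀ y₁) (hp : F p₀ p₁ = u) (hq : F q₀ q₁ = u)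
    {x : ℝ} (hx : x ∈ Set.uIcc p₀ q₀) : ∃ y ∈ Set.uIcc p₁ q₁, F x y = u := by
  wlog hpq : p₀ ≤ q₀ generalizing p₀ p₁ q₀ q₁
  · rw [Set.uIcc_comm] at hx ⊢
    exact this hq₀ hq₁ hp₀ hp₁ hq hp hx (not_le.1 hpq).le
  rw [Set.uIcc_of_le hpq] at hx
  have hxx : x ∈ Set.Icc x₀ x₁ := ⟨hp₀.1.trans hx.1, hx.2.trans hq₀.2⟩
  -- Moving from p₀ to x at height p₁ and from q₀ to x at height q₁ changes F in opposite
  -- directions, so u is caught between the two values.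
  have hu : u ∈ Set.uIcc (F x p₁) (F x q₁) := by
    rcases hs₁ with hs | hs
    · have e1 := (h.strictMonoOn_left fun x hx => hs x hx p₁ hp₁).monotoneOn hp₀ hxx hx.1
      have e2 := (h.strictMonoOn_left fun x hx => hs x hx q₁ hq₁).monotoneOn hxx hq₀ hx.2
      simp only [hp, hq] at e1 e2
      exact Set.mem_uIcc.2 (Or.inr ⟨e2, e1⟩)
    · have e1 := (h.strictAntiOn_left fun x hx => hs x hx p₁ hp₁).antitoneOn hp₀ hxx hx.1
      have e2 := (h.strictAntiOn_left fun x hx => hs x hx q₁ hq₁).antitoneOn hxx hq₀ hx.2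
      simp only [hp, hq] at e1 e2
      exact Set.mem_uIcc.2 (Or.inl ⟨e1, e2⟩)
  obtain ⟨y, hy, hxy⟩ := intermediate_value_uIcc (h.cont_right x).continuousOn hu
  exact ⟨y, hy, hxy⟩

/-- If both partial derivatives have constant sign, then the level set is monotone. -/
lemma HasPartials.exists_sign {F F₁ F₂ : ℝ → ℝ → ℝ} (h : HasPartials F F₁ F₂)
    {u x₀ x₁ y₀ y₁ : ℝ}
    (hs₁ : (∀ x ∈ Set.Icc x₀ x₁, ∀ y ∈ Set.Icc y₀ y₁, 0 < F₁ x y) ∨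
      (∀ x ∈ Set.Icc x₀ x₁, ∀ y ∈ Set.Icc y₀ y₁, F₁ x y < 0))
    (hs₂ : (∀ x ∈ Set.Icc x₀ x₁, ∀ y ∈ Set.Icc y₀ y₁, 0 < F₂ x y) ∨
      (∀ x ∈ Set.Icc x₀ x₁, ∀ y ∈ Set.Icc y₀ y₁, F₂ x y < 0)) :
    ∃ σ : ℝ, (σ = 1 ∨ σ = -1) ∧ ∀ x ∈ Set.Icc x₀ x₁, ∀ y ∈ Set.Icc y₀ y₁,
      ∀ x' ∈ Set.Icc x₀ x₁, ∀ y' ∈ Set.Icc y₀ y₁, F x y = u → F x' y' = u → x ≤ x' →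
      0 ≤ σ * (y' - y) ∧ (x = x' → y = y') := by
  -- σ is the sign of the slope -F₁/F₂ of the level set.
  have key : ∃ σ : ℝ, (σ = 1 ∨ σ = -1) ∧ ∀ x ∈ Set.Icc x₀ x₁, ∀ y ∈ Set.Icc y₀ y₁,
      0 < -σ * F₁ x y * F₂ x y := by
    rcases hs₁ with h1 | h1 <;> rcases hs₂ with h2 | h2
    · refine ⟨-1, Or.inr rfl, fun x hx y hy => ?_⟩
      have := mul_pos (h1 x hx y hy) (h2 x hx y hy); linarith
    · refine ⟨1, Or.inl rfl, fun x hx y hy => ?_⟩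
      have := mul_neg_of_pos_of_neg (h1 x hx y hy) (h2 x hx y hy); linarith
    · refine ⟨1, Or.inl rfl, fun x hx y hy => ?_⟩
      have := mul_neg_of_neg_of_pos (h1 x hx y hy) (h2 x hx y hy); linarith
    · refine ⟨-1, Or.inr rfl, fun x hx y hy => ?_⟩
      have := mul_pos_of_neg_of_neg (h1 x hx y hy) (h2 x hx y hy); linarith
  obtain ⟨σ, hσ, hpos⟩ := key
  refine ⟨σ, hσ, fun x hx y hy x' hx' y' hy' hF hF' hxx => ?_⟩
  obtain ⟨ξ, hξ, υ, hυ, h0⟩ := h.rolle hx hx' hy hy' (hF.trans hF'.symm)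
  have hp := hpos ξ hξ υ hυ
  have h2 : F₂ ξ υ ≠ 0 := fun h => by simp [h] at hp
  have e : F₂ ξ υ ^ 2 * (σ * (y' - y)) = (-σ * F₁ ξ υ * F₂ ξ υ) * (x' - x) := by
    linear_combination σ * F₂ ξ υ * h0
  constructor
  · have : 0 ≤ F₂ ξ υ ^ 2 * (σ * (y' - y)) := by
      rw [e]; exact mul_nonneg hp.le (by linarith)
    exact nonneg_of_mul_nonneg_right this (by positivity)
  · intro hxe
    rw [hxe, sub_self, mul_zero, zero_add] at h0
    have := (mul_eq_zero.1 h0).resolve_left h2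
    linarith

/-- A vector `v` orthogonal to `(a, b)` is almost parallel to a unit vector `w` orthogonal to
a nearby vector `(a', b')`. -/
lemma cross_sq_le {a b a' b' v₀ v₁ w₀ w₁ c κ : ℝ} (hc0 : 0 < c) (hw : w₀ ^ 2 + w₁ ^ 2 = 1)
    (hc : c ≤ |b'|) (ha : |a' - a| ≤ κ) (hb : |b' - b| ≤ κ)
    (hv : a * v₀ + b * v₁ = 0) (hw' : a' * w₀ + b' * w₁ = 0) :
    (v₀ * w₁ - v₁ * w₀) ^ 2 ≤ 2 * κ ^ 2 / c ^ 2 * (v₀ ^ 2 + v₁ ^ 2) := by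
  -- Orthogonality of w to (a', b') turns the cross product into the inner product of v with (a',
  -- b'). Orthogonality of v to (a, b) then leaves only the difference of the two normals, which is
  -- of size κ.
  have id : b' * (v₀ * w₁ - v₁ * w₀) = - (w₀ * ((a' - a) * v₀ + (b' - b) * v₁)) := by
    linear_combination v₀ * hw' - w₀ * hv
  have a1 : (a' - a) ^ 2 ≤ κ ^ 2 := sq_le_sq' (abs_le.1 ha).1 (abs_le.1 ha).2
  have a2 : (b' - b) ^ 2 ≤ κ ^ 2 := sq_le_sq' (abs_le.1 hb).1 (abs_le.1 hb).2
  have a3 : c ^ 2 ≤ b' ^ 2 := by rw [← sq_abs b']; gcongr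
  have a4 : w₀ ^ 2 ≤ 1 := by linarith [sq_nonneg w₁]
  rw [div_mul_eq_mul_div, le_div_iff₀ (by positivity)]
  generalize a' - a = A at *
  generalize b' - b = B at *
  have a5 : (A * v₀ + B * v₁) ^ 2 = (A ^ 2 + B ^ 2) * (v₀ ^ 2 + v₁ ^ 2) - (A * v₁ - B * v₀) ^ 2 := by
    ring
  calc (v₀ * w₁ - v₁ * w₀) ^ 2 * c ^ 2 ≤ (v₀ * w₁ - v₁ * w₀) ^ 2 * b' ^ 2 := by gcongr
    _ = (b' * (v₀ * w₁ - v₁ * w₀)) ^ 2 := by ring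
    _ = w₀ ^ 2 * (A * v₀ + B * v₁) ^ 2 := by rw [id]; ring
    _ ≤ 1 * (A * v₀ + B * v₁) ^ 2 := by gcongr
    _ ≤ (A ^ 2 + B ^ 2) * (v₀ ^ 2 + v₁ ^ 2) := by
      rw [one_mul, a5]; linarith [sq_nonneg (A * v₁ - B * v₀)]
    _ ≤ (κ ^ 2 + κ ^ 2) * (v₀ ^ 2 + v₁ ^ 2) := by gcongr
    _ = 2 * κ ^ 2 * (v₀ ^ 2 + v₁ ^ 2) := by ring

/-- A monotone level set with slowly varying normal direction is almost a chord. -/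
lemma HasPartials.hausdorffMeasure_levelSet_of_monotone {F F₁ F₂ : ℝ → ℝ → ℝ}
    (h : HasPartials F F₁ F₂) {u x₀ x₁ y₀ y₁ c K κ : ℝ} (hx : x₀ ≤ x₁) (hy : y₀ ≤ y₁)
    (hs₁ : (∀ x ∈ Set.Icc x₀ x₁, ∀ y ∈ Set.Icc y₀ y₁, 0 < F₁ x y) ∨
      (∀ x ∈ Set.Icc x₀ x₁, ∀ y ∈ Set.Icc y₀ y₁, F₁ x y < 0))
    (hs₂ : (∀ x ∈ Set.Icc x₀ x₁, ∀ y ∈ Set.Icc y₀ y₁, 0 < F₂ x y) ∨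
      (∀ x ∈ Set.Icc x₀ x₁, ∀ y ∈ Set.Icc y₀ y₁, F₂ x y < 0))
    (hc0 : 0 < c) (hc : ∀ x ∈ Set.Icc x₀ x₁, ∀ y ∈ Set.Icc y₀ y₁, c ≤ |F₂ x y|)
    (hK : ∀ x ∈ Set.Icc x₀ x₁, ∀ y ∈ Set.Icc y₀ y₁, |F₁ x y| ≤ K)
    (hκ : ∀ x ∈ Set.Icc x₀ x₁, ∀ y ∈ Set.Icc y₀ y₁, ∀ x' ∈ Set.Icc x₀ x₁, ∀ y' ∈ Set.Icc y₀ y₁,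
      |F₁ x y - F₁ x' y'| ≤ κ ∧ |F₂ x y - F₂ x' y'| ≤ κ)
    (hκc : 2 * κ ≤ c) :
    ∃ dx dy : ℝ, 0 ≤ dx ∧ 0 ≤ dy ∧ dx ≤ x₁ - x₀ ∧ dy ≤ y₁ - y₀ ∧
      volume (levelProj F u x₀ x₁ y₀ y₁) = ENNReal.ofReal dx ∧
      volume (levelProj (flip F) u y₀ y₁ x₀ x₁) = ENNReal.ofReal dy ∧
      ENNReal.ofReal √(dx ^ 2 + dy ^ 2) ≤ μH[1] (levelSet F u x₀ x₁ y₀ y₁) ∧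
      μH[1] (levelSet F u x₀ x₁ y₀ y₁) ≤
        ENNReal.ofReal ((1 + 4 * κ ^ 2 / c ^ 2) * √(dx ^ 2 + dy ^ 2)) := by
  set C : Set (ℝ × ℝ) := (Set.Icc x₀ x₁ ×ˢ Set.Icc y₀ y₁) ∩ {p | F p.1 p.2 = u} with hC
  have hCc : IsCompact C :=
    (isCompact_Icc.prod isCompact_Icc).inter_right (isClosed_eq h.cont continuous_const)
  rcases C.eq_empty_or_nonempty with hemp | hne
  · have hno : ∀ x ∈ Set.Icc x₀ x₁, ∀ y ∈ Set.Icc y₀ y₁, F x y ≠ u := fun x hx y hy hF => by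
      have : (x, y) ∈ C := ⟨⟨hx, hy⟩, hF⟩
      simp [hemp] at this
    have e1 : levelProj F u x₀ x₁ y₀ y₁ = ∅ :=
      Set.eq_empty_of_forall_notMem fun x ⟨hx, y, hy, hF⟩ => hno x hx y hy hF
    have e2 : levelProj (flip F) u y₀ y₁ x₀ x₁ = ∅ :=
      Set.eq_empty_of_forall_notMem fun y ⟨hy, x, hx, hF⟩ => hno x hx y hy hF
    have e3 : levelSet F u x₀ x₁ y₀ y₁ = ∅ :=
      Set.eq_empty_of_forall_notMem fun s ⟨hx, hy, hF⟩ => hno _ hx _ hy hF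
    exact ⟨0, 0, le_rfl, le_rfl, by linarith, by linarith, by simp [e1], by simp [e2],
      by simp [e3], by simp [e3]⟩
  -- The points p and q are the leftmost and rightmost points of the level set. By monotonicity they
  -- are extreme in height too, so dx and dy will be the sides of the box with diagonal pq.
  obtain ⟨⟨p₀, p₁⟩, ⟨⟨hp₀, hp₁⟩, hp⟩, hmin⟩ := hCc.exists_isMinOn hne continuous_fst.continuousOn
  obtain ⟨⟨q₀, q₁⟩, ⟨⟨hq₀, hq₁⟩, hq⟩, hmax⟩ := hCc.exists_isMaxOn hne continuous_fst.continuousOn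
  simp only [Set.mem_ofPred_eq] at hp hq hp₀ hp₁ hq₀ hq₁
  have hmin' : ∀ x ∈ Set.Icc x₀ x₁, ∀ y ∈ Set.Icc y₀ y₁, F x y = u → p₀ ≤ x :=
    fun x hx y hy hF => hmin (a := (x, y)) ⟨⟨hx, hy⟩, hF⟩
  have hmax' : ∀ x ∈ Set.Icc x₀ x₁, ∀ y ∈ Set.Icc y₀ y₁, F x y = u → x ≤ q₀ :=
    fun x hx y hy hF => hmax (a := (x, y)) ⟨⟨hx, hy⟩, hF⟩
  have hpq : p₀ ≤ q₀ := hmin' q₀ hq₀ q₁ hq₁ hq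
  obtain ⟨σ, hσ, hmono⟩ := h.exists_sign (u := u) hs₁ hs₂
  have hσ2 : σ * σ = 1 := by rcases hσ with h | h <;> rw [h] <;> norm_num
  have hpos := hmono p₀ hp₀ p₁ hp₁
  have hpos' := fun x hx y hy => hmono x hx y hy q₀ hq₀ q₁ hq₁
  have hbetween : ∀ x ∈ Set.Icc x₀ x₁, ∀ y ∈ Set.Icc y₀ y₁, F x y = u →
      0 ≤ σ * (y - p₁) ∧ 0 ≤ σ * (q₁ - y) := fun x hx y hy hF =>
    ⟨(hpos x hx y hy hp hF (hmin' x hx y hy hF)).1, (hpos' x hx y hy hF hq (hmax' x hx y hy hF)).1⟩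
  have huIcc : ∀ y, 0 ≤ σ * (y - p₁) ∧ 0 ≤ σ * (q₁ - y) → y ∈ Set.uIcc p₁ q₁ := by
    rintro y ⟨h1, h2⟩
    rw [Set.mem_uIcc]
    rcases hσ with rfl | rfl
    · left; constructor <;> linarith
    · right; constructor <;> linarith
  have hsub₀ : Set.uIcc p₀ q₀ ⊆ Set.Icc x₀ x₁ := Set.uIcc_subset_Icc hp₀ hq₀
  have hsub₁ : Set.uIcc p₁ q₁ ⊆ Set.Icc y₀ y₁ := Set.uIcc_subset_Icc hp₁ hq₁
  have hDx : levelProj F u x₀ x₁ y₀ y₁ = Set.uIcc p₀ q₀ := by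
    ext x; constructor
    · rintro ⟨hx, y, hy, hF⟩
      rw [Set.uIcc_of_le hpq]
      exact ⟨hmin' x hx y hy hF, hmax' x hx y hy hF⟩
    · intro hx
      obtain ⟨y, hy, hF⟩ := h.exists_mem_uIcc hs₁ hp₀ hp₁ hq₀ hq₁ hp hq hx
      exact ⟨hsub₀ hx, y, hsub₁ hy, hF⟩
  have hDy : levelProj (flip F) u y₀ y₁ x₀ x₁ = Set.uIcc p₁ q₁ := by
    ext y; constructor
    · rintro ⟨hy, x, hx, hF⟩
      exact huIcc y (hbetween x hx y hy hF)
    · intro hy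
      obtain ⟨x, hx, hF⟩ := h.symm.exists_mem_uIcc (x₀ := y₀) (x₁ := y₁) (y₀ := x₀) (y₁ := x₁)
        (hs₂.imp (fun h x hx y hy => h y hy x hx) (fun h x hx y hy => h y hy x hx))
        hp₁ hp₀ hq₁ hq₀ hp hq hy
      exact ⟨hsub₁ hy, x, hsub₀ hx, hF⟩
  set L := √((q₀ - p₀) ^ 2 + (q₁ - p₁) ^ 2) with hL
  have hL2 : L ^ 2 = (q₀ - p₀) ^ 2 + (q₁ - p₁) ^ 2 := Real.sq_sqrt (by positivity)
  have hLabs : √(|q₀ - p₀| ^ 2 + |q₁ - p₁| ^ 2) = L := by rw [sq_abs, sq_abs]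
  have hLnn : 0 ≤ L := Real.sqrt_nonneg _
  refine ⟨|q₀ - p₀|, |q₁ - p₁|, abs_nonneg _, abs_nonneg _, ?_, ?_, ?_, ?_, ?_⟩
  · rw [abs_le]; constructor <;> linarith [hp₀.1, hp₀.2, hq₀.1, hq₀.2]
  · rw [abs_le]; constructor <;> linarith [hp₁.1, hp₁.2, hq₁.1, hq₁.2]
  · rw [hDx, Real.volume_interval]
  · rw [hDy, Real.volume_interval]
  rw [hLabs]
  set Γ := levelSet F u x₀ x₁ y₀ y₁ with hΓ
  rcases hLnn.eq_or_lt with hL0 | hLpos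
  · have hsing : Γ.Subsingleton := by
      have h0 : q₀ - p₀ = 0 := by
        rw [← hL0] at hL2; nlinarith [sq_nonneg (q₀ - p₀), sq_nonneg (q₁ - p₁)]
      have hx : ∀ s ∈ Γ, s 0 = p₀ ∧ s 1 = p₁ := fun s ⟨h1, h2, h3⟩ => by
        have e := hmin' _ h1 _ h2 h3
        have : p₀ = s 0 := le_antisymm e (by linarith [hmax' _ h1 _ h2 h3])
        exact ⟨this.symm, ((hpos _ h1 _ h2 hp h3 e).2 this).symm⟩
      intro s hs s' hs'
      ext i; fin_cases i
      · exact (hx s hs).1.trans (hx s' hs').1.symm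
      · exact (hx s hs).2.trans (hx s' hs').2.symm
    have : μH[1] Γ = 0 := have := Measure.nullSingletonClass_hausdorff Plane (d := 1) one_pos; hsing.measure_zero _
    rw [this, ← hL0]; simp
  set w₀ := (q₀ - p₀) / L
  set w₁ := (q₁ - p₁) / L
  have hw : w₀ ^ 2 + w₁ ^ 2 = 1 := by
    rw [div_pow, div_pow, ← add_div, ← hL2, div_self (by positivity)]
  have hw₀ : 0 ≤ w₀ := div_nonneg (by linarith) hLnn
  have hw₁ : 0 ≤ σ * w₁ := by
    rw [← mul_div_assoc]; exact div_nonneg (hbetween _ hq₀ _ hq₁ hq).1 hLnn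
  have hκ0 : 0 ≤ κ := (abs_nonneg _).trans (hκ _ hp₀ _ hp₁ _ hp₀ _ hp₁).1
  have hη : 2 * κ ^ 2 / c ^ 2 ≤ 1 / 2 := by
    rw [div_le_iff₀ (by positivity)]; nlinarith
  -- Rolle's theorem gives normals for an arbitrary chord and for the chord pq, differing by at most
  -- κ in each entry. The deviation from w is thus of order κ/c, and it enters the length only
  -- through its square.
  have hproj := hausdorffMeasure_bounds_of_projection (Γ := Γ) (η := 2 * κ ^ 2 / c ^ 2) hw
    (by positivity) hη (by
      rintro s ⟨h1, h2, h3⟩ s' ⟨h1', h2', h3'⟩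
      obtain ⟨ξ, hξ, υ, hυ, e1⟩ := h.rolle h1' h1 h2' h2 (h3'.trans h3.symm)
      obtain ⟨ξ', hξ', υ', hυ', e2⟩ := h.rolle hp₀ hq₀ hp₁ hq₁ (hp.trans hq.symm)
      have e3 : F₁ ξ' υ' * w₀ + F₂ ξ' υ' * w₁ = 0 := by
        rw [← mul_div_assoc, ← mul_div_assoc, ← add_div, e2, zero_div]
      obtain ⟨k1, k2⟩ := hκ ξ' hξ' υ' hυ' ξ hξ υ hυ
      rw [dist_sq_eq]
      exact cross_sq_le hc0 hw (hc ξ' hξ' υ' hυ') k1 k2 e1 e3)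
  set π : Plane → ℝ := fun s => w₀ * s 0 + w₁ * s 1
  have hlen : (w₀ * q₀ + w₁ * q₁) - (w₀ * p₀ + w₁ * p₁) = L := by
    have : (w₀ * q₀ + w₁ * q₁) - (w₀ * p₀ + w₁ * p₁) =
        ((q₀ - p₀) ^ 2 + (q₁ - p₁) ^ 2) / L := by simp only [w₀, w₁]; ring
    rw [this, ← hL2]; field_simp
  -- By monotonicity both coordinates lie between those of p and q, hence so does the projection to
  -- the direction of pq.
  have himage : π '' Γ ⊆ Set.Icc (w₀ * p₀ + w₁ * p₁) (w₀ * q₀ + w₁ * q₁) := by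
    rintro _ ⟨s, ⟨h1, h2, h3⟩, rfl⟩
    have b := hbetween _ h1 _ h2 h3
    have b1 : 0 ≤ w₁ * (s 1 - p₁) := by
      have := mul_nonneg hw₁ b.1
      linear_combination this + (w₁ * (s 1 - p₁)) * hσ2
    have b2 : 0 ≤ w₁ * (q₁ - s 1) := by
      have := mul_nonneg hw₁ b.2
      linear_combination this + (w₁ * (q₁ - s 1)) * hσ2
    have b3 := mul_nonneg hw₀ (sub_nonneg.2 (hmin' _ h1 _ h2 h3))
    have b4 := mul_nonneg hw₀ (sub_nonneg.2 (hmax' _ h1 _ h2 h3))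
    simp only [π]
    constructor <;> linarith
  constructor
  · refine le_trans ?_ hproj.1
    -- For the lower bound the level set is written as a Lipschitz graph φ over [p₀, q₀]; being
    -- connected, it projects onto the whole chord.
    have hsel : ∀ x : ℝ, ∃ y : ℝ, x ∈ Set.Icc p₀ q₀ → y ∈ Set.Icc y₀ y₁ ∧ F x y = u := fun x => by
      by_cases hx : x ∈ Set.Icc p₀ q₀
      · obtain ⟨y, hy, hF⟩ := h.exists_mem_uIcc hs₁ hp₀ hp₁ hq₀ hq₁ hp hq
          (by rwa [Set.uIcc_of_le hpq])
        exact ⟨y, fun _ => ⟨hsub₁ hy, hF⟩⟩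
      · exact ⟨0, fun h => absurd h hx⟩
    choose φ hφ using hsel
    have hIcc : Set.Icc p₀ q₀ ⊆ Set.Icc x₀ x₁ := Set.Icc_subset_Icc hp₀.1 hq₀.2
    have hφc : ContinuousOn φ (Set.Icc p₀ q₀) := by
      have hK0 : 0 ≤ K := (abs_nonneg _).trans (hK _ hp₀ _ hp₁)
      have : LipschitzOnWith (Real.toNNReal (K / c)) φ (Set.Icc p₀ q₀) := by
        refine LipschitzOnWith.of_dist_le_mul fun x hx x' hx' => ?_
        have := h.abs_sub_le hc hK (hIcc hx') (hIcc hx) (hφ x' hx').1 (hφ x hx).1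
          ((hφ x' hx').2.trans (hφ x hx).2.symm)
        rw [Real.coe_toNNReal _ (by positivity), Real.dist_eq, Real.dist_eq, div_mul_eq_mul_div,
          le_div_iff₀ hc0]
        linarith
      exact this.continuousOn
    have hψc : ContinuousOn (fun x => w₀ * x + w₁ * φ x) (Set.Icc p₀ q₀) :=
      (continuousOn_const.mul continuousOn_id).add (continuousOn_const.mul hφc)
    have hpm : p₀ ∈ Set.Icc p₀ q₀ := ⟨le_rfl, hpq⟩
    have hqm : q₀ ∈ Set.Icc p₀ q₀ := ⟨hpq, le_rfl⟩
    have ep : φ p₀ = p₁ := ((hpos _ hp₀ _ (hφ _ hpm).1 hp (hφ _ hpm).2 le_rfl).2 rfl).symm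
    have eq : φ q₀ = q₁ := (hpos' _ hq₀ _ (hφ _ hqm).1 (hφ _ hqm).2 hq le_rfl).2 rfl
    have hsurj := intermediate_value_Icc hpq hψc
    simp only [ep, eq] at hsurj
    calc ENNReal.ofReal L = volume (Set.Icc (w₀ * p₀ + w₁ * p₁) (w₀ * q₀ + w₁ * q₁)) := by
          rw [Real.volume_Icc, hlen]
      _ ≤ _ := measure_mono fun z hz => by
        obtain ⟨x, hx, rfl⟩ := hsurj hz
        exact ⟨!₂[x, φ x], ⟨by simpa using hIcc hx, by simpa using (hφ x hx).1,
          by simpa using (hφ x hx).2⟩, by simp [π]⟩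
  · refine hproj.2.trans ?_
    rw [ENNReal.ofReal_mul (by positivity)]
    gcongr
    · apply le_of_eq; ring
    · exact (measure_mono himage).trans (by rw [Real.volume_Icc, hlen])

/-! ### Error of the estimator in a single block -/

lemma sqrt_sq_add_sq_le (p q r s : ℝ) :
    √(p ^ 2 + q ^ 2) ≤ √(r ^ 2 + s ^ 2) + |p - r| + |q - s| := by
  have hS : √(r ^ 2 + s ^ 2) ^ 2 = r ^ 2 + s ^ 2 := Real.sq_sqrt (by positivity)
  have h0 : 0 ≤ √(r ^ 2 + s ^ 2) := Real.sqrt_nonneg _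
  have hr : |r| ≤ √(r ^ 2 + s ^ 2) := Real.abs_le_sqrt (by linarith [sq_nonneg s])
  have hs : |s| ≤ √(r ^ 2 + s ^ 2) := Real.abs_le_sqrt (by linarith [sq_nonneg r])
  set S := √(r ^ 2 + s ^ 2)
  have hA := abs_nonneg (p - r)
  have hB := abs_nonneg (q - s)
  have e1 : p ^ 2 = r ^ 2 + 2 * (r * (p - r)) + |p - r| ^ 2 := by rw [sq_abs]; ring
  have e2 : q ^ 2 = s ^ 2 + 2 * (s * (q - s)) + |q - s| ^ 2 := by rw [sq_abs]; ring
  have e3 : r * (p - r) ≤ S * |p - r| :=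
    (le_abs_self _).trans (by rw [abs_mul]; gcongr)
  have e4 : s * (q - s) ≤ S * |q - s| :=
    (le_abs_self _).trans (by rw [abs_mul]; gcongr)
  rw [Real.sqrt_le_iff]
  refine ⟨by positivity, ?_⟩
  nlinarith [mul_nonneg hA hB]

lemma abs_sqrt_sub_sqrt_le (p q r s : ℝ) :
    |√(p ^ 2 + q ^ 2) - √(r ^ 2 + s ^ 2)| ≤ |p - r| + |q - s| := by
  have h1 := sqrt_sq_add_sq_le p q r s
  have h2 := sqrt_sq_add_sq_le r s p q
  rw [abs_sub_comm r p, abs_sub_comm s q] at h2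
  rw [abs_le]; constructor <;> linarith

section IsIntervalLike

variable {F : ℝ → ℝ → ℝ} {u x₀ x₁ y : ℝ}

lemma sdiff_superlevel : Set.Icc x₀ x₁ \ superlevel F u x₀ x₁ y =
    {x ∈ Set.Icc x₀ x₁ | F x y < u} := by
  ext x
  simp only [superlevel, Set.mem_sdiff, Set.mem_ofPred_eq, not_and, not_le]
  tauto

lemma isIntervalLike_of_monotoneOn (h : MonotoneOn (fun x => F x y) (Set.Icc x₀ x₁)) :
    IsIntervalLike F u x₀ x₁ y := by
  refine Or.inl ⟨fun x hx x' hx' z hz => ?_⟩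
  have hzm : z ∈ Set.Icc x₀ x₁ := ⟨hx.1.1.trans hz.1, hz.2.trans hx'.1.2⟩
  exact ⟨hzm, hx.2.trans (h hx.1 hzm hz.1)⟩

lemma isIntervalLike_of_antitoneOn (h : AntitoneOn (fun x => F x y) (Set.Icc x₀ x₁)) :
    IsIntervalLike F u x₀ x₁ y := by
  refine Or.inl ⟨fun x hx x' hx' z hz => ?_⟩
  have hzm : z ∈ Set.Icc x₀ x₁ := ⟨hx.1.1.trans hz.1, hz.2.trans hx'.1.2⟩
  exact ⟨hzm, hx'.2.trans (h hzm hx'.1 hz.2)⟩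

lemma isIntervalLike_of_concaveOn (h : ConcaveOn ℝ (Set.Icc x₀ x₁) (fun x => F x y)) :
    IsIntervalLike F u x₀ x₁ y :=
  Or.inl (h.convex_ge u).ordConnected

/-- Convexity makes the sublevel set an interval, which is why `IsIntervalLike` admits complements.
-/
lemma isIntervalLike_of_convexOn (h : ConvexOn ℝ (Set.Icc x₀ x₁) (fun x => F x y)) :
    IsIntervalLike F u x₀ x₁ y :=
  Or.inr (by rw [sdiff_superlevel]; exact (h.convex_lt u).ordConnected)

end IsIntervalLike

lemma HasPartials.isIntervalLike {F F₁ F₂ : ℝ → ℝ → ℝ} (h : HasPartials F F₁ F₂)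
    {u x₀ x₁ y₀ y₁ : ℝ}
    (hs₁ : (∀ x ∈ Set.Icc x₀ x₁, ∀ y ∈ Set.Icc y₀ y₁, 0 < F₁ x y) ∨
      (∀ x ∈ Set.Icc x₀ x₁, ∀ y ∈ Set.Icc y₀ y₁, F₁ x y < 0)) {y : ℝ} (hy : y ∈ Set.Icc y₀ y₁) :
    IsIntervalLike F u x₀ x₁ y := by
  rcases hs₁ with hs | hs
  · exact isIntervalLike_of_monotoneOn (h.strictMonoOn_left fun x hx => hs x hx y hy).monotoneOn
  · exact isIntervalLike_of_antitoneOn (h.strictAntiOn_left fun x hx => hs x hx y hy).antitoneOn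

lemma HasPartials.strictMono_or_strictAnti {F F₁ F₂ : ℝ → ℝ → ℝ} (h : HasPartials F F₁ F₂)
    {x₀ x₁ y₀ y₁ : ℝ}
    (hs₂ : (∀ x ∈ Set.Icc x₀ x₁, ∀ y ∈ Set.Icc y₀ y₁, 0 < F₂ x y) ∨
      (∀ x ∈ Set.Icc x₀ x₁, ∀ y ∈ Set.Icc y₀ y₁, F₂ x y < 0)) :
    (∀ x ∈ Set.Icc x₀ x₁, StrictMonoOn (F x) (Set.Icc y₀ y₁)) ∨
      ∀ x ∈ Set.Icc x₀ x₁, StrictAntiOn (F x) (Set.Icc y₀ y₁) :=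
  hs₂.imp (fun hs x hx => h.strictMonoOn_right (hs x hx))
    (fun hs x hx => h.strictAntiOn_right (hs x hx))

/-- The error of the estimator in a block in which the level set is monotone. -/
lemma HasPartials.monotone_block_error {F F₁ F₂ : ℝ → ℝ → ℝ} (h : HasPartials F F₁ F₂)
    {t ε u c K κ : ℝ} (hε : 0 < ε) {a a' a'' b b' b'' : ℕ}
    (haa' : a ≤ a') (ha'' : a' ≤ a'') (ha₃ : a'' ≤ a' + 1)
    (hbb' : b ≤ b') (hb'' : b' ≤ b'') (hb₃ : b'' ≤ b' + 1) {x₀ x₁ y₀ y₁ : ℝ}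
    (hx₀ : x₀ = node t ε a) (hx₁ : x₁ = node t ε a')
    (hy₀ : y₀ = node t ε b) (hy₁ : y₁ = node t ε b')
    (hs₁ : (∀ x ∈ Set.Icc x₀ x₁, ∀ y ∈ Set.Icc y₀ y₁, 0 < F₁ x y) ∨
      (∀ x ∈ Set.Icc x₀ x₁, ∀ y ∈ Set.Icc y₀ y₁, F₁ x y < 0))
    (hs₂ : (∀ x ∈ Set.Icc x₀ x₁, ∀ y ∈ Set.Icc y₀ y₁, 0 < F₂ x y) ∨
      (∀ x ∈ Set.Icc x₀ x₁, ∀ y ∈ Set.Icc y₀ y₁, F₂ x y < 0))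
    (hc0 : 0 < c) (hc : ∀ x ∈ Set.Icc x₀ x₁, ∀ y ∈ Set.Icc y₀ y₁, c ≤ |F₂ x y|)
    (hK : ∀ x ∈ Set.Icc x₀ x₁, ∀ y ∈ Set.Icc y₀ y₁, |F₁ x y| ≤ K)
    (hκ : ∀ x ∈ Set.Icc x₀ x₁, ∀ y ∈ Set.Icc y₀ y₁, ∀ x' ∈ Set.Icc x₀ x₁, ∀ y' ∈ Set.Icc y₀ y₁,
      |F₁ x y - F₁ x' y'| ≤ κ ∧ |F₂ x y - F₂ x' y'| ≤ κ)
    (hκc : 2 * κ ≤ c)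
    (hnull₁ : ∀ y ∈ Set.Icc y₀ y₁, volume {x ∈ Set.Icc x₀ x₁ | F x y = u} = 0)
    (hnull₂ : ∀ x ∈ Set.Icc x₀ x₁, volume {y ∈ Set.Icc y₀ y₁ | F x y = u} = 0) :
    μH[1] (levelSet F u x₀ x₁ y₀ y₁) ≠ ⊤ ∧
      |ε * √(crossings F t ε u a a'' b b' ^ 2 + crossings (flip F) t ε u b b'' a a' ^ 2) -
        (μH[1] (levelSet F u x₀ x₁ y₀ y₁)).toReal| ≤
      12 * ε + 4 * κ ^ 2 / c ^ 2 * ((x₁ - x₀) + (y₁ - y₀)) := by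
  have hx : x₀ ≤ x₁ := by rw [hx₀, hx₁]; exact (node_le_node_iff hε).2 haa'
  have hy : y₀ ≤ y₁ := by rw [hy₀, hy₁]; exact (node_le_node_iff hε).2 hbb'
  obtain ⟨dx, dy, hdx, hdy, hdx', hdy', hvx, hvy, hlow, hup⟩ :=
    h.hausdorffMeasure_levelSet_of_monotone (u := u) hx hy hs₁ hs₂ hc0 hc hK hκ hκc
  have hs₁' := hs₁.imp (fun hs y hy x hx => hs x hx y hy) (fun hs y hy x hx => hs x hx y hy)
  have hs₂' := hs₂.imp (fun hs y hy x hx => hs x hx y hy) (fun hs y hy x hx => hs x hx y hy)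
  have hNh : |ε * crossings F t ε u a a'' b b' - dx| ≤ 6 * ε := by
    subst hx₀ hx₁ hy₀ hy₁
    have := abs_crossings_sub_volume_le (u := u) hε haa' ha'' ha₃ hbb' h.cont_right
      (h.strictMono_or_strictAnti hs₂) (fun y hy => h.isIntervalLike hs₁ hy) hnull₁
    rwa [hvx, ENNReal.toReal_ofReal hdx] at this
  have hNv : |ε * crossings (flip F) t ε u b b'' a a' - dy| ≤ 6 * ε := by
    subst hx₀ hx₁ hy₀ hy₁
    have := abs_crossings_sub_volume_le (F := flip F) (u := u) hε hbb' hb'' hb₃ haa'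
      h.symm.cont_right (h.symm.strictMono_or_strictAnti hs₁')
      (fun x hx => h.symm.isIntervalLike hs₂' hx) hnull₂
    rwa [hvy, ENNReal.toReal_ofReal hdy] at this
  have hfin : μH[1] (levelSet F u x₀ x₁ y₀ y₁) ≠ ⊤ := ne_top_of_le_ne_top ENNReal.ofReal_ne_top hup
  refine ⟨hfin, ?_⟩
  set L := √(dx ^ 2 + dy ^ 2)
  have hL0 : 0 ≤ L := Real.sqrt_nonneg _
  have hlow' := (ENNReal.ofReal_le_iff_le_toReal hfin).1 hlow
  have hup' := ENNReal.toReal_le_of_le_ofReal (by positivity) hup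
  have hLle : L ≤ dx + dy := by
    rw [Real.sqrt_le_iff]; constructor <;> nlinarith
  have hroot : ε * √(crossings F t ε u a a'' b b' ^ 2 + crossings (flip F) t ε u b b'' a a' ^ 2) =
      √((ε * crossings F t ε u a a'' b b') ^ 2 + (ε * crossings (flip F) t ε u b b'' a a') ^ 2) := by
    rw [mul_pow, mul_pow, ← mul_add, Real.sqrt_mul (by positivity), Real.sqrt_sq hε.le]
  -- The Euclidean norm is 1-Lipschitz for the sum of the coordinate errors, so the two errors 6ε
  -- add up to 12ε.
  have hcount := abs_sqrt_sub_sqrt_le (ε * crossings F t ε u a a'' b b')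
    (ε * crossings (flip F) t ε u b b'' a a') dx dy
  rw [hroot]
  have hq : 0 ≤ 4 * κ ^ 2 / c ^ 2 := by positivity
  have hqL : 4 * κ ^ 2 / c ^ 2 * L ≤ 4 * κ ^ 2 / c ^ 2 * ((x₁ - x₀) + (y₁ - y₀)) := by
    gcongr; linarith
  have hc2 := abs_le.1 (hcount.trans (add_le_add hNh hNv))
  rw [add_mul, one_mul] at hup'
  rw [abs_le]; constructor <;> linarith

lemma sum_abs_threshold_le_two {F : ℝ → ℝ → ℝ} {t ε u y : ℝ} (hε : 0 < ε) {a a' : ℕ}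
    (hQ : IsIntervalLike F u (node t ε a) (node t ε a') y) :
    ∑ i ∈ Finset.Ico a a', |threshold u (F (node t ε i) y) - threshold u (F (node t ε (i + 1)) y)|
      ≤ 2 := by
  rcases hQ with hQ | hQ
  · refine sum_abs_sub_succ_le_two_of_ordConnected (g := fun i => threshold u (F (node t ε i) y))
      (fun i => threshold_eq _ _) ⟨fun i hi j hj k hk => ?_⟩
    have hmem : ∀ i ∈ Set.Icc a a', threshold u (F (node t ε i) y) = 1 ↔
        node t ε i ∈ superlevel F u (node t ε a) (node t ε a') y := fun i hi => by
      constructor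
      · intro h
        refine ⟨node_mem_Icc hε hi, ?_⟩
        by_contra hlt
        simp [threshold, hlt] at h
      · rintro ⟨-, h⟩
        simp [threshold, h]
    have hk' : k ∈ Set.Icc a a' := ⟨hi.1.1.trans hk.1, hk.2.trans hj.1.2⟩
    exact ⟨hk', (hmem k hk').2 (hQ.out ((hmem i hi.1).1 hi.2) ((hmem j hj.1).1 hj.2)
      (node_mem_Icc hε hk))⟩
  · have : ∀ i, |threshold u (F (node t ε i) y) - threshold u (F (node t ε (i + 1)) y)| =
        |(1 - threshold u (F (node t ε i) y)) - (1 - threshold u (F (node t ε (i + 1)) y))| :=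
      fun i => by rw [← abs_neg]; congr 1; ring
    simp_rw [this]
    refine sum_abs_sub_succ_le_two_of_ordConnected
      (g := fun i => 1 - threshold u (F (node t ε i) y))
      (fun i => by rcases threshold_eq u (F (node t ε i) y) with h | h <;> simp [h])
      ⟨fun i hi j hj k hk => ?_⟩
    have hmem : ∀ i ∈ Set.Icc a a', 1 - threshold u (F (node t ε i) y) = 1 ↔
        node t ε i ∈ Set.Icc (node t ε a) (node t ε a') \
          superlevel F u (node t ε a) (node t ε a') y := fun i hi => by
      rw [sdiff_superlevel]
      constructor
      · intro h
        refine ⟨node_mem_Icc hε hi, ?_⟩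
        by_contra hlt
        simp [threshold, not_lt.1 hlt] at h
      · rintro ⟨-, h⟩
        simp [threshold, not_le.2 h]
    have hk' : k ∈ Set.Icc a a' := ⟨hi.1.1.trans hk.1, hk.2.trans hj.1.2⟩
    exact ⟨hk', (hmem k hk').2 (hQ.out ((hmem i hi.1).1 hi.2) ((hmem j hj.1).1 hj.2)
      (node_mem_Icc hε hk))⟩

/-- A threshold crossing contains a point of the level set. -/
lemma exists_mem_Icc_of_threshold_ne {g : ℝ → ℝ} (hg : Continuous g) {u x x' : ℝ} (hx : x ≤ x')
    (h : threshold u (g x) ≠ threshold u (g x')) : ∃ z ∈ Set.Icc x x', g z = u := by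
  have hu : u ∈ Set.uIcc (g x) (g x') := by
    rw [Set.mem_uIcc]
    unfold threshold at h
    by_contra! hcon
    split_ifs at h with h1 h2 h2
    · exact h rfl
    · exact absurd (hcon.2 (not_le.1 h2).le) (not_lt.2 h1)
    · exact absurd (hcon.1 (not_le.1 h1).le) (not_lt.2 h2)
    · exact h rfl
  obtain ⟨z, hz, hzu⟩ := intermediate_value_uIcc hg.continuousOn hu
  exact ⟨z, by rwa [Set.uIcc_of_le hx] at hz, hzu⟩

-- A row without a point of the level set has no crossing, and any other row has at most two. The
-- heights of the latter rows lie in a window of length d, which holds at most d/ε + 1 nodes.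
open Classical in
lemma HasPartials.crossings_le_of_flat {F F₁ F₂ : ℝ → ℝ → ℝ} (h : HasPartials F F₁ F₂)
    {t ε u d : ℝ} (hε : 0 < ε) (hd : 0 ≤ d) {a a' b b' b'' : ℕ} (hb₃ : b'' ≤ b' + 1)
    (hQ : ∀ y ∈ Set.Icc (node t ε b) (node t ε b'),
      IsIntervalLike F u (node t ε a) (node t ε a') y)
    (hflat : ∀ x ∈ Set.Icc (node t ε a) (node t ε a'), ∀ x' ∈ Set.Icc (node t ε a) (node t ε a'),
      ∀ y ∈ Set.Icc (node t ε b) (node t ε b'), ∀ y' ∈ Set.Icc (node t ε b) (node t ε b'),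
      F x y = u → F x' y' = u → y - y' ≤ d) :
    ε * crossings (flip F) t ε u b b'' a a' ≤ 2 * (d + ε) := by
  set J := (Finset.Ico b b'').filter
    (fun j => ∃ x ∈ Set.Icc (node t ε a) (node t ε a'), F x (node t ε j) = u)
  have hnode : ∀ j ∈ Finset.Ico b b'', node t ε j ∈ Set.Icc (node t ε b) (node t ε b') :=
    fun j hj => by
      rw [Finset.mem_Ico] at hj; exact node_mem_Icc hε ⟨hj.1, by omega⟩
  have hJ : ε * J.card ≤ d + ε := card_nodes_le (t := t) hε hd fun i hi j hj => by
    obtain ⟨hi1, x, hx, hxu⟩ := Finset.mem_filter.1 hi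
    obtain ⟨hj1, x', hx', hxu'⟩ := Finset.mem_filter.1 hj
    exact hflat x hx x' hx' _ (hnode i hi1) _ (hnode j hj1) hxu hxu'
  have hsum : crossings (flip F) t ε u b b'' a a' ≤ 2 * J.card := by
    have : ∀ j ∈ Finset.Ico b b'', ∑ i ∈ Finset.Ico a a',
        |threshold u (flip F (node t ε j) (node t ε i)) -
          threshold u (flip F (node t ε j) (node t ε (i + 1)))| ≤
        if (∃ x ∈ Set.Icc (node t ε a) (node t ε a'), F x (node t ε j) = u) then 2 else 0 := by
      intro j hj
      split_ifs with hex
      · exact sum_abs_threshold_le_two hε (hQ _ (hnode j hj))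
      · refine le_of_eq (Finset.sum_eq_zero fun i hi => ?_)
        rw [Finset.mem_Ico] at hi
        rw [abs_eq_zero, sub_eq_zero]
        by_contra hne
        obtain ⟨z, hz, hzu⟩ := exists_mem_Icc_of_threshold_ne (h.symm.cont_right (node t ε j))
          ((node_le_node_iff hε).2 (Nat.le_succ i)) hne
        exact hex ⟨z, ⟨((node_le_node_iff hε).2 hi.1).trans hz.1,
          hz.2.trans ((node_le_node_iff hε).2 hi.2)⟩, hzu⟩
    refine (Finset.sum_le_sum this).trans ?_
    rw [← Finset.sum_filter, Finset.sum_const, nsmul_eq_mul, mul_comm]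
  calc ε * crossings (flip F) t ε u b b'' a a' ≤ ε * (2 * J.card) := by gcongr
    _ = 2 * (ε * J.card) := by ring
    _ ≤ 2 * (d + ε) := by gcongr

/-- The error of the estimator in a block in which the level set is almost horizontal. -/
lemma HasPartials.flat_block_error {F F₁ F₂ : ℝ → ℝ → ℝ} (h : HasPartials F F₁ F₂)
    {t ε u c θ : ℝ} (hε : 0 < ε) {a a' a'' b b' b'' : ℕ}
    (haa' : a ≤ a') (ha'' : a' ≤ a'') (ha₃ : a'' ≤ a' + 1)
    (hbb' : b ≤ b') (hb₃ : b'' ≤ b' + 1) {x₀ x₁ y₀ y₁ : ℝ}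
    (hx₀ : x₀ = node t ε a) (hx₁ : x₁ = node t ε a')
    (hy₀ : y₀ = node t ε b) (hy₁ : y₁ = node t ε b')
    (hs₂ : (∀ x ∈ Set.Icc x₀ x₁, ∀ y ∈ Set.Icc y₀ y₁, 0 < F₂ x y) ∨
      (∀ x ∈ Set.Icc x₀ x₁, ∀ y ∈ Set.Icc y₀ y₁, F₂ x y < 0))
    (hc0 : 0 < c) (hc : ∀ x ∈ Set.Icc x₀ x₁, ∀ y ∈ Set.Icc y₀ y₁, c ≤ |F₂ x y|)
    (hθ : 0 ≤ θ) (hθ' : θ ^ 2 ≤ 1 / 2)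
    (hK : ∀ x ∈ Set.Icc x₀ x₁, ∀ y ∈ Set.Icc y₀ y₁, |F₁ x y| ≤ c * θ)
    (hQ : ∀ y ∈ Set.Icc y₀ y₁, IsIntervalLike F u x₀ x₁ y)
    (hnull₁ : ∀ y ∈ Set.Icc y₀ y₁, volume {x ∈ Set.Icc x₀ x₁ | F x y = u} = 0) :
    μH[1] (levelSet F u x₀ x₁ y₀ y₁) ≠ ⊤ ∧
      |ε * √(crossings F t ε u a a'' b b' ^ 2 + crossings (flip F) t ε u b b'' a a' ^ 2) -
        (μH[1] (levelSet F u x₀ x₁ y₀ y₁)).toReal| ≤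
      8 * ε + 2 * θ * (x₁ - x₀) + 2 * θ ^ 2 * (x₁ - x₀) := by
  have hx : x₀ ≤ x₁ := by rw [hx₀, hx₁]; exact (node_le_node_iff hε).2 haa'
  have hle : ∀ x ∈ Set.Icc x₀ x₁, ∀ x' ∈ Set.Icc x₀ x₁, ∀ y ∈ Set.Icc y₀ y₁,
      ∀ y' ∈ Set.Icc y₀ y₁, F x y = u → F x' y' = u → |y - y'| ≤ θ * |x - x'| :=
    fun x hx x' hx' y hy y' hy' hF hF' => by
      have := h.abs_sub_le hc hK hx' hx hy' hy (hF'.trans hF.symm)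
      rw [mul_assoc] at this
      exact le_of_mul_le_mul_left this hc0
  obtain ⟨hlow, hup⟩ := hausdorffMeasure_levelSet_of_flat (F := F) (u := u) hθ'
    (fun s ⟨h1, h2, h3⟩ s' ⟨h1', h2', h3'⟩ => hle _ h1 _ h1' _ h2 _ h2' h3 h3')
  have hDx : volume (levelProj F u x₀ x₁ y₀ y₁) ≤ ENNReal.ofReal (x₁ - x₀) := by
    rw [← Real.volume_Icc]; exact measure_mono fun x hx => hx.1
  have hDfin : volume (levelProj F u x₀ x₁ y₀ y₁) ≠ ⊤ :=
    ne_top_of_le_ne_top ENNReal.ofReal_ne_top hDx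
  have hDx' := ENNReal.toReal_le_of_le_ofReal (by linarith) hDx
  have hfin : μH[1] (levelSet F u x₀ x₁ y₀ y₁) ≠ ⊤ :=
    ne_top_of_le_ne_top (ENNReal.mul_ne_top ENNReal.ofReal_ne_top hDfin) hup
  refine ⟨hfin, ?_⟩
  have hlow' := ENNReal.toReal_mono hfin hlow
  have hup' := ENNReal.toReal_mono (ENNReal.mul_ne_top ENNReal.ofReal_ne_top hDfin) hup
  rw [ENNReal.toReal_mul, ENNReal.toReal_ofReal (by positivity)] at hup'
  have hNh : |ε * crossings F t ε u a a'' b b' -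
      (volume (levelProj F u x₀ x₁ y₀ y₁)).toReal| ≤ 6 * ε := by
    subst hx₀ hx₁ hy₀ hy₁
    exact abs_crossings_sub_volume_le (u := u) hε haa' ha'' ha₃ hbb' h.cont_right
      (h.strictMono_or_strictAnti hs₂) hQ hnull₁
  have hNv : ε * crossings (flip F) t ε u b b'' a a' ≤ 2 * (θ * (x₁ - x₀) + ε) := by
    have hd : 0 ≤ θ * (x₁ - x₀) := mul_nonneg hθ (by linarith)
    have hflat : ∀ x ∈ Set.Icc x₀ x₁, ∀ x' ∈ Set.Icc x₀ x₁, ∀ y ∈ Set.Icc y₀ y₁,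
        ∀ y' ∈ Set.Icc y₀ y₁, F x y = u → F x' y' = u → y - y' ≤ θ * (x₁ - x₀) :=
      fun x hx x' hx' y hy y' hy' hF hF' => by
        refine ((le_abs_self _).trans (hle x hx x' hx' y hy y' hy' hF hF')).trans ?_
        gcongr
        rw [abs_le]; constructor <;> linarith [hx.1, hx.2, hx'.1, hx'.2]
    subst hx₀ hx₁ hy₀ hy₁
    exact h.crossings_le_of_flat hε hd hb₃ hQ hflat
  set V := (volume (levelProj F u x₀ x₁ y₀ y₁)).toReal
  set H := crossings F t ε u a a'' b b'
  set W := crossings (flip F) t ε u b b'' a a'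
  have hH : 0 ≤ H := crossings_nonneg _ _ _ _ _ _ _ _
  have hW : 0 ≤ W := crossings_nonneg _ _ _ _ _ _ _ _
  -- The 2-norm lies between H and H + W. Here εH is within 6ε of the projected length, and εW is at
  -- most 2ε plus the rise of the level set, so W is treated purely as an error.
  have hr1 : H ≤ √(H ^ 2 + W ^ 2) := Real.le_sqrt_of_sq_le (by linarith [sq_nonneg W])
  have hr2 : √(H ^ 2 + W ^ 2) ≤ H + W := by
    rw [Real.sqrt_le_iff]; constructor <;> nlinarith
  have hr1' := mul_le_mul_of_nonneg_left hr1 hε.le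
  have hr2' := mul_le_mul_of_nonneg_left hr2 hε.le
  have hV : 2 * θ ^ 2 * V ≤ 2 * θ ^ 2 * (x₁ - x₀) := by gcongr
  have hV0 : 0 ≤ 2 * θ ^ 2 * V := by positivity
  have hxx : 0 ≤ θ * (x₁ - x₀) := mul_nonneg hθ (by linarith)
  have hxx' : 0 ≤ θ ^ 2 * (x₁ - x₀) := mul_nonneg (sq_nonneg θ) (by linarith)
  rw [abs_le] at hNh ⊢
  constructor <;> linarith

/-! ### From the plane to coordinates; consequences of regularity and compactness -/

/-- A function on the plane as a function of two real variables. -/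
noncomputable def coordFun (f : Plane → ℝ) (x y : ℝ) : ℝ := f !₂[x, y]

lemma vec_eq (s : Plane) : !₂[s 0, s 1] = s := by
  ext i; fin_cases i <;> simp

lemma vec_eq_smul (x y : ℝ) : (!₂[x, y] : Plane) =
    x • EuclideanSpace.single (0 : Fin 2) (1 : ℝ) + y • EuclideanSpace.single (1 : Fin 2) (1 : ℝ) := by
  ext i; fin_cases i <;> simp

lemma coordFun_apply (f : Plane → ℝ) (s : Plane) : coordFun f (s 0) (s 1) = f s := by
  rw [coordFun, vec_eq]

lemma continuous_vec : Continuous fun p : ℝ × ℝ => (!₂[p.1, p.2] : Plane) := by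
  simp_rw [vec_eq_smul]; fun_prop

lemma fderiv_apply_eq (f : Plane → ℝ) (s v : Plane) :
    fderiv ℝ f s v = partialDeriv 0 f s * v 0 + partialDeriv 1 f s * v 1 := by
  conv_lhs => rw [← vec_eq v, vec_eq_smul]
  simp [partialDeriv, mul_comm]

lemma contDiff_partialDeriv {f : Plane → ℝ} (hf : ContDiff ℝ 2 f) (k : Fin 2) :
    ContDiff ℝ 1 (partialDeriv k f) :=
  (hf.fderiv_right (m := 1) (by norm_num)).clm_apply contDiff_const

lemma continuous_partialDeriv {f : Plane → ℝ} (hf : ContDiff ℝ 1 f) (k : Fin 2) :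
    Continuous (partialDeriv k f) :=
  (hf.continuous_fderiv (by norm_num)).clm_apply continuous_const

lemma hasPartials {f : Plane → ℝ} (hf : ContDiff ℝ 1 f) :
    HasPartials (coordFun f) (coordFun (partialDeriv 0 f)) (coordFun (partialDeriv 1 f)) where
  cont := hf.continuous.comp continuous_vec
  cont₁ := (continuous_partialDeriv hf 0).comp continuous_vec
  cont₂ := (continuous_partialDeriv hf 1).comp continuous_vec
  deriv₁ x y := by
    have h1 := (hf.differentiable (by norm_num) !₂[x, y]).hasFDerivAt
    have h2 : HasDerivAt (fun x : ℝ => (!₂[x, y] : Plane)) (EuclideanSpace.single 0 1) x := by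
      simp_rw [vec_eq_smul]
      simpa using ((hasDerivAt_id x).smul_const (EuclideanSpace.single (0 : Fin 2) (1 : ℝ))).add_const
        (y • EuclideanSpace.single (1 : Fin 2) (1 : ℝ))
    exact h1.comp_hasDerivAt x h2
  deriv₂ x y := by
    have h1 := (hf.differentiable (by norm_num) !₂[x, y]).hasFDerivAt
    have h2 : HasDerivAt (fun y : ℝ => (!₂[x, y] : Plane)) (EuclideanSpace.single 1 1) y := by
      simp_rw [vec_eq_smul]
      simpa using ((hasDerivAt_id y).smul_const (EuclideanSpace.single (1 : Fin 2) (1 : ℝ))).const_add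
        (x • EuclideanSpace.single (0 : Fin 2) (1 : ℝ))
    exact h1.comp_hasDerivAt y h2
  -- Rolle's theorem in one variable along the segment between the two points, which stays in the
  -- rectangle.
  rolle {x₀ x₁ y₀ y₁ x x' y y'} hx hx' hy hy' hF := by
    set v : Plane := !₂[x' - x, y' - y]
    have hd : ∀ τ : ℝ, HasDerivAt (fun τ : ℝ => f (!₂[x, y] + τ • v))
        (fderiv ℝ f (!₂[x, y] + τ • v) v) τ := fun τ => by
      have h1 := (hf.differentiable (by norm_num) (!₂[x, y] + τ • v)).hasFDerivAt
      have h2 : HasDerivAt (fun τ : ℝ => (!₂[x, y] : Plane) + τ • v) v τ := by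
        simpa using ((hasDerivAt_id τ).smul_const v).const_add (!₂[x, y] : Plane)
      exact h1.comp_hasDerivAt τ h2
    have hvec : ∀ τ : ℝ, (!₂[x, y] : Plane) + τ • v = !₂[x + τ * (x' - x), y + τ * (y' - y)] :=
      fun τ => by ext i; fin_cases i <;> simp [v]
    obtain ⟨τ, hτ, h0⟩ := exists_hasDerivAt_eq_zero (f := fun τ : ℝ => f (!₂[x, y] + τ • v))
      zero_lt_one (fun τ _ => (hd τ).continuousAt.continuousWithinAt)
      (by simp only [hvec]; simpa [coordFun] using hF) (fun τ _ => hd τ)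
    have hmem : ∀ {a b z z' : ℝ}, z ∈ Set.Icc a b → z' ∈ Set.Icc a b →
        z + τ * (z' - z) ∈ Set.Icc a b := fun {a b z z'} hz hz' => by
      have := (convex_Icc a b) hz hz' (sub_nonneg.2 hτ.2.le) hτ.1.le (by ring)
      convert this using 1
      simp only [smul_eq_mul]; ring
    refine ⟨_, hmem hx hx', _, hmem hy hy', ?_⟩
    rw [fderiv_apply_eq, hvec] at h0
    simpa [coordFun, v] using h0

lemma isCompact_square (t : ℝ) : IsCompact (square t) := by
  have : square t = (fun p : ℝ × ℝ => (!₂[p.1, p.2] : Plane)) ''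
      (Set.Icc (-t) t ×ˢ Set.Icc (-t) t) := by
    ext s; constructor
    · exact fun h => ⟨(s 0, s 1), ⟨h 0, h 1⟩, vec_eq s⟩
    · rintro ⟨p, ⟨h0, h1⟩, rfl⟩ k
      fin_cases k
      · exact h0
      · exact h1
  rw [this]
  exact (isCompact_Icc.prod isCompact_Icc).image continuous_vec

lemma convex_square (t : ℝ) : Convex ℝ (square t) := by
  intro s hs s' hs' a b ha hb hab k
  exact convex_Icc (-t) t (hs k) (hs' k) ha hb hab

lemma dist_le_add (s s' : Plane) : dist s s' ≤ |s 0 - s' 0| + |s 1 - s' 1| := by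
  refine (abs_le_of_sq_le_sq' ?_ (by positivity)).2
  rw [dist_sq_eq, add_sq, sq_abs, sq_abs]
  have := mul_nonneg (abs_nonneg (s 0 - s' 0)) (abs_nonneg (s 1 - s' 1))
  linarith

lemma abs_sub_le_dist (s s' : Plane) (k : Fin 2) : |s k - s' k| ≤ dist s s' := by
  refine (abs_le_of_sq_le_sq' ?_ dist_nonneg).2
  rw [dist_sq_eq, sq_abs]
  fin_cases k
  · simp only [Fin.zero_eta]; linarith [sq_nonneg (s 1 - s' 1)]
  · simp only [Fin.mk_one]; linarith [sq_nonneg (s 0 - s' 0)]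

lemma exists_bound_partialDeriv {f : Plane → ℝ} (hf : ContDiff ℝ 2 f) (t : ℝ) :
    ∃ K : ℝ, 0 < K ∧ ∀ k, (∀ s ∈ square t, |partialDeriv k f s| ≤ K) ∧
      ∀ s ∈ square t, ∀ s' ∈ square t,
        |partialDeriv k f s - partialDeriv k f s'| ≤ K * (|s 0 - s' 0| + |s 1 - s' 1|) := by
  have : ∀ k : Fin 2, ∃ K : ℝ, (∀ s ∈ square t, |partialDeriv k f s| ≤ K) ∧
      ∀ s ∈ square t, ∀ s' ∈ square t,
        |partialDeriv k f s - partialDeriv k f s'| ≤ K * (|s 0 - s' 0| + |s 1 - s' 1|) := by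
    intro k
    have hC := contDiff_partialDeriv hf k
    obtain ⟨B, hB⟩ := (isCompact_square t).exists_bound_of_continuousOn hC.continuous.continuousOn
    obtain ⟨L, hL⟩ := hC.contDiffOn.exists_lipschitzOnWith (by norm_num) (convex_square t)
      (isCompact_square t)
    refine ⟨max B L, fun s hs => (hB s hs).trans (le_max_left _ _), fun s hs s' hs' => ?_⟩
    calc |partialDeriv k f s - partialDeriv k f s'| ≤ L * dist s s' := hL.dist_le_mul s hs s' hs'
      _ ≤ L * (|s 0 - s' 0| + |s 1 - s' 1|) := by gcongr; exact dist_le_add s s'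
      _ ≤ _ := by gcongr; exact le_max_right _ _
  choose K hK using this
  refine ⟨max 1 (max (K 0) (K 1)), by positivity, fun k => ?_⟩
  have hk : K k ≤ max 1 (max (K 0) (K 1)) := by fin_cases k <;> simp
  exact ⟨fun s hs => ((hK k).1 s hs).trans hk, fun s hs s' hs' =>
    ((hK k).2 s hs s' hs').trans (by gcongr)⟩

lemma isCompact_level {f : Plane → ℝ} (hf : Continuous f) (t u : ℝ) :
    IsCompact (square t ∩ {s | f s = u}) :=
  (isCompact_square t).inter_right (isClosed_eq hf continuous_const)

/-- The larger of the two absolute values is continuous and positive on the compact level set. -/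
lemma exists_lower_bound_partialDeriv {f : Plane → ℝ} (hf : ContDiff ℝ 1 f) {t u : ℝ}
    (hreg : RegularAtLevel f t u) :
    ∃ c : ℝ, 0 < c ∧ ∀ s ∈ square t, f s = u →
      c ≤ |partialDeriv 0 f s| ∨ c ≤ |partialDeriv 1 f s| := by
  set Z := square t ∩ {s | f s = u}
  rcases Z.eq_empty_or_nonempty with h | h
  · exact ⟨1, one_pos, fun s hs hsu => absurd (show s ∈ Z from ⟨hs, hsu⟩) (by simp [h])⟩
  · have hc : Continuous fun s => max |partialDeriv 0 f s| |partialDeriv 1 f s| :=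
      (continuous_partialDeriv hf 0).abs.max (continuous_partialDeriv hf 1).abs
    obtain ⟨z, hz, hmin⟩ := (isCompact_level hf.continuous t u).exists_isMinOn h hc.continuousOn
    refine ⟨_, ?_, fun s hs hsu => le_max_iff.1 (hmin (show s ∈ Z from ⟨hs, hsu⟩))⟩
    obtain ⟨k, hk⟩ := hreg.no_critical z hz.1 hz.2
    fin_cases k
    · exact lt_max_of_lt_left (abs_pos.2 hk)
    · exact lt_max_of_lt_right (abs_pos.2 hk)

/-- A point of the level set that is not a limit of points with f < u would be a local minimum in
the plane, hence critical. This works at points on the edge of the square as well. -/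
lemma frontier_excursionSet {f : Plane → ℝ} (hf : ContDiff ℝ 1 f) {t u : ℝ}
    (hreg : RegularAtLevel f t u) :
    excursionBoundary f t u = square t ∩ {s | f s = u} := by
  ext s
  refine and_congr_right fun hs => ⟨fun h => ?_, fun h => ?_⟩
  · exact (frontier_le_subset_eq continuous_const hf.continuous h).symm
  · rw [frontier_eq_closure_inter_closure]
    refine ⟨subset_closure (show u ≤ f s from le_of_eq h.symm), ?_⟩
    by_contra hcl
    have hmin : IsLocalMin f s := by
      have : (closure (excursionSet f u)ᶜ)ᶜ ∈ 𝓝 s := isClosed_closure.isOpen_compl.mem_nhds hcl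
      filter_upwards [this] with s' hs'
      have : s' ∈ excursionSet f u := by
        by_contra hn; exact hs' (subset_closure hn)
      exact (le_of_eq h).trans this
    obtain ⟨k, hk⟩ := hreg.no_critical s hs h
    exact hk (by simp [partialDeriv, hmin.fderiv_eq_zero])

/-- A function without degenerate zeros has finitely many zeros. -/
lemma finite_zeros {g g' g'' : ℝ → ℝ} {u a b : ℝ} (hg : ∀ x, HasDerivAt g (g' x) x)
    (hg' : ∀ x, HasDerivAt g' (g'' x) x)
    (hnd : ∀ x ∈ Set.Icc a b, ¬ (g x = u ∧ g' x = 0 ∧ g'' x = 0)) :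
    {x ∈ Set.Icc a b | g x = u}.Finite := by
  by_contra hinf
  have hgc : Continuous g := continuous_iff_continuousAt.2 fun x => (hg x).continuousAt
  -- At an accumulation point x of zeros g' vanishes, so g'' does not, and x is an isolated zero of
  -- g'. Rolle's theorem between x and a nearby zero of g - u contradicts this.
  obtain ⟨x, hx, hacc⟩ := Set.Infinite.exists_accPt_of_subset_isCompact hinf isCompact_Icc
    (fun x hx => hx.1)
  rw [accPt_iff_frequently] at hacc
  have hxu : g x = u := by
    have hcl : IsClosed {x | g x = u} := isClosed_eq hgc continuous_const
    exact hcl.mem_of_frequently_of_tendsto (hacc.mono fun y hy => hy.2.2) tendsto_id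
  have hx0 : g' x = 0 := by
    by_contra hne
    have := (hg x).eventually_ne (c := u) hne
    rw [eventually_nhdsWithin_iff] at this
    obtain ⟨y, ⟨hy1, hy2⟩, hy3⟩ := (hacc.and_eventually this).exists
    exact hy3 hy1 hy2.2
  have hx1 : g'' x ≠ 0 := fun h => hnd x hx ⟨hxu, hx0, h⟩
  have hev := (hg' x).eventually_ne (c := 0) hx1
  rw [eventually_nhdsWithin_iff, Metric.eventually_nhds_iff] at hev
  obtain ⟨r, hr, hball⟩ := hev
  obtain ⟨y, ⟨hy1, hy2⟩, hy3⟩ := (hacc.and_eventually (Metric.ball_mem_nhds x hr)).exists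
  have hyx : g x = g y := hxu.trans hy2.2.symm
  rw [Real.dist_eq, abs_lt] at hy3
  rcases lt_or_gt_of_ne hy1 with h | h
  · obtain ⟨ξ, hξ, h0⟩ := exists_hasDerivAt_eq_zero h hgc.continuousOn hyx.symm fun z _ => hg z
    refine hball ?_ hξ.2.ne h0
    rw [Real.dist_eq, abs_lt]; constructor <;> linarith [hξ.1, hξ.2]
  · obtain ⟨ξ, hξ, h0⟩ := exists_hasDerivAt_eq_zero h hgc.continuousOn hyx fun z _ => hg z
    refine hball ?_ hξ.1.ne' h0
    rw [Real.dist_eq, abs_lt]; constructor <;> linarith [hξ.1, hξ.2]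

lemma vec_mem_square {t x y : ℝ} (hx : x ∈ Set.Icc (-t) t) (hy : y ∈ Set.Icc (-t) t) :
    !₂[x, y] ∈ square t := by
  intro k; fin_cases k
  · exact hx
  · exact hy

lemma finite_zeros_row {f : Plane → ℝ} (hf : ContDiff ℝ 2 f) {t u : ℝ}
    (hreg : RegularAtLevel f t u) {y : ℝ} (hy : y ∈ Set.Icc (-t) t) :
    {x ∈ Set.Icc (-t) t | coordFun f x y = u}.Finite :=
  finite_zeros (fun x => (hasPartials (hf.of_le (by norm_num))).deriv₁ x y)
    (fun x => (hasPartials (contDiff_partialDeriv hf 0)).deriv₁ x y)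
    fun _ hx => hreg.no_degenerate 0 _ (vec_mem_square hx hy)

lemma finite_zeros_column {f : Plane → ℝ} (hf : ContDiff ℝ 2 f) {t u : ℝ}
    (hreg : RegularAtLevel f t u) {x : ℝ} (hx : x ∈ Set.Icc (-t) t) :
    {y ∈ Set.Icc (-t) t | coordFun f x y = u}.Finite :=
  finite_zeros (fun y => (hasPartials (hf.of_le (by norm_num))).deriv₂ x y)
    (fun y => (hasPartials (contDiff_partialDeriv hf 1)).deriv₂ x y)
    fun _ hy => hreg.no_degenerate 1 _ (vec_mem_square hx hy)

/-! ### Points of the level set with vanishing partial derivative -/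

/-- The points of the level set at which `f_k` is small are close to finitely many points near
which `f_kk` has constant sign. -/
lemma exists_finset_degenerate {f : Plane → ℝ} (hf : ContDiff ℝ 2 f) {t u : ℝ}
    (hreg : RegularAtLevel f t u) (k : Fin 2) :
    ∃ (S : Finset Plane) (κ η r : ℝ), 0 ≤ κ ∧ 0 < η ∧ 0 < r ∧
      (∀ z ∈ square t, f z = u → |partialDeriv k f z| < η →
        ∃ s ∈ S, dist z s ≤ κ * |partialDeriv k f z|) ∧
      ∀ s ∈ S, (∀ s', dist s' s < r → 0 < partialDeriv k (partialDeriv k f) s') ∨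
        (∀ s', dist s' s < r → partialDeriv k (partialDeriv k f) s' < 0) := by
  classical
  have hf1 : ContDiff ℝ 1 f := hf.of_le (by norm_num)
  have hpk := contDiff_partialDeriv hf k
  have hpkk := continuous_partialDeriv hpk k
  let p : Set Plane → Prop := fun U => ∃ (S : Finset Plane) (κ η r : ℝ), 0 ≤ κ ∧ 0 < η ∧ 0 < r ∧
      (∀ z ∈ U, f z = u → |partialDeriv k f z| < η →
        ∃ s ∈ S, dist z s ≤ κ * |partialDeriv k f z|) ∧
      ∀ s ∈ S, (∀ s', dist s' s < r → 0 < partialDeriv k (partialDeriv k f) s') ∨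
        (∀ s', dist s' s < r → partialDeriv k (partialDeriv k f) s' < 0)
  have hmain : p (square t ∩ {s | f s = u}) := by
    -- Compactness induction: the property passes to subsets and finite unions, so a neighbourhood
    -- of each point suffices.
    refine (isCompact_level hf.continuous t u).induction_on (p := p) ?_ ?_ ?_ ?_
    · exact ⟨∅, 0, 1, 1, le_rfl, one_pos, one_pos, by simp, by simp⟩
    · rintro U V hUV ⟨S, κ, η, r, h1, h2, h3, h4, h5⟩
      exact ⟨S, κ, η, r, h1, h2, h3, fun z hz => h4 z (hUV hz), h5⟩
    · rintro U V ⟨S, κ, η, r, h1, h2, h3, h4, h5⟩ ⟨S', κ', η', r', h1', h2', h3', h4', h5'⟩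
      refine ⟨S ∪ S', max κ κ', min η η', min r r', le_max_of_le_left h1, lt_min h2 h2',
        lt_min h3 h3', ?_, ?_⟩
      · rintro z (hz | hz) hzu hη
        · obtain ⟨s, hs, hd⟩ := h4 z hz hzu (hη.trans_le (min_le_left _ _))
          exact ⟨s, Finset.mem_union_left _ hs, hd.trans (by gcongr; exact le_max_left _ _)⟩
        · obtain ⟨s, hs, hd⟩ := h4' z hz hzu (hη.trans_le (min_le_right _ _))
          exact ⟨s, Finset.mem_union_right _ hs, hd.trans (by gcongr; exact le_max_right _ _)⟩
      · intro s hs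
        rcases Finset.mem_union.1 hs with hs | hs
        · exact (h5 s hs).imp (fun h s' hs' => h s' (hs'.trans_le (min_le_left _ _)))
            (fun h s' hs' => h s' (hs'.trans_le (min_le_left _ _)))
        · exact (h5' s hs).imp (fun h s' hs' => h s' (hs'.trans_le (min_le_right _ _)))
            (fun h s' hs' => h s' (hs'.trans_le (min_le_right _ _)))
    · rintro z₀ ⟨hz₀, hz₀u⟩
      by_cases h0 : partialDeriv k f z₀ = 0
      · have hkk : partialDeriv k (partialDeriv k f) z₀ ≠ 0 := fun h =>
          hreg.no_degenerate k z₀ hz₀ ⟨hz₀u, h0, h⟩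
        have hsign : ∃ r > 0, (∀ s', dist s' z₀ < r → 0 < partialDeriv k (partialDeriv k f) s') ∨
            (∀ s', dist s' z₀ < r → partialDeriv k (partialDeriv k f) s' < 0) := by
          rcases lt_or_gt_of_ne hkk with h | h
          · obtain ⟨r, hr, hb⟩ := Metric.eventually_nhds_iff.1
              (hpkk.continuousAt.eventually (gt_mem_nhds h))
            exact ⟨r, hr, Or.inr fun s' hs' => hb hs'⟩
          · obtain ⟨r, hr, hb⟩ := Metric.eventually_nhds_iff.1
              (hpkk.continuousAt.eventually (lt_mem_nhds h))
            exact ⟨r, hr, Or.inl fun s' hs' => hb hs'⟩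
        obtain ⟨r, hr, hsign⟩ := hsign
        -- The derivative of (f, f_k) at z₀ is triangular: f_k vanishes, so the other first
        -- derivative and f_kk do not. Injectivity bounds ‖z - z₀‖ by a multiple of the change of
        -- (f, f_k), which on the level set is that of f_k alone.
        have hG : HasFDerivAt (fun s => (f s, partialDeriv k f s))
            ((fderiv ℝ f z₀).prod (fderiv ℝ (partialDeriv k f) z₀)) z₀ :=
          (hf1.differentiable (by norm_num) z₀).hasFDerivAt.prodMk
            (hpk.differentiable (by norm_num) z₀).hasFDerivAt
        have hker : LinearMap.ker ((fderiv ℝ f z₀).prod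
            (fderiv ℝ (partialDeriv k f) z₀)).toLinearMap = ⊥ := by
          rw [LinearMap.ker_eq_bot']
          intro v hv
          have hv1 : fderiv ℝ f z₀ v = 0 := congrArg Prod.fst hv
          have hv2 : fderiv ℝ (partialDeriv k f) z₀ v = 0 := congrArg Prod.snd hv
          rw [fderiv_apply_eq] at hv1 hv2
          obtain ⟨l, hl⟩ := hreg.no_critical z₀ hz₀ hz₀u
          have hv0 : v 0 = 0 ∧ v 1 = 0 := by
            fin_cases k <;> fin_cases l <;> simp_all
          ext i; fin_cases i
          · exact hv0.1
          · exact hv0.2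
        obtain ⟨C, -, hC⟩ := LinearMap.exists_antilipschitzWith _ hker
        obtain ⟨κ, hκ0, hκ⟩ := (hG.isTheta_sub
          (hC.isUniformInducing (ContinuousLinearMap.uniformContinuous _)).isInducing).2.exists_nonneg
        refine ⟨_, mem_nhdsWithin_of_mem_nhds hκ.bound, {z₀}, κ, 1, r, hκ0, one_pos, hr, ?_, ?_⟩
        · intro z hz hzu _
          refine ⟨z₀, Finset.mem_singleton_self _, ?_⟩
          have hz' : ‖z - z₀‖ ≤ κ * ‖(f z, partialDeriv k f z) - (f z₀, partialDeriv k f z₀)‖ := hz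
          rw [hzu, hz₀u, h0, Prod.mk_sub_mk, sub_self, sub_zero, Prod.norm_mk, norm_zero,
            max_eq_right (norm_nonneg _), Real.norm_eq_abs] at hz'
          rwa [dist_eq_norm]
        · intro s hs
          rw [Finset.mem_singleton] at hs
          exact hs ▸ hsign
      -- Where f_k is not zero, taking η to be half its absolute value makes the condition void,
      -- with empty S.
      · refine ⟨_, mem_nhdsWithin_of_mem_nhds
          (hpk.continuous.abs.continuousAt.eventually (lt_mem_nhds (half_lt_self (abs_pos.2 h0)))),
          ∅, 0, |partialDeriv k f z₀| / 2, 1, le_rfl, half_pos (abs_pos.2 h0), one_pos, ?_, by simp⟩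
        intro z hz _ hlt
        exact absurd hlt (not_lt.2 (le_of_lt hz))
  obtain ⟨S, κ, η, r, h1, h2, h3, h4, h5⟩ := hmain
  exact ⟨S, κ, η, r, h1, h2, h3, fun z hz hzu => h4 z ⟨hz, hzu⟩ hzu, h5⟩

/-! ### Error in a block under uniform bounds, and numbers of blocks -/

/-- Bounds for the partial derivatives `F₁` and `F₂` of `F` in the square `[-t, t]²`, and a
description of the level set near the points where `F₁` vanishes: these are close to the finite
set `S`, and near `S` the second derivative `F₁₁` has constant sign. -/
structure LevelBounds (F F₁ F₂ F₁₁ : ℝ → ℝ → ℝ) (t u K κ η r : ℝ) (S : Finset (ℝ × ℝ)) :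
    Prop where
  partials : HasPartials F F₁ F₂
  deriv₁₁ : ∀ x y, HasDerivAt (fun x => F₁ x y) (F₁₁ x y) x
  K_pos : 0 < K
  κ_nonneg : 0 ≤ κ
  bound₁ : ∀ x ∈ Set.Icc (-t) t, ∀ y ∈ Set.Icc (-t) t, |F₁ x y| ≤ K
  lip₁ : ∀ x ∈ Set.Icc (-t) t, ∀ y ∈ Set.Icc (-t) t, ∀ x' ∈ Set.Icc (-t) t,
    ∀ y' ∈ Set.Icc (-t) t, |F₁ x y - F₁ x' y'| ≤ K * (|x - x'| + |y - y'|)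
  lip₂ : ∀ x ∈ Set.Icc (-t) t, ∀ y ∈ Set.Icc (-t) t, ∀ x' ∈ Set.Icc (-t) t,
    ∀ y' ∈ Set.Icc (-t) t, |F₂ x y - F₂ x' y'| ≤ K * (|x - x'| + |y - y'|)
  null_row : ∀ y ∈ Set.Icc (-t) t, volume {x ∈ Set.Icc (-t) t | F x y = u} = 0
  null_column : ∀ x ∈ Set.Icc (-t) t, volume {y ∈ Set.Icc (-t) t | F x y = u} = 0
  near : ∀ x ∈ Set.Icc (-t) t, ∀ y ∈ Set.Icc (-t) t, F x y = u → |F₁ x y| < η →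
    ∃ s ∈ S, |x - s.1| ≤ κ * |F₁ x y| ∧ |y - s.2| ≤ κ * |F₁ x y|
  sign : ∀ s ∈ S, (∀ x y, |x - s.1| < r → |y - s.2| < r → 0 < F₁₁ x y) ∨
    (∀ x y, |x - s.1| < r → |y - s.2| < r → F₁₁ x y < 0)

namespace LevelBounds

variable {F F₁ F₂ F₁₁ : ℝ → ℝ → ℝ} {t u K κ η r : ℝ} {S : Finset (ℝ × ℝ)}

/-- The error of the estimator in a block that contains a point of the level set at which
`|F₂| ≥ c`. -/
lemma block_error (h : LevelBounds F F₁ F₂ F₁₁ t u K κ η r S) {ε c δ : ℝ} (hε : 0 < ε)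
    (hc0 : 0 < c) (hδ0 : 0 < δ) (hδc : 8 * K * δ ≤ c) (hδη : 2 * K * δ < η)
    (hδr : (2 * κ * K + 1) * δ < r)
    {a a' a'' b b' b'' : ℕ}
    (haa' : a ≤ a') (ha'' : a' ≤ a'') (ha₃ : a'' ≤ a' + 1)
    (hbb' : b ≤ b') (hb'' : b' ≤ b'') (hb₃ : b'' ≤ b' + 1) {x₀ x₁ y₀ y₁ : ℝ}
    (hx₀ : x₀ = node t ε a) (hx₁ : x₁ = node t ε a')
    (hy₀ : y₀ = node t ε b) (hy₁ : y₁ = node t ε b')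
    (hxt : Set.Icc x₀ x₁ ⊆ Set.Icc (-t) t) (hyt : Set.Icc y₀ y₁ ⊆ Set.Icc (-t) t)
    (hxδ : x₁ - x₀ ≤ δ) (hyδ : y₁ - y₀ ≤ δ)
    {x y : ℝ} (hx : x ∈ Set.Icc x₀ x₁) (hy : y ∈ Set.Icc y₀ y₁) (hF : F x y = u)
    (hcz : c ≤ |F₂ x y|) :
    μH[1] (levelSet F u x₀ x₁ y₀ y₁) ≠ ⊤ ∧
      (|ε * √(crossings F t ε u a a'' b b' ^ 2 + crossings (flip F) t ε u b b'' a a' ^ 2) -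
          (μH[1] (levelSet F u x₀ x₁ y₀ y₁)).toReal| ≤ 12 * ε + 128 * K ^ 2 / c ^ 2 * δ ^ 3 ∨
        (∃ s ∈ S, |x - s.1| ≤ 2 * κ * K * δ ∧ |y - s.2| ≤ 2 * κ * K * δ) ∧
        |ε * √(crossings F t ε u a a'' b b' ^ 2 + crossings (flip F) t ε u b b'' a a' ^ 2) -
          (μH[1] (levelSet F u x₀ x₁ y₀ y₁)).toReal| ≤ 8 * ε + 12 * K / c * δ ^ 2) := by
  have hK := h.K_pos
  have hdx : ∀ {x x'}, x ∈ Set.Icc x₀ x₁ → x' ∈ Set.Icc x₀ x₁ → |x - x'| ≤ δ := by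
    intro x x' hx hx'
    rw [abs_le]; constructor <;> linarith [hx.1, hx.2, hx'.1, hx'.2]
  have hdy : ∀ {y y'}, y ∈ Set.Icc y₀ y₁ → y' ∈ Set.Icc y₀ y₁ → |y - y'| ≤ δ := by
    intro y y' hy hy'
    rw [abs_le]; constructor <;> linarith [hy.1, hy.2, hy'.1, hy'.2]
  have hosc : ∀ x ∈ Set.Icc x₀ x₁, ∀ y ∈ Set.Icc y₀ y₁, ∀ x' ∈ Set.Icc x₀ x₁,
      ∀ y' ∈ Set.Icc y₀ y₁, |F₁ x y - F₁ x' y'| ≤ 2 * K * δ ∧ |F₂ x y - F₂ x' y'| ≤ 2 * K * δ := by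
    intro x hx y hy x' hx' y' hy'
    have e : K * (|x - x'| + |y - y'|) ≤ 2 * K * δ := by
      have := mul_le_mul_of_nonneg_left (add_le_add (hdx hx hx') (hdy hy hy')) hK.le
      linarith
    exact ⟨(h.lip₁ x (hxt hx) y (hyt hy) x' (hxt hx') y' (hyt hy')).trans e,
      (h.lip₂ x (hxt hx) y (hyt hy) x' (hxt hx') y' (hyt hy')).trans e⟩
  have hKδ : 0 < K * δ := mul_pos hK hδ0
  -- F₂ varies by at most 2Kδ ≤ c/4 in the block.
  have hc2 : ∀ x' ∈ Set.Icc x₀ x₁, ∀ y' ∈ Set.Icc y₀ y₁, c / 2 ≤ |F₂ x' y'| := by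
    intro x' hx' y' hy'
    have h1 := (hosc x hx y hy x' hx' y' hy').2
    have h2 := abs_sub_abs_le_abs_sub (F₂ x y) (F₂ x' y')
    linarith
  have hs₂ := pos_or_neg_of_ne_zero h.partials.cont₂ (x₀ := x₀) (x₁ := x₁) (y₀ := y₀) (y₁ := y₁)
    fun x hx y hy h0 => by
      have := hc2 x hx y hy
      rw [h0, abs_zero] at this; linarith
  have hnull₁ : ∀ y ∈ Set.Icc y₀ y₁, volume {x ∈ Set.Icc x₀ x₁ | F x y = u} = 0 := fun y hy =>
    measure_mono_null (Set.inter_subset_inter_left _ hxt) (h.null_row y (hyt hy))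
  have hnull₂ : ∀ x ∈ Set.Icc x₀ x₁, volume {y ∈ Set.Icc y₀ y₁ | F x y = u} = 0 := fun x hx =>
    measure_mono_null (Set.inter_subset_inter_left _ hyt) (h.null_column x (hxt hx))
  by_cases hz : ∀ x ∈ Set.Icc x₀ x₁, ∀ y ∈ Set.Icc y₀ y₁, F₁ x y ≠ 0
  · have hs₁ := pos_or_neg_of_ne_zero h.partials.cont₁ hz
    obtain ⟨hfin, herr⟩ := h.partials.monotone_block_error (u := u) (c := c / 2) (K := K)
      (κ := 2 * K * δ) hε haa' ha'' ha₃ hbb' hb'' hb₃ hx₀ hx₁ hy₀ hy₁ hs₁ hs₂ (by positivity) hc2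
      (fun x hx y hy => h.bound₁ x (hxt hx) y (hyt hy)) hosc (by linarith) hnull₁ hnull₂
    refine ⟨hfin, Or.inl (herr.trans ?_)⟩
    refine add_le_add le_rfl ?_
    have : (x₁ - x₀) + (y₁ - y₀) ≤ 2 * δ := by linarith
    calc 4 * (2 * K * δ) ^ 2 / (c / 2) ^ 2 * ((x₁ - x₀) + (y₁ - y₀))
        ≤ 4 * (2 * K * δ) ^ 2 / (c / 2) ^ 2 * (2 * δ) := by gcongr
      _ = 128 * K ^ 2 / c ^ 2 * δ ^ 3 := by field_simp; ring
  · push Not at hz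
    obtain ⟨x', hx', y', hy', h0⟩ := hz
    -- F₁ has a zero in the block, so it is O(δ) throughout, and `near` places the block close to S.
    have hF₁ : ∀ x ∈ Set.Icc x₀ x₁, ∀ y ∈ Set.Icc y₀ y₁, |F₁ x y| ≤ 2 * K * δ :=
      fun x hx y hy => by
        have := (hosc x hx y hy x' hx' y' hy').1
        rwa [h0, sub_zero] at this
    have hFz := hF₁ x hx y hy
    obtain ⟨s, hs, hs1, hs2⟩ := h.near x (hxt hx) y (hyt hy) hF (hFz.trans_lt hδη)
    have hκ := mul_le_mul_of_nonneg_left hFz h.κ_nonneg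
    have hs1' : |x - s.1| ≤ 2 * κ * K * δ := by linarith
    have hs2' : |y - s.2| ≤ 2 * κ * K * δ := by linarith
    have hr₁ : ∀ x' ∈ Set.Icc x₀ x₁, |x' - s.1| < r := fun x' hx' => by
      have := abs_sub_le x' x s.1
      have := hdx hx' hx
      linarith
    have hr₂ : ∀ y' ∈ Set.Icc y₀ y₁, |y' - s.2| < r := fun y' hy' => by
      have := abs_sub_le y' y s.2
      have := hdy hy' hy
      linarith
    have hcont : ∀ y, ContinuousOn (fun x => F x y) (Set.Icc x₀ x₁) := fun y =>
      (h.partials.symm.cont_right y).continuousOn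
    -- The rows need not be monotone here, but F₁₁ has constant sign near S, so they are all convex
    -- or all concave.
    have hQ : ∀ y ∈ Set.Icc y₀ y₁, IsIntervalLike F u x₀ x₁ y := fun y hy => by
      rcases h.sign s hs with hsg | hsg
      · exact isIntervalLike_of_convexOn (convexOn_of_hasDerivWithinAt2_nonneg (convex_Icc _ _)
          (hcont y) (fun x _ => (h.partials.deriv₁ x y).hasDerivWithinAt)
          (fun x _ => (h.deriv₁₁ x y).hasDerivWithinAt)
          fun x hx => (hsg x y (hr₁ x (interior_subset hx)) (hr₂ y hy)).le)
      · exact isIntervalLike_of_concaveOn (concaveOn_of_hasDerivWithinAt2_nonpos (convex_Icc _ _)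
          (hcont y) (fun x _ => (h.partials.deriv₁ x y).hasDerivWithinAt)
          (fun x _ => (h.deriv₁₁ x y).hasDerivWithinAt)
          fun x hx => (hsg x y (hr₁ x (interior_subset hx)) (hr₂ y hy)).le)
    -- The bound 2Kδ for |F₁| divided by the bound c/2 for |F₂|.
    set θ := 4 * K * δ / c with hθ
    have hθ0 : 0 ≤ θ := by positivity
    have hθ1 : θ ≤ 1 / 2 := by rw [hθ, div_le_iff₀ hc0]; linarith
    obtain ⟨hfin, herr⟩ := h.partials.flat_block_error (u := u) (c := c / 2) (θ := θ)
      hε haa' ha'' ha₃ hbb' hb₃ hx₀ hx₁ hy₀ hy₁ hs₂ (by positivity) hc2 hθ0 (by nlinarith)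
      (fun x hx y hy => (hF₁ x hx y hy).trans (le_of_eq (by rw [hθ]; field_simp; ring))) hQ hnull₁
    refine ⟨hfin, Or.inr ⟨⟨s, hs, hs1', hs2'⟩, herr.trans ?_⟩⟩
    have e1 : θ * (x₁ - x₀) ≤ θ * δ := by gcongr
    have e2 : θ ^ 2 * (x₁ - x₀) ≤ 1 / 2 * (θ * δ) := by
      have : θ ^ 2 * (x₁ - x₀) = θ * (θ * (x₁ - x₀)) := by ring
      rw [this]
      have hθδ : 0 ≤ θ * δ := by positivity
      calc θ * (θ * (x₁ - x₀)) ≤ θ * (θ * δ) := by gcongr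
        _ ≤ 1 / 2 * (θ * δ) := by gcongr
    have e3 : 12 * K / c * δ ^ 2 = 3 * (θ * δ) := by rw [hθ]; field_simp; ring
    rw [e3]; linarith

/-- The number of the blocks that contain a point of the level set at which `|F₂| ≥ c`. -/
lemma card_blocks_mul_le (h : LevelBounds F F₁ F₂ F₁₁ t u K κ η r S) {ε c : ℝ} {m : ℕ}
    (hε : 0 < ε) (hm : 0 < m) (ht : 0 < t)
    (hc0 : 0 < c) (hδc : 8 * K * (m * ε) ≤ c) (hδt : m * ε ≤ t) {A : Finset (ℕ × ℕ)}
    (hA : ∀ p ∈ A, m ∣ p.1 ∧ m ∣ p.2 ∧ ∃ x ∈ Set.Icc (-t) t, ∃ y ∈ Set.Icc (-t) t,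
      node t ε p.1 ≤ x ∧ x ≤ node t ε p.1 + m * ε ∧ node t ε p.2 ≤ y ∧ y ≤ node t ε p.2 + m * ε ∧
      F x y = u ∧ c ≤ |F₂ x y|) :
    A.card * (m * ε) ≤ 4 * t * ((16 * K * t / c + 1) * (2 * K / c + 3)) := by
  have hK := h.K_pos
  set δ := (m : ℝ) * ε with hδ
  have hδ0 : 0 < δ := by positivity
  have hnode : ∀ i, m ∣ i → node t ε i = -t + (i / m : ℕ) * δ := fun i ⟨k, hk⟩ => by
    rw [hk, Nat.mul_div_cancel_left _ hm, node, hδ]; push_cast; ring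
  set D := ⌈2 * K / c + 1⌉₊
  set ρ := c / (8 * K) with hρ
  have hρ0 : 0 < ρ := by positivity
  have hδρ : δ ≤ ρ := by rw [hρ, le_div_iff₀ (by positivity)]; linarith
  -- A block is encoded by its column, a horizontal strip of height ρ and its row modulo D + 1. Two
  -- level points with the same column and strip span a rectangle in which |F₂| ≥ c/2, so their
  -- heights differ by at most (2K/c)δ and their block rows by at most D. Equal residues then force
  -- equal rows. Only the number of columns grows, like 1/δ.
  let φ : ℕ × ℕ → ℕ × ℕ × ℕ := fun p =>
    (p.1 / m, ⌊((p.2 / m : ℕ) : ℝ) * δ / ρ⌋₊, (p.2 / m) % (D + 1))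
  have hcard : A.card ≤ (Finset.range (⌊2 * t / δ⌋₊ + 1) ×ˢ
      (Finset.range (⌊2 * t / ρ⌋₊ + 1) ×ˢ Finset.range (D + 1))).card := by
    refine Finset.card_le_card_of_injOn φ ?_ ?_
    · intro p hp
      obtain ⟨h1, h2, x, hx, y, hy, hx1, hx2, hy1, hy2, -⟩ := hA p hp
      rw [hnode _ h1] at hx1
      rw [hnode _ h2] at hy1
      simp only [φ, Finset.coe_product, Set.mem_prod, Finset.mem_coe, Finset.mem_range,
        Nat.lt_succ_iff]
      refine ⟨Nat.le_floor ?_, Nat.floor_le_floor ?_, Nat.le_of_lt_succ (Nat.mod_lt _ (by omega))⟩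
      · rw [le_div_iff₀ hδ0]; linarith [hx.2]
      · exact div_le_div_of_nonneg_right (by linarith [hy.2]) hρ0.le
    · intro p hp q hq hpq
      obtain ⟨h1, h2, x, hx, y, hy, hx1, hx2, hy1, hy2, hF, hFc⟩ := hA p hp
      obtain ⟨h1', h2', x', hx', y', hy', hx1', hx2', hy1', hy2', hF', -⟩ := hA q hq
      simp only [φ, Prod.mk.injEq] at hpq
      obtain ⟨e1, e2, e3⟩ := hpq
      have e1' : p.1 = q.1 := by rw [← Nat.div_mul_cancel h1, e1, Nat.div_mul_cancel h1']
      rw [hnode _ h2] at hy1 hy2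
      rw [hnode _ h2'] at hy1' hy2'
      rw [e1'] at hx1 hx2
      have hxx : |x - x'| ≤ δ := by rw [abs_le]; constructor <;> linarith
      set β := p.2 / m
      set β' := q.2 / m
      have hβ : |(β : ℝ) * δ - β' * δ| ≤ ρ := by
        have f1 := Nat.floor_le (show 0 ≤ (β : ℝ) * δ / ρ by positivity)
        have f2 := Nat.lt_floor_add_one ((β : ℝ) * δ / ρ)
        have f3 := Nat.floor_le (show 0 ≤ (β' : ℝ) * δ / ρ by positivity)
        have f4 := Nat.lt_floor_add_one ((β' : ℝ) * δ / ρ)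
        rw [e2] at f1 f2
        have : |((β : ℝ) * δ - β' * δ) / ρ| ≤ 1 := by
          rw [sub_div, abs_le]; constructor <;> linarith
        rwa [abs_div, abs_of_pos hρ0, div_le_one hρ0] at this
      have hyy : |y - y'| ≤ ρ + δ := by
        rw [abs_le] at hβ ⊢; constructor <;> linarith
      have hKρ : K * (ρ + δ) ≤ c / 4 := by
        have : K * ρ = c / 8 := by rw [hρ]; field_simp
        linarith
      have hsubx : Set.uIcc x x' ⊆ Set.Icc (-t) t := Set.uIcc_subset_Icc hx hx'
      have hsuby : Set.uIcc y y' ⊆ Set.Icc (-t) t := Set.uIcc_subset_Icc hy hy'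
      have hlow : ∀ ξ ∈ Set.uIcc x x', ∀ υ ∈ Set.uIcc y y', c / 2 ≤ |F₂ ξ υ| := by
        intro ξ hξ υ hυ
        have g1 := h.lip₂ x hx y hy ξ (hsubx hξ) υ (hsuby hυ)
        have g2 : |x - ξ| ≤ |x - x'| := by
          rw [abs_sub_comm x ξ, abs_sub_comm x x']; exact Set.abs_sub_left_of_mem_uIcc hξ
        have g3 : |y - υ| ≤ |y - y'| := by
          rw [abs_sub_comm y υ, abs_sub_comm y y']; exact Set.abs_sub_left_of_mem_uIcc hυ
        have g4 := mul_le_mul_of_nonneg_left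
          (add_le_add (g2.trans hxx) (g3.trans hyy)) hK.le
        have g5 := abs_sub_abs_le_abs_sub (F₂ x y) (F₂ ξ υ)
        linarith
      have hclose := h.partials.abs_sub_le hlow
        (fun ξ hξ υ hυ => h.bound₁ ξ (hsubx hξ) υ (hsuby hυ)) Set.left_mem_uIcc
        Set.right_mem_uIcc Set.left_mem_uIcc Set.right_mem_uIcc (hF.trans hF'.symm)
      rw [abs_sub_comm y' y, abs_sub_comm x' x] at hclose
      have hyy2 : |y - y'| ≤ 2 * K / c * δ := by
        have := mul_le_mul_of_nonneg_left hxx hK.le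
        rw [div_mul_eq_mul_div, le_div_iff₀ hc0]; linarith
      have hββ : |(β : ℝ) - β'| ≤ 2 * K / c + 1 := by
        have : |(β : ℝ) - β'| * δ ≤ (2 * K / c + 1) * δ := by
          rw [← abs_of_pos hδ0, ← abs_mul, abs_of_pos hδ0, sub_mul, add_mul, one_mul]
          rw [abs_le] at hyy2 ⊢; constructor <;> linarith
        exact le_of_mul_le_mul_right this hδ0
      have hD : |(β : ℝ) - β'| ≤ D := hββ.trans (Nat.le_ceil _)
      have hββ' : β = β' := by
        have hD' : |(β : ℤ) - β'| ≤ D := by exact_mod_cast hD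
        have hmod : (β : ℤ) ≡ β' [ZMOD (D + 1 : ℕ)] := by exact_mod_cast (show β ≡ β' [MOD D + 1] from e3)
        have hdvd := hmod.symm.dvd
        have := Int.eq_zero_of_abs_lt_dvd hdvd (by push_cast; omega)
        omega
      have e2' : p.2 = q.2 := by
        rw [← Nat.div_mul_cancel h2, ← Nat.div_mul_cancel h2']; exact congrArg (· * m) hββ'
      exact Prod.ext e1' e2'
  rw [Finset.card_product, Finset.card_product, Finset.card_range, Finset.card_range,
    Finset.card_range] at hcard
  have hcard' : (A.card : ℝ) ≤ (⌊2 * t / δ⌋₊ + 1) * ((⌊2 * t / ρ⌋₊ + 1) * (D + 1)) := by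
    exact_mod_cast hcard
  have b1 : (⌊2 * t / δ⌋₊ + 1 : ℝ) * δ ≤ 4 * t := by
    have := Nat.floor_le (show 0 ≤ 2 * t / δ by positivity)
    rw [le_div_iff₀ hδ0] at this
    linarith
  have b2 : (⌊2 * t / ρ⌋₊ + 1 : ℝ) ≤ 16 * K * t / c + 1 := by
    have := Nat.floor_le (show 0 ≤ 2 * t / ρ by positivity)
    have e : 2 * t / ρ = 16 * K * t / c := by rw [hρ]; field_simp; ring
    linarith
  have b3 : (D + 1 : ℝ) ≤ 2 * K / c + 3 := by
    have := Nat.ceil_lt_add_one (show 0 ≤ 2 * K / c + 1 by positivity)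
    linarith
  calc A.card * δ ≤ (⌊2 * t / δ⌋₊ + 1) * ((⌊2 * t / ρ⌋₊ + 1) * (D + 1)) * δ := by gcongr
    _ = ((⌊2 * t / δ⌋₊ + 1) * δ) * ((⌊2 * t / ρ⌋₊ + 1) * (D + 1)) := by ring
    _ ≤ _ := by gcongr

end LevelBounds

/-- The number of the blocks that are close to a finite set. -/
lemma card_near_blocks_le {t ε q : ℝ} {m : ℕ} (hε : 0 < ε) (hm : 0 < m) (hq : 0 ≤ q)
    {B : Finset (ℕ × ℕ)} {S : Finset (ℝ × ℝ)}
    (hB : ∀ p ∈ B, m ∣ p.1 ∧ m ∣ p.2 ∧ ∃ x y : ℝ,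
      node t ε p.1 ≤ x ∧ x ≤ node t ε p.1 + m * ε ∧ node t ε p.2 ≤ y ∧ y ≤ node t ε p.2 + m * ε ∧
      ∃ s ∈ S, |x - s.1| ≤ q * (m * ε) ∧ |y - s.2| ≤ q * (m * ε)) :
    (B.card : ℝ) ≤ S.card * (2 * q + 2) ^ 2 := by
  classical
  set δ := (m : ℝ) * ε with hδ
  have hδ0 : 0 < δ := by positivity
  have hnode : ∀ i, m ∣ i → node t ε i = -t + (i / m : ℕ) * δ := fun i ⟨k, hk⟩ => by
    rw [hk, Nat.mul_div_cancel_left _ hm, node, hδ]; push_cast; ring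
  let near : ℝ × ℝ → ℕ × ℕ → Prop := fun s p => ∃ x y : ℝ,
      node t ε p.1 ≤ x ∧ x ≤ node t ε p.1 + δ ∧ node t ε p.2 ≤ y ∧ y ≤ node t ε p.2 + δ ∧
      |x - s.1| ≤ q * δ ∧ |y - s.2| ≤ q * δ
  have hsub : B ⊆ S.biUnion fun s => B.filter (near s) := fun p hp => by
    obtain ⟨-, -, x, y, h1, h2, h3, h4, s, hs, h5, h6⟩ := hB p hp
    exact Finset.mem_biUnion.2 ⟨s, hs, Finset.mem_filter.2 ⟨hp, x, y, h1, h2, h3, h4, h5, h6⟩⟩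
  have hone : ∀ s ∈ S, ((B.filter (near s)).card : ℝ) ≤ (2 * q + 2) ^ 2 := by
    intro s _
    set U := (B.filter (near s)).image fun p => p.1 / m
    set V := (B.filter (near s)).image fun p => p.2 / m
    have hle : (B.filter (near s)).card ≤ (U ×ˢ V).card := by
      refine Finset.card_le_card_of_injOn (fun p => (p.1 / m, p.2 / m)) ?_ ?_
      · intro p hp
        exact Finset.mem_coe.2 (Finset.mem_product.2
          ⟨Finset.mem_image_of_mem _ hp, Finset.mem_image_of_mem _ hp⟩)
      · intro p hp p' hp' he
        obtain ⟨h1, h2, -⟩ := hB p (Finset.mem_filter.1 hp).1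
        obtain ⟨h1', h2', -⟩ := hB p' (Finset.mem_filter.1 hp').1
        simp only [Prod.mk.injEq] at he
        exact Prod.ext (by rw [← Nat.div_mul_cancel h1, he.1, Nat.div_mul_cancel h1'])
          (by rw [← Nat.div_mul_cancel h2, he.2, Nat.div_mul_cancel h2'])
    -- Two such blocks hold points at distance at most 2qδ in this coordinate, and a block of width
    -- δ adds one more unit.
    have hU : (U.card : ℝ) ≤ (2 * q + 1) + 1 := by
      refine card_le_of_forall_sub_le (by linarith) fun i hi j hj => ?_
      obtain ⟨p, hp, rfl⟩ := Finset.mem_image.1 hi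
      obtain ⟨p', hp', rfl⟩ := Finset.mem_image.1 hj
      obtain ⟨hpB, x, y, h1, h2, h3, h4, h5, h6⟩ := Finset.mem_filter.1 hp
      obtain ⟨hpB', x', y', h1', h2', h3', h4', h5', h6'⟩ := Finset.mem_filter.1 hp'
      rw [hnode _ (hB p hpB).1] at h1 h2
      rw [hnode _ (hB p' hpB').1] at h1' h2'
      rw [abs_le] at h5 h5'
      refine le_of_mul_le_mul_right ?_ hδ0
      linarith
    have hV : (V.card : ℝ) ≤ (2 * q + 1) + 1 := by
      refine card_le_of_forall_sub_le (by linarith) fun i hi j hj => ?_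
      obtain ⟨p, hp, rfl⟩ := Finset.mem_image.1 hi
      obtain ⟨p', hp', rfl⟩ := Finset.mem_image.1 hj
      obtain ⟨hpB, x, y, h1, h2, h3, h4, h5, h6⟩ := Finset.mem_filter.1 hp
      obtain ⟨hpB', x', y', h1', h2', h3', h4', h5', h6'⟩ := Finset.mem_filter.1 hp'
      rw [hnode _ (hB p hpB).2.1] at h3 h4
      rw [hnode _ (hB p' hpB').2.1] at h3' h4'
      rw [abs_le] at h6 h6'
      refine le_of_mul_le_mul_right ?_ hδ0
      linarith
    rw [Finset.card_product] at hle
    calc ((B.filter (near s)).card : ℝ) ≤ U.card * V.card := by exact_mod_cast hle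
      _ ≤ (2 * q + 1 + 1) * (2 * q + 1 + 1) := by gcongr
      _ = (2 * q + 2) ^ 2 := by ring
  calc (B.card : ℝ) ≤ ∑ s ∈ S, ((B.filter (near s)).card : ℝ) := by
        exact_mod_cast (Finset.card_le_card hsub).trans Finset.card_biUnion_le
    _ ≤ ∑ s ∈ S, (2 * q + 2) ^ 2 := Finset.sum_le_sum hone
    _ = _ := by rw [Finset.sum_const, nsmul_eq_mul]

lemma exists_near_finset {f : Plane → ℝ} (hf : ContDiff ℝ 2 f) {t u : ℝ}
    (hreg : RegularAtLevel f t u) (k : Fin 2) :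
    ∃ (S : Finset (ℝ × ℝ)) (κ η r : ℝ), 0 ≤ κ ∧ 0 < η ∧ 0 < r ∧
      (∀ x ∈ Set.Icc (-t) t, ∀ y ∈ Set.Icc (-t) t, coordFun f x y = u →
        |coordFun (partialDeriv k f) x y| < η →
        ∃ s ∈ S, |x - s.1| ≤ κ * |coordFun (partialDeriv k f) x y| ∧
          |y - s.2| ≤ κ * |coordFun (partialDeriv k f) x y|) ∧
      ∀ s ∈ S, (∀ x y, |x - s.1| < r → |y - s.2| < r →
          0 < coordFun (partialDeriv k (partialDeriv k f)) x y) ∨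
        (∀ x y, |x - s.1| < r → |y - s.2| < r →
          coordFun (partialDeriv k (partialDeriv k f)) x y < 0) := by
  classical
  obtain ⟨S, κ, η, r, h1, h2, h3, h4, h5⟩ := exists_finset_degenerate hf hreg k
  -- Halving r makes the coordinatewise square fit into the Euclidean ball of radius r.
  refine ⟨S.image fun s => (s 0, s 1), κ, η, r / 2, h1, h2, half_pos h3, ?_, ?_⟩
  · intro x hx y hy hF hη
    obtain ⟨s, hs, hd⟩ := h4 _ (vec_mem_square hx hy) hF hη
    refine ⟨_, Finset.mem_image_of_mem _ hs, ?_, ?_⟩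
    · exact (abs_sub_le_dist !₂[x, y] s 0).trans hd
    · exact (abs_sub_le_dist !₂[x, y] s 1).trans hd
  · intro p hp
    obtain ⟨s, hs, rfl⟩ := Finset.mem_image.1 hp
    have hd : ∀ x y : ℝ, |x - s 0| < r / 2 → |y - s 1| < r / 2 → dist !₂[x, y] s < r :=
      fun x y hx hy => by
        have : dist !₂[x, y] s ≤ |x - s 0| + |y - s 1| := dist_le_add !₂[x, y] s
        linarith
    exact (h5 s hs).imp (fun h x y hx hy => h _ (hd x y hx hy)) fun h x y hx hy => h _ (hd x y hx hy)

/-- The second set of bounds has the coordinates exchanged and serves the blocks in which the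
derivative in the first coordinate is the large one; its exceptional points are exchanged
accordingly. -/
lemma exists_levelBounds {f : Plane → ℝ} (hf : ContDiff ℝ 2 f) {t u : ℝ}
    (hreg : RegularAtLevel f t u) :
    ∃ (K κ η r κ' η' r' : ℝ) (S S' : Finset (ℝ × ℝ)), 0 < η ∧ 0 < r ∧ 0 < η' ∧ 0 < r' ∧
      LevelBounds (coordFun f) (coordFun (partialDeriv 0 f)) (coordFun (partialDeriv 1 f))
        (coordFun (partialDeriv 0 (partialDeriv 0 f))) t u K κ η r S ∧
      LevelBounds (flip (coordFun f)) (flip (coordFun (partialDeriv 1 f)))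
        (flip (coordFun (partialDeriv 0 f)))
        (flip (coordFun (partialDeriv 1 (partialDeriv 1 f)))) t u K κ' η' r' S' := by
  classical
  obtain ⟨K, hK, hKb⟩ := exists_bound_partialDeriv hf t
  obtain ⟨S, κ, η, r, h1, h2, h3, h4, h5⟩ := exists_near_finset hf hreg 0
  obtain ⟨S', κ', η', r', h1', h2', h3', h4', h5'⟩ := exists_near_finset hf hreg 1
  have hP := hasPartials (hf.of_le (by norm_num : (1 : WithTop ℕ∞) ≤ 2))
  have hbound : ∀ k, ∀ x ∈ Set.Icc (-t) t, ∀ y ∈ Set.Icc (-t) t,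
      |coordFun (partialDeriv k f) x y| ≤ K :=
    fun k x hx y hy => (hKb k).1 _ (vec_mem_square hx hy)
  have hlip : ∀ k, ∀ x ∈ Set.Icc (-t) t, ∀ y ∈ Set.Icc (-t) t, ∀ x' ∈ Set.Icc (-t) t,
      ∀ y' ∈ Set.Icc (-t) t, |coordFun (partialDeriv k f) x y - coordFun (partialDeriv k f) x' y'|
        ≤ K * (|x - x'| + |y - y'|) := fun k x hx y hy x' hx' y' hy' => by
    exact (hKb k).2 _ (vec_mem_square hx hy) _ (vec_mem_square hx' hy')
  refine ⟨K, κ, η, r, κ', η', r', S, S'.image Prod.swap, h2, h3, h2', h3', ?_, ?_⟩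
  · exact
      { partials := hP
        deriv₁₁ := (hasPartials (contDiff_partialDeriv hf 0)).deriv₁
        K_pos := hK
        κ_nonneg := h1
        bound₁ := hbound 0
        lip₁ := hlip 0
        lip₂ := hlip 1
        null_row := fun y hy => (finite_zeros_row hf hreg hy).measure_zero _
        null_column := fun x hx => (finite_zeros_column hf hreg hx).measure_zero _
        near := h4
        sign := h5 }
  · exact
      { partials := hP.symm
        deriv₁₁ := fun y x => (hasPartials (contDiff_partialDeriv hf 1)).deriv₂ x y
        K_pos := hK
        κ_nonneg := h1'
        bound₁ := fun y hy x hx => hbound 1 x hx y hy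
        lip₁ := fun y hy x hx y' hy' x' hx' => by
          rw [add_comm]; exact hlip 1 x hx y hy x' hx' y' hy'
        lip₂ := fun y hy x hx y' hy' x' hx' => by
          rw [add_comm]; exact hlip 0 x hx y hy x' hx' y' hy'
        null_row := fun x hx => (finite_zeros_column hf hreg hx).measure_zero _
        null_column := fun y hy => (finite_zeros_row hf hreg hy).measure_zero _
        near := fun y hy x hx hF hη => by
          obtain ⟨s, hs, hs1, hs2⟩ := h4' x hx y hy hF hη
          exact ⟨s.swap, Finset.mem_image_of_mem _ hs, hs2, hs1⟩
        sign := fun p hp => by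
          obtain ⟨s, hs, rfl⟩ := Finset.mem_image.1 hp
          exact (h5' s hs).imp (fun h y x hy hx => h x y hx hy) fun h y x hy hx => h x y hx hy }

/-! ### The grid and the decomposition of estimator and perimeter into blocks -/

section Grid

variable {t ε : ℝ} {N : ℕ}

lemma gridPoint_mem_square (hε : 0 < ε) (hN : N * ε = 2 * t) {i j : ℕ} :
    gridPoint t ε i j ∈ square t ↔ i ≤ N ∧ j ≤ N := by
  have key : ∀ i : ℕ, -t + i * ε ∈ Set.Icc (-t) t ↔ i ≤ N := fun i => by
    rw [← Nat.cast_le (α := ℝ), ← mul_le_mul_iff_left₀ hε, hN, Set.mem_Icc]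
    have : 0 ≤ i * ε := by positivity
    constructor
    · rintro ⟨-, h⟩; linarith
    · intro h; constructor <;> linarith
  rw [← key i, ← key j]
  exact ⟨fun h => ⟨h 0, h 1⟩, fun h => vec_mem_square h.1 h.2⟩

lemma numRows_eq (hε : 0 < ε) (hN : N * ε = 2 * t) : numRows t ε = N + 1 := by
  have : {j : ℕ | ∃ i : ℕ, gridPoint t ε i j ∈ grid t ε} = (Finset.range (N + 1) : Set ℕ) := by
    ext j
    simp only [Set.mem_ofPred_eq, Finset.coe_range, Set.mem_Iio, Nat.lt_succ_iff]
    constructor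
    · rintro ⟨i, -, h⟩
      exact ((gridPoint_mem_square hε hN).1 h).2
    · exact fun h => ⟨0, ⟨0, j, rfl⟩, (gridPoint_mem_square hε hN).2 ⟨Nat.zero_le _, h⟩⟩
  rw [numRows, this, Set.ncard_coe_finset, Finset.card_range]

lemma exists_mul_eq_of_vertices_subset (h : vertices t ⊆ grid t ε) : ∃ N : ℕ, N * ε = 2 * t := by
  have hv : !₂[t, t] ∈ vertices t := fun k => by fin_cases k <;> simp
  obtain ⟨⟨i, j, hij⟩, -⟩ := h hv
  have := congrArg (fun s : Plane => s 0) hij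
  simp only [gridPoint] at this
  exact ⟨i, by simp at this; linarith⟩

lemma zeta_eq (f : Plane → ℝ) (t ε u : ℝ) (i j : ℕ) :
    zeta f t ε u i j = threshold u (coordFun f (node t ε i) (node t ε j)) := by
  by_cases h : u ≤ f (gridPoint t ε i j)
  · rw [zeta, Set.indicator_of_mem (show gridPoint t ε i j ∈ excursionSet f u from h)]
    exact (if_pos h).symm
  · rw [zeta, Set.indicator_of_notMem (show gridPoint t ε i j ∉ excursionSet f u from h)]
    exact (if_neg h).symm

/-- The vertical count is the horizontal one of the flipped function. Indices along the edges stop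
at N because an edge needs a successor; those across the edges stop at N + 1, so that the last row
or column is counted. -/
lemma estimator_two_eq (f : Plane → ℝ) (u : ℝ) (m : ℕ) (hε : 0 < ε) (hN : N * ε = 2 * t) :
    estimator 2 f ε m t u = ∑ p ∈ blockIndices t ε m ×ˢ blockIndices t ε m,
      ε * √(crossings (coordFun f) t ε u p.1 (min (p.1 + m) (N + 1)) p.2 (min (p.2 + m) N) ^ 2 +
        crossings (flip (coordFun f)) t ε u p.2 (min (p.2 + m) (N + 1)) p.1
          (min (p.1 + m) N) ^ 2) := by
  rw [estimator, Finset.sum_product, Finset.mul_sum]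
  refine Finset.sum_congr rfl fun a _ => ?_
  rw [Finset.mul_sum]
  refine Finset.sum_congr rfl fun b _ => ?_
  have hH : countH f t ε u m a b = crossings (coordFun f) t ε u a (min (a + m) (N + 1)) b
      (min (b + m) N) := by
    simp only [countH, crossings, numRows_eq hε hN, zeta_eq, Nat.add_sub_cancel]
  have hV : countV f t ε u m a b = crossings (flip (coordFun f)) t ε u b
      (min (b + m) (N + 1)) a (min (a + m) N) := by
    simp only [countV, crossings, numRows_eq hε hN, zeta_eq, Nat.add_sub_cancel, flip]
    rw [Finset.sum_comm]
  rw [hH, hV, EuclideanSpace.norm_eq, Fin.sum_univ_two]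
  simp

lemma mem_blockIndices (hε : 0 < ε) (hN : N * ε = 2 * t) {m i : ℕ} :
    i ∈ blockIndices t ε m ↔ i ≤ N ∧ m ∣ i := by
  rw [blockIndices, Finset.mem_filter, numRows_eq hε hN, Finset.mem_range, Nat.lt_succ_iff,
    Nat.modEq_zero_iff_dvd]

lemma node_eq_right (hN : N * ε = 2 * t) : node t ε N = t := by
  unfold node; linarith

lemma exists_block (hε : 0 < ε) (hN : N * ε = 2 * t) {m : ℕ} (hm : 0 < m) {x : ℝ}
    (hx : x ∈ Set.Icc (-t) t) :
    ∃ a ∈ blockIndices t ε m, x ∈ Set.Icc (node t ε a) (node t ε (min (a + m) N)) := by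
  have hδ : 0 < (m : ℝ) * ε := by positivity
  have h0 : 0 ≤ (x + t) / (m * ε) := div_nonneg (by linarith [hx.1]) hδ.le
  have h1 := Nat.floor_le h0
  have h2 := Nat.lt_floor_add_one ((x + t) / (m * ε))
  set α := ⌊(x + t) / (m * ε)⌋₊
  rw [le_div_iff₀ hδ] at h1
  rw [div_lt_iff₀ hδ] at h2
  have hle : m * α ≤ N := by
    have : ((m * α : ℕ) : ℝ) * ε ≤ N * ε := by push_cast; linarith [hx.2]
    exact_mod_cast le_of_mul_le_mul_right this hε
  refine ⟨m * α, (mem_blockIndices hε hN).2 ⟨hle, dvd_mul_right _ _⟩, ?_, ?_⟩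
  · unfold node; push_cast; linarith
  · rcases min_choice (m * α + m) N with h | h <;> rw [h]
    · unfold node; push_cast; linarith
    · rw [node_eq_right hN]; exact hx.2

end Grid

/-- The part of the level set in the block with the lower left node `p`. -/
def blockLevelSet (F : ℝ → ℝ → ℝ) (u t ε : ℝ) (m N : ℕ) (p : ℕ × ℕ) : Set Plane :=
  levelSet F u (node t ε p.1) (node t ε (min (p.1 + m) N)) (node t ε p.2)
    (node t ε (min (p.2 + m) N))

lemma measurableSet_levelSet {F : ℝ → ℝ → ℝ} (hF : Continuous fun p : ℝ × ℝ => F p.1 p.2)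
    (u x₀ x₁ y₀ y₁ : ℝ) : MeasurableSet (levelSet F u x₀ x₁ y₀ y₁) := by
  have h0 : Continuous fun s : Plane => s 0 := by fun_prop
  have h1 : Continuous fun s : Plane => s 1 := by fun_prop
  exact ((isClosed_Icc.preimage h0).inter ((isClosed_Icc.preimage h1).inter
    (isClosed_eq (hF.comp (h0.prodMk h1)) continuous_const))).measurableSet

lemma hausdorffMeasure_level_line {f : Plane → ℝ} (hf : ContDiff ℝ 2 f) {t u : ℝ}
    (hreg : RegularAtLevel f t u) {v : ℝ} (hv : v ∈ Set.Icc (-t) t) (k : Fin 2) :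
    μH[1] {s | s ∈ square t ∧ f s = u ∧ s k = v} = 0 := by
  have := Measure.nullSingletonClass_hausdorff Plane (d := 1) one_pos
  refine Set.Finite.measure_zero ?_ _
  fin_cases k
  · refine ((finite_zeros_column hf hreg hv).image fun y => (!₂[v, y] : Plane)).subset ?_
    rintro s ⟨hs, hu, hk⟩
    have hk : s 0 = v := hk
    exact ⟨s 1, ⟨hs 1, by rw [← hk, coordFun_apply]; exact hu⟩, by rw [← hk]; exact vec_eq s⟩
  · refine ((finite_zeros_row hf hreg hv).image fun x => (!₂[x, v] : Plane)).subset ?_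
    rintro s ⟨hs, hu, hk⟩
    have hk : s 1 = v := hk
    exact ⟨s 0, ⟨hs 0, by rw [← hk, coordFun_apply]; exact hu⟩, by rw [← hk]; exact vec_eq s⟩

/-- The blocks are closed and overlap, but distinct ones meet only on grid lines, where the level
set has measure zero by `hausdorffMeasure_level_line`. If m divides N, the last blocks are
degenerate, which does no harm. -/
lemma perimeter_eq_sum {f : Plane → ℝ} (hf : ContDiff ℝ 2 f) {t u ε : ℝ}
    (hreg : RegularAtLevel f t u) (hε : 0 < ε) {N m : ℕ} (hm : 0 < m) (hN : N * ε = 2 * t) :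
    perimeter f t u = ∑ p ∈ blockIndices t ε m ×ˢ blockIndices t ε m,
      μH[1] (blockLevelSet (coordFun f) u t ε m N p) := by
  have hf1 : ContDiff ℝ 1 f := hf.of_le (by norm_num)
  have hnode : ∀ i ≤ N, node t ε i ∈ Set.Icc (-t) t := fun i hi => by
    have h1 := (node_le_node_iff (t := t) hε).2 hi
    rw [node_eq_right hN] at h1
    have : 0 ≤ (i : ℝ) * ε := by positivity
    exact ⟨by unfold node; linarith, h1⟩
  have hsub : ∀ p ∈ blockIndices t ε m ×ˢ blockIndices t ε m,
      blockLevelSet (coordFun f) u t ε m N p ⊆ square t ∩ {s | f s = u} := by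
    rintro ⟨a, b⟩ hp s ⟨h0, h1, h2⟩
    rw [Finset.mem_product, mem_blockIndices hε hN, mem_blockIndices hε hN] at hp
    rw [coordFun_apply] at h2
    refine ⟨fun k => ?_, h2⟩
    fin_cases k
    · exact ⟨(hnode a hp.1.1).1.trans h0.1, h0.2.trans (hnode _ (min_le_right _ _)).2⟩
    · exact ⟨(hnode b hp.2.1).1.trans h1.1, h1.2.trans (hnode _ (min_le_right _ _)).2⟩
  have hunion : square t ∩ {s | f s = u} =
      ⋃ p ∈ blockIndices t ε m ×ˢ blockIndices t ε m, blockLevelSet (coordFun f) u t ε m N p := by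
    refine subset_antisymm ?_ (Set.iUnion₂_subset hsub)
    rintro s ⟨hs, hu⟩
    obtain ⟨a, ha, hsa⟩ := exists_block hε hN hm (hs 0)
    obtain ⟨b, hb, hsb⟩ := exists_block hε hN hm (hs 1)
    exact Set.mem_iUnion₂.2 ⟨(a, b), Finset.mem_product.2 ⟨ha, hb⟩, hsa, hsb,
      by rw [coordFun_apply]; exact hu⟩
  have hoverlap : ∀ {a a' : ℕ} {x : ℝ}, m ∣ a → m ∣ a' → a < a' →
      x ∈ Set.Icc (node t ε a) (node t ε (min (a + m) N)) →
      x ∈ Set.Icc (node t ε a') (node t ε (min (a' + m) N)) → x = node t ε a' := by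
    rintro a a' x ⟨i, rfl⟩ ⟨j, rfl⟩ hlt hx hx'
    refine le_antisymm (hx.2.trans ((node_le_node_iff hε).2 ((min_le_left _ _).trans ?_))) hx'.1
    rw [← Nat.mul_succ]
    exact Nat.mul_le_mul_left _ (lt_of_mul_lt_mul_left' hlt)
  rw [perimeter, frontier_excursionSet hf1 hreg, hunion]
  refine measure_biUnion_finset₀ ?_ fun p _ =>
    (measurableSet_levelSet (hasPartials hf1).cont _ _ _ _ _).nullMeasurableSet
  rintro ⟨a, b⟩ hp ⟨a', b'⟩ hp' hne
  have hpp := hp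
  have hpp' := hp'
  rw [Finset.mem_coe, Finset.mem_product, mem_blockIndices hε hN, mem_blockIndices hε hN]
    at hpp hpp'
  obtain ⟨⟨ha, hma⟩, hb, hmb⟩ := hpp
  obtain ⟨⟨ha', hma'⟩, hb', hmb'⟩ := hpp'
  simp only at ha hma hb hmb ha' hma' hb' hmb'
  by_cases haa : a = a'
  · have hbb : b ≠ b' := fun h => hne (by rw [haa, h])
    rcases lt_or_gt_of_ne hbb with h | h
    · refine measure_mono_null ?_ (hausdorffMeasure_level_line hf hreg (hnode b' hb') 1)
      rintro s ⟨hs, hs'⟩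
      exact ⟨(hsub _ hp hs).1, (hsub _ hp hs).2, hoverlap hmb hmb' h hs.2.1 hs'.2.1⟩
    · refine measure_mono_null ?_ (hausdorffMeasure_level_line hf hreg (hnode b hb) 1)
      rintro s ⟨hs, hs'⟩
      exact ⟨(hsub _ hp hs).1, (hsub _ hp hs).2, hoverlap hmb' hmb h hs'.2.1 hs.2.1⟩
  · rcases lt_or_gt_of_ne haa with h | h
    · refine measure_mono_null ?_ (hausdorffMeasure_level_line hf hreg (hnode a' ha') 0)
      rintro s ⟨hs, hs'⟩
      exact ⟨(hsub _ hp hs).1, (hsub _ hp hs).2, hoverlap hma hma' h hs.1 hs'.1⟩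
    · refine measure_mono_null ?_ (hausdorffMeasure_level_line hf hreg (hnode a ha) 0)
      rintro s ⟨hs, hs'⟩
      exact ⟨(hsub _ hp hs).1, (hsub _ hp hs).2, hoverlap hma' hma h hs'.1 hs.1⟩

/-! ### The deterministic error bound -/

open Classical in
/-- The deterministic error bound for a regular function of class `C²`. -/
lemma exists_estimator_bound {f : Plane → ℝ} (hf : ContDiff ℝ 2 f) {t u : ℝ} (ht : 0 < t)
    (hreg : RegularAtLevel f t u) :
    ∃ δ₀ > 0, ∃ C : ℝ, ∀ (ε : ℝ) (m N : ℕ), 0 < ε → 0 < m → N * ε = 2 * t → m * ε ≤ δ₀ →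
      perimeter f t u ≠ ⊤ ∧
      |estimator 2 f ε m t u - (perimeter f t u).toReal| ≤ C * (1 / m + (m * ε) ^ 2) := by
  obtain ⟨c, hc0, hc⟩ := exists_lower_bound_partialDeriv (hf.of_le (by norm_num)) hreg
  obtain ⟨K, κ, η, r, κ', η', r', S, S', hη, hr, hη', hr', h, h'⟩ := exists_levelBounds hf hreg
  set F := coordFun f
  set F₁ := coordFun (partialDeriv 0 f)
  set F₂ := coordFun (partialDeriv 1 f)
  have hK := h.K_pos
  have hκ := h.κ_nonneg
  have hκ' := h'.κ_nonneg
  set q := 2 * κ * K with hq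
  set q' := 2 * κ' * K with hq'
  have hq0 : 0 ≤ q := by positivity
  have hq0' : 0 ≤ q' := by positivity
  set δ₀ := min (min t (c / (8 * K))) (min (min (η / (4 * K)) (η' / (4 * K)))
    (min (r / (2 * (q + 1))) (r' / (2 * (q' + 1))))) with hδ₀
  have hδ₀0 : 0 < δ₀ := by positivity
  set CA := 4 * t * ((16 * K * t / c + 1) * (2 * K / c + 3)) with hCA
  set CB := (S.card : ℝ) * (2 * q + 2) ^ 2 + (S'.image Prod.swap).card * (2 * q' + 2) ^ 2 with hCB
  have hCA0 : 0 ≤ CA := by positivity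
  have hCB0 : 0 ≤ CB := by positivity
  refine ⟨δ₀, hδ₀0, 2 * CA * (12 + 128 * K ^ 2 / c ^ 2) + CB * (8 * t + 12 * K / c),
    fun ε m N hε hm hN hδle => ?_⟩
  set δ := (m : ℝ) * ε with hδ
  have hm0 : (0 : ℝ) < m := by exact_mod_cast hm
  have hδ0 : 0 < δ := by positivity
  simp only [hδ₀, le_min_iff] at hδle
  obtain ⟨⟨hδt, hδc⟩, ⟨hδη, hδη'⟩, hδr, hδr'⟩ := hδle
  rw [le_div_iff₀ (by positivity)] at hδc hδη hδη' hδr hδr'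
  have hδc : 8 * K * δ ≤ c := by linarith
  have hKδ : 0 < K * δ := by positivity
  have hδη : 2 * K * δ < η := by linarith
  have hδη' : 2 * K * δ < η' := by linarith
  have hδr : (2 * κ * K + 1) * δ < r := by nlinarith [mul_pos (show 0 < q + 1 by linarith) hδ0]
  have hδr' : (2 * κ' * K + 1) * δ < r' := by
    nlinarith [mul_pos (show 0 < q' + 1 by linarith) hδ0]
  set P := blockIndices t ε m ×ˢ blockIndices t ε m with hP
  have hPmem : ∀ p ∈ P, (p.1 ≤ N ∧ m ∣ p.1) ∧ (p.2 ≤ N ∧ m ∣ p.2) := fun p hp => by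
    rwa [hP, Finset.mem_product, mem_blockIndices hε hN, mem_blockIndices hε hN] at hp
  have hIcc : ∀ i ≤ N, Set.Icc (node t ε i) (node t ε (min (i + m) N)) ⊆ Set.Icc (-t) t :=
    fun i hi => by
      refine Set.Icc_subset_Icc ?_ ?_
      · have : 0 ≤ (i : ℝ) * ε := by positivity
        unfold node; linarith
      · exact ((node_le_node_iff hε).2 (min_le_right _ _)).trans (node_eq_right hN).le
  have hwidth : ∀ i, node t ε (min (i + m) N) ≤ node t ε i + δ := fun i => by
    refine ((node_le_node_iff hε).2 (min_le_left _ _)).trans (le_of_eq ?_)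
    unfold node; push_cast; ring
  let inBlock : ℕ × ℕ → ℝ → ℝ → Prop := fun p x y =>
    x ∈ Set.Icc (node t ε p.1) (node t ε (min (p.1 + m) N)) ∧
      y ∈ Set.Icc (node t ε p.2) (node t ε (min (p.2 + m) N))
  -- A₁ and A₂ collect the O(1/δ) blocks with a level point where the indicated derivative is large;
  -- B₁ and B₂ collect the O(1) blocks near the exceptional points. A block may lie in several of
  -- them, so its error is bounded by a sum of indicators.
  set A₂ := P.filter fun p => ∃ x y, inBlock p x y ∧ F x y = u ∧ c ≤ |F₂ x y|
  set A₁ := P.filter fun p => ∃ x y, inBlock p x y ∧ F x y = u ∧ c ≤ |F₁ x y|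
  set B₁ := P.filter fun p => ∃ x y, inBlock p x y ∧
    ∃ s ∈ S, |x - s.1| ≤ q * δ ∧ |y - s.2| ≤ q * δ
  set B₂ := P.filter fun p => ∃ x y, inBlock p x y ∧
    ∃ s ∈ S'.image Prod.swap, |x - s.1| ≤ q' * δ ∧ |y - s.2| ≤ q' * δ
  have hA₂ : A₂.card * δ ≤ CA := h.card_blocks_mul_le hε hm ht hc0 hδc hδt fun p hp => by
    obtain ⟨hpP, x, y, ⟨hx, hy⟩, hF, hcF⟩ := Finset.mem_filter.1 hp
    obtain ⟨⟨h1, h2⟩, h3, h4⟩ := hPmem p hpP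
    exact ⟨h2, h4, x, hIcc _ h1 hx, y, hIcc _ h3 hy, hx.1, hx.2.trans (hwidth _), hy.1,
      hy.2.trans (hwidth _), hF, hcF⟩
  have hA₁ : A₁.card * δ ≤ CA := by
    rw [← Finset.card_image_of_injective A₁ Prod.swap_injective]
    refine h'.card_blocks_mul_le hε hm ht hc0 hδc hδt fun p' hp' => ?_
    obtain ⟨p, hp, rfl⟩ := Finset.mem_image.1 hp'
    obtain ⟨hpP, x, y, ⟨hx, hy⟩, hF, hcF⟩ := Finset.mem_filter.1 hp
    obtain ⟨⟨h1, h2⟩, h3, h4⟩ := hPmem p hpP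
    exact ⟨h4, h2, y, hIcc _ h3 hy, x, hIcc _ h1 hx, hy.1, hy.2.trans (hwidth _), hx.1,
      hx.2.trans (hwidth _), hF, hcF⟩
  have hB₁ : (B₁.card : ℝ) ≤ S.card * (2 * q + 2) ^ 2 :=
    card_near_blocks_le (t := t) hε hm hq0 fun p hp => by
      obtain ⟨hpP, x, y, ⟨hx, hy⟩, hs⟩ := Finset.mem_filter.1 hp
      obtain ⟨⟨h1, h2⟩, h3, h4⟩ := hPmem p hpP
      exact ⟨h2, h4, x, y, hx.1, hx.2.trans (hwidth _), hy.1, hy.2.trans (hwidth _), hs⟩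
  have hB₂ : (B₂.card : ℝ) ≤ (S'.image Prod.swap).card * (2 * q' + 2) ^ 2 :=
    card_near_blocks_le (t := t) hε hm hq0' fun p hp => by
      obtain ⟨hpP, x, y, ⟨hx, hy⟩, hs⟩ := Finset.mem_filter.1 hp
      obtain ⟨⟨h1, h2⟩, h3, h4⟩ := hPmem p hpP
      exact ⟨h2, h4, x, y, hx.1, hx.2.trans (hwidth _), hy.1, hy.2.trans (hwidth _), hs⟩
  set est : ℕ × ℕ → ℝ := fun p =>
    ε * √(crossings F t ε u p.1 (min (p.1 + m) (N + 1)) p.2 (min (p.2 + m) N) ^ 2 +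
      crossings (flip F) t ε u p.2 (min (p.2 + m) (N + 1)) p.1 (min (p.1 + m) N) ^ 2) with hest
  set per : ℕ × ℕ → ℝ≥0∞ := fun p => μH[1] (blockLevelSet F u t ε m N p) with hper
  set E₁ := 12 * ε + 128 * K ^ 2 / c ^ 2 * δ ^ 3 with hE₁
  set E₂ := 8 * ε + 12 * K / c * δ ^ 2 with hE₂
  have hE₁0 : 0 ≤ E₁ := by positivity
  have hE₂0 : 0 ≤ E₂ := by positivity
  have hblock : ∀ p ∈ P, per p ≠ ⊤ ∧ |est p - (per p).toReal| ≤
      (if p ∈ A₁ then E₁ else 0) + (if p ∈ A₂ then E₁ else 0) +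
      (if p ∈ B₁ then E₂ else 0) + (if p ∈ B₂ then E₂ else 0) := by
    intro p hp
    obtain ⟨⟨h1, h2⟩, h3, h4⟩ := hPmem p hp
    have n₁ : 0 ≤ (if p ∈ A₁ then E₁ else 0) := by split_ifs <;> simp [hE₁0]
    have n₂ : 0 ≤ (if p ∈ A₂ then E₁ else 0) := by split_ifs <;> simp [hE₁0]
    have n₃ : 0 ≤ (if p ∈ B₁ then E₂ else 0) := by split_ifs <;> simp [hE₂0]
    have n₄ : 0 ≤ (if p ∈ B₂ then E₂ else 0) := by split_ifs <;> simp [hE₂0]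
    have w₁ := hwidth p.1
    have w₂ := hwidth p.2
    by_cases hex : ∃ x y, inBlock p x y ∧ F x y = u
    · obtain ⟨x, y, hxy, hF⟩ := hex
      rcases hc _ (vec_mem_square (hIcc _ h1 hxy.1) (hIcc _ h3 hxy.2)) hF with hcF | hcF
      · have hpA : p ∈ A₁ := Finset.mem_filter.2 ⟨hp, x, y, hxy, hF, hcF⟩
        -- The flipped bounds interchange the two counts, which the 2-norm does not see, and
        -- preserve the length.
        obtain ⟨hfin, herr⟩ := h'.block_error hε hc0 hδ0 hδc hδη' hδr'
          (le_min (Nat.le_add_right p.2 m) h3) (by omega : min (p.2 + m) N ≤ min (p.2 + m) (N + 1))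
          (by omega) (le_min (Nat.le_add_right p.1 m) h1)
          (by omega : min (p.1 + m) N ≤ min (p.1 + m) (N + 1)) (by omega) rfl rfl rfl rfl
          (hIcc _ h3) (hIcc _ h1) (by linarith) (by linarith) hxy.2 hxy.1 hF hcF
        rw [hausdorffMeasure_levelSet_flip F, add_comm (_ ^ 2) (_ ^ 2)] at herr
        rw [hausdorffMeasure_levelSet_flip F] at hfin
        refine ⟨hfin, ?_⟩
        rcases herr with herr | ⟨⟨s, hs, hs1, hs2⟩, herr⟩
        · rw [if_pos hpA] at n₁ ⊢
          exact herr.trans (by linarith)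
        · have hpB : p ∈ B₂ := Finset.mem_filter.2
            ⟨hp, x, y, hxy, s.swap, Finset.mem_image_of_mem _ hs, hs2, hs1⟩
          rw [if_pos hpB]
          exact herr.trans (by linarith)
      · have hpA : p ∈ A₂ := Finset.mem_filter.2 ⟨hp, x, y, hxy, hF, hcF⟩
        obtain ⟨hfin, herr⟩ := h.block_error hε hc0 hδ0 hδc hδη hδr
          (le_min (Nat.le_add_right p.1 m) h1) (by omega : min (p.1 + m) N ≤ min (p.1 + m) (N + 1))
          (by omega) (le_min (Nat.le_add_right p.2 m) h3)
          (by omega : min (p.2 + m) N ≤ min (p.2 + m) (N + 1)) (by omega) rfl rfl rfl rfl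
          (hIcc _ h1) (hIcc _ h3) (by linarith) (by linarith) hxy.1 hxy.2 hF hcF
        refine ⟨hfin, ?_⟩
        rcases herr with herr | ⟨⟨s, hs, hs1, hs2⟩, herr⟩
        · rw [if_pos hpA]
          exact herr.trans (by linarith)
        · have hpB : p ∈ B₁ := Finset.mem_filter.2 ⟨hp, x, y, hxy, s, hs, hs1, hs2⟩
          rw [if_pos hpB]
          exact herr.trans (by linarith)
    -- A block that misses the level set contributes nothing to either side, since a crossing would
    -- produce a level point.
    · have hper0 : per p = 0 := by
        have : blockLevelSet F u t ε m N p = ∅ := Set.eq_empty_of_forall_notMem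
          fun s ⟨hs0, hs1, hsu⟩ => hex ⟨_, _, ⟨hs0, hs1⟩, hsu⟩
        rw [hper]; simp only [this, measure_empty]
      have hP0 := (hasPartials (hf.of_le (by norm_num : (1 : WithTop ℕ∞) ≤ 2)))
      have hcr : crossings F t ε u p.1 (min (p.1 + m) (N + 1)) p.2 (min (p.2 + m) N) = 0 := by
        refine Finset.sum_eq_zero fun i hi => Finset.sum_eq_zero fun j hj => ?_
        rw [Finset.mem_Ico] at hi hj
        rw [abs_eq_zero, sub_eq_zero]
        by_contra hne
        obtain ⟨z, hz, hzu⟩ := exists_mem_Icc_of_threshold_ne (hP0.cont_right (node t ε i))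
          ((node_le_node_iff hε).2 (Nat.le_succ j)) hne
        exact hex ⟨_, z, ⟨node_mem_Icc hε ⟨hi.1, by omega⟩,
          ((node_le_node_iff hε).2 hj.1).trans hz.1, hz.2.trans ((node_le_node_iff hε).2 hj.2)⟩, hzu⟩
      have hcr' : crossings (flip F) t ε u p.2 (min (p.2 + m) (N + 1)) p.1 (min (p.1 + m) N) = 0 := by
        refine Finset.sum_eq_zero fun i hi => Finset.sum_eq_zero fun j hj => ?_
        rw [Finset.mem_Ico] at hi hj
        rw [abs_eq_zero, sub_eq_zero]
        by_contra hne
        obtain ⟨z, hz, hzu⟩ := exists_mem_Icc_of_threshold_ne (hP0.symm.cont_right (node t ε i))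
          ((node_le_node_iff hε).2 (Nat.le_succ j)) hne
        exact hex ⟨z, _, ⟨⟨((node_le_node_iff hε).2 hj.1).trans hz.1,
          hz.2.trans ((node_le_node_iff hε).2 hj.2)⟩, node_mem_Icc hε ⟨hi.1, by omega⟩⟩, hzu⟩
      refine ⟨by simp [hper0], ?_⟩
      rw [hper0, hest]
      simp only [hcr, hcr']
      simp
      linarith
  have hpersum : perimeter f t u = ∑ p ∈ P, per p := perimeter_eq_sum hf hreg hε hm hN
  have hfin : perimeter f t u ≠ ⊤ := by
    rw [hpersum]; exact ENNReal.sum_ne_top.2 fun p hp => (hblock p hp).1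
  refine ⟨hfin, ?_⟩
  rw [hpersum, ENNReal.toReal_sum fun p hp => (hblock p hp).1, estimator_two_eq f u m hε hN,
    ← Finset.sum_sub_distrib]
  have hsum : ∀ (A : Finset (ℕ × ℕ)) (E : ℝ), A ⊆ P →
      ∑ p ∈ P, (if p ∈ A then E else 0) = A.card * E := fun A E hA => by
    rw [← Finset.sum_filter, Finset.filter_mem_eq_inter, Finset.inter_eq_right.2 hA,
      Finset.sum_const, nsmul_eq_mul]
  have htotal : |∑ p ∈ P, (est p - (per p).toReal)| ≤
      A₁.card * E₁ + A₂.card * E₁ + B₁.card * E₂ + B₂.card * E₂ := by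
    refine (Finset.abs_sum_le_sum_abs _ _).trans
      ((Finset.sum_le_sum fun p hp => (hblock p hp).2).trans (le_of_eq ?_))
    rw [Finset.sum_add_distrib, Finset.sum_add_distrib, Finset.sum_add_distrib,
      hsum _ _ (Finset.filter_subset _ _), hsum _ _ (Finset.filter_subset _ _),
      hsum _ _ (Finset.filter_subset _ _), hsum _ _ (Finset.filter_subset _ _)]
  refine htotal.trans ?_
  -- This converts errors of order ε: over O(1/δ) blocks they add up to O(1/m), and over O(1) blocks
  -- δ ≤ t suffices.
  have hεδ : ε = δ * (1 / m) := by rw [hδ]; field_simp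
  have hεt : ε ≤ t * (1 / m) := by rw [hεδ]; gcongr
  set μ : ℝ := 1 / m
  have hμ0 : 0 < μ := by positivity
  have hδ2 : 0 ≤ δ ^ 2 := by positivity
  have a1 : ∀ A : Finset (ℕ × ℕ), A.card * δ ≤ CA →
      A.card * E₁ ≤ CA * (12 + 128 * K ^ 2 / c ^ 2) * (μ + δ ^ 2) := fun A hA => by
    have e : A.card * E₁ = A.card * δ * (12 * μ + 128 * K ^ 2 / c ^ 2 * δ ^ 2) := by
      rw [hE₁]; linear_combination (12 * A.card : ℝ) * hεδ
    rw [e, mul_assoc CA]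
    have : 0 ≤ 128 * K ^ 2 / c ^ 2 := by positivity
    have h5 := mul_nonneg this hμ0.le
    exact mul_le_mul hA (by linarith) (by positivity) hCA0
  have a2 : E₂ ≤ (8 * t + 12 * K / c) * (μ + δ ^ 2) := by
    have : 0 ≤ 12 * K / c := by positivity
    have h5 := mul_nonneg this hμ0.le
    have h6 := mul_nonneg ht.le hδ2
    rw [hE₂]; linarith
  have a3 : B₁.card * E₂ + B₂.card * E₂ ≤ CB * ((8 * t + 12 * K / c) * (μ + δ ^ 2)) := by
    rw [← add_mul]
    exact mul_le_mul (add_le_add hB₁ hB₂) a2 hE₂0 hCB0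
  have := a1 A₁ hA₁
  have := a1 A₂ hA₂
  linarith

end ExcursionPerimeter

/-! ### The almost sure statement -/

open ExcursionPerimeter in
theorem theorem1 {Ω : Type*} [MeasurableSpace Ω] (P : Measure Ω) [IsProbabilityMeasure P]
    (X : ExcursionPerimeter.Plane → Ω → ℝ) (hX : ∀ s, Measurable (X s))
    (t : ℝ) (ht : 0 < t)
    -- the sample paths are of class C²
    (hC2 : ∀ ω, ContDiff ℝ 2 (fun s => X s ω))
    -- at every level, almost every sample path is regular
    (hreg : ∀ v : ℝ, ∀ᵐ ω ∂P, ExcursionPerimeter.RegularAtLevel (fun s => X s ω) t v)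
    (m : ℕ → ℕ) (hm_pos : ∀ n, 0 < m n) (hm_mono : Monotone m) (hm : Tendsto m atTop atTop)
    (ε : ℕ → ℝ) (hε : ∀ n, 0 < ε n) (C : ℝ) (hC : 0 < C)
    (hmε : Tendsto (fun n => (m n : ℝ) * (ε n) ^ (2 / 3 : ℝ)) atTop (𝓝 C))
    (hvert : ∀ n, ExcursionPerimeter.vertices t ⊆ ExcursionPerimeter.grid t (ε n))
    (u : ℝ) :
    (∀ᵐ ω ∂P, ExcursionPerimeter.perimeter (fun s => X s ω) t u ≠ ⊤) ∧
    (∀ g : ℕ → ℝ, Monotone g → g =o[atTop] (fun n => (m n : ℝ)) →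
      ∀ᵐ ω ∂P, Tendsto
        (fun n => g n * |ExcursionPerimeter.estimator 2 (fun s => X s ω) (ε n) (m n) t u
          - (ExcursionPerimeter.perimeter (fun s => X s ω) t u).toReal|)
        atTop (𝓝 0)) ∧
    (∀ᵐ ω ∂P,
      (fun n => ExcursionPerimeter.estimator 2 (fun s => X s ω) (ε n) (m n) t u
          - (ExcursionPerimeter.perimeter (fun s => X s ω) t u).toReal)
        =O[atTop] (fun n => 1 / (m n : ℝ))) := by
  have hmR : Tendsto (fun n => (m n : ℝ)) atTop atTop := tendsto_natCast_atTop_atTop.comp hm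
  have hm0 : ∀ n, (0 : ℝ) < m n := fun n => by exact_mod_cast hm_pos n
  -- The exponent 2/3 balances the two error terms: m(mε)² converges, so (mε)² is of order 1/m.
  have hcube : ∀ n, ((m n : ℝ) * (ε n) ^ (2 / 3 : ℝ)) ^ 3 = m n * (m n * ε n) ^ 2 := fun n => by
    have : ((ε n) ^ (2 / 3 : ℝ)) ^ 3 = ε n ^ 2 := by
      rw [← Real.rpow_natCast, ← Real.rpow_mul (hε n).le, ← Real.rpow_natCast (ε n) 2]
      norm_num
    rw [mul_pow, this]; ring
  have hδlim : Tendsto (fun n => (m n : ℝ) * (m n * ε n) ^ 2) atTop (𝓝 (C ^ 3)) := by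
    simpa only [hcube] using hmε.pow 3
  have hδ0 : Tendsto (fun n => (m n : ℝ) * ε n) atTop (𝓝 0) := by
    have h1 : Tendsto (fun n => (m n * ε n) ^ 2) atTop (𝓝 0) := by
      refine (hδlim.div_atTop hmR).congr fun n => ?_
      have := (hm0 n).ne'
      field_simp
    have h2 := h1.sqrt
    rw [Real.sqrt_zero] at h2
    exact h2.congr fun n => Real.sqrt_sq (mul_pos (hm0 n) (hε n)).le
  have hpath : ∀ᵐ ω ∂P, perimeter (fun s => X s ω) t u ≠ ⊤ ∧
      (fun n => estimator 2 (fun s => X s ω) (ε n) (m n) t u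
        - (perimeter (fun s => X s ω) t u).toReal) =O[atTop] (fun n => 1 / (m n : ℝ)) := by
    filter_upwards [hreg u] with ω hω
    obtain ⟨δ₀, hδ₀, B, hB⟩ := exists_estimator_bound (hC2 ω) ht hω
    have hsmall : ∀ᶠ n in atTop, (m n : ℝ) * ε n ≤ δ₀ :=
      (hδ0.eventually (gt_mem_nhds hδ₀)).mono fun n hn => hn.le
    have hbd : ∀ n, (m n : ℝ) * ε n ≤ δ₀ → perimeter (fun s => X s ω) t u ≠ ⊤ ∧
        |estimator 2 (fun s => X s ω) (ε n) (m n) t u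
          - (perimeter (fun s => X s ω) t u).toReal| ≤ B * (1 / m n + (m n * ε n) ^ 2) :=
      fun n hn => by
        obtain ⟨N, hN⟩ := exists_mul_eq_of_vertices_subset (hvert n)
        exact hB (ε n) (m n) N (hε n) (hm_pos n) hN hn
    -- The perimeter does not depend on n, so one sufficiently fine grid shows that it is finite.
    obtain ⟨n₀, hn₀⟩ := hsmall.exists
    refine ⟨(hbd n₀ hn₀).1, ?_⟩
    refine IsBigO.of_bound (|B| * (1 + (C ^ 3 + 1))) ?_
    filter_upwards [hsmall, hδlim.eventually (gt_mem_nhds (lt_add_one (C ^ 3)))] with n hn hn'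
    have h1 : (m n * ε n) ^ 2 ≤ (C ^ 3 + 1) * (1 / m n) := by
      rw [mul_one_div, le_div_iff₀ (hm0 n)]; linarith
    have h2 : (0 : ℝ) < 1 / m n := one_div_pos.2 (hm0 n)
    rw [Real.norm_eq_abs, Real.norm_eq_abs, abs_of_pos h2]
    calc _ ≤ B * (1 / m n + (m n * ε n) ^ 2) := (hbd n hn).2
      _ ≤ |B| * (1 / m n + (m n * ε n) ^ 2) := by gcongr; exact le_abs_self B
      _ ≤ |B| * (1 / m n + (C ^ 3 + 1) * (1 / m n)) := by gcongr
      _ = _ := by ring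
  refine ⟨hpath.mono fun ω h => h.1, fun g _ hg => ?_, hpath.mono fun ω h => h.2⟩
  filter_upwards [hpath] with ω hω
  have h1 := hg.mul_isBigO hω.2.abs_left
  have h2 : (fun n => (m n : ℝ) * (1 / m n)) = fun _ => (1 : ℝ) := by
    funext n; exact mul_one_div_cancel (hm0 n).ne'
  rw [h2] at h1
  exact (isLittleO_one_iff ℝ).1 h1
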